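/- Let $s>s_1>\tfrac12$, let $u$ be real-valued with $u\in L^2_s(\mathbb R)$, where $L^p_r(\mathbb R)=\{\varphi : (1+|x|)^{r}\varphi\in L^p(\mathbb R)\}$ with norm $\|(1+|x|)^r\varphi\|_{L^p}$. For $\lambda>0$ write $\boldsymbol e(x,\lambda)=e^{i\lambda x}$ and $$\widetilde G_\lambda(x)=\frac1{2\pi}\int_{-\infty}^0\frac{e^{ix\xi}}{\xi-\lambda}\,d\xi,\qquad G_{\lambda\pm0i}(x)=\pm i e^{i\lambda x}\chi_{\mathbb R^{\pm}}(x)-\widetilde G_\lambda(x),$$ the first integral being an improper (conditionally convergent) one, for $x\neq0$. For every $\lambda>0$ and each choice of sign, the integral equations $$m_1(\lambda\pm0i)=1+G_{\lambda\pm0i}*\big(u\,m_1(\lambda\pm0i)\big),\qquad m_e(\lambda\pm0i)=\boldsymbol e(\lambda)+G_{\lambda\pm0i}*\big(u\,m_e(\lambda\pm0i)\big)$$ have unique solutions $m_1(\lambda\pm 0i)=m_1(\cdot,\lambda\pm0i)$ and $m_e(\lambda\pm 0i)=m_e(\cdot,\lambda\pm0i)$ in $L^\infty_{-(s-s_1)}(\mathbb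 R)$ (the Jost solutions), and $u\,m_1(\lambda\pm0i),\,u\,m_e(\lambda\pm0i)\in L^1(\mathbb R)$. Define, for $\lambda>0$, $$\Gamma(\lambda)=1+i\int_{\mathbb R}u(x)m_e(x,\lambda+0i)e^{-i\lambda x}\,dx,\qquad \beta(\lambda)=i\int_{\mathbb R}u(x)m_1(x,\lambda+0i)e^{-i\lambda x}\,dx,$$ $$f(\lambda)=-\frac1{2\pi\lambda}\int_{\mathbb R}u(x)m_e(x,\lambda-0i)\,dx.$$ Then for every $\lambda>0$: $$1-i\int_{\mathbb R}u(x)m_e(x,\lambda-0i)e^{-i\lambda x}\,dx\neq0,\qquad \Gamma(\lambda)=\frac1{1-i\int_{\mathbb R}u(x)m_e(x,\lambda-0i)e^{-i\lambda x}\,dx},$$ $$m_e(\lambda+0i)=\Gamma(\lambda)\,m_e(\lambda-0i),$$ $$m_1(\lambda+0i)-m_1(\lambda-0i)=\beta(\lambda)\,m_e(\lambda-0i),$$ and the map $\lambda\mapsto\overline{\boldsymbol e}(\lambda)\,m_e(\lambda-0i)$ from $(0,\infty)$ to $L^\infty_{-(s-s_1)}(\mathbb R)$ is differentiable (in norm),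 with $$\boldsymbol e(\lambda)\,\partial_\lambda\big(\overline{\boldsymbol e}(\lambda)\,m_e(\lambda-0i)\big)=f(\lambda)\,m_1(\lambda-0i).$$ The identities between functions of $x$ hold in $L^\infty_{-(s-s_1)}(\mathbb R)$, i.e. almost everywhere. -/

import Mathlib

open MeasureTheory Filter Topology Set

namespace BOScattering

noncomputable section

/-- The weight `w(x) = 1 + |x|`. -/
def weight (x : ℝ) : ℝ := 1 + |x|

/-- Membership in the weighted space `L^p_r(ℝ) = {f | w^r f ∈ L^p(ℝ)}`. -/
def MemWeightedLp {E : Type*} [NormedAddCommGroup E] [NormedSpace ℝ E]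
    (p : ENNReal) (r : ℝ) (f : ℝ → E) : Prop :=
  MemLp (fun x : ℝ => (weight x ^ r) • f x) p volume

/-- The plane wave `e(x, l) = e^{i l x}`. -/
def planeWave (l x : ℝ) : ℂ := Complex.exp (Complex.I * l * x)

/-- The side from which the positive half line is approached: `upper` stands for `l + 0i`,
`lower` for `l - 0i`. -/
inductive Side : Type
  | upper : Side
  | lower : Side

/-- `G̃_l(x) = (1/2π) ∫_{-∞}^0 e^{ixξ} / (ξ - l) dξ` for `l > 0`, as an improper integral
(it converges conditionally for every `x ≠ 0`; the point `x = 0` is a null set). -/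
def tildeG (l x : ℝ) : ℂ :=
  (1 / (2 * (Real.pi : ℂ))) *
    limUnder atTop (fun R : ℝ =>
      ∫ ξ in (-R)..(0 : ℝ), Complex.exp (Complex.I * x * ξ) / ((ξ : ℂ) - (l : ℂ)))

/-- The boundary kernels `G_{l ± 0i}(x) = ± i e^{i l x} χ_{ℝ^±}(x) - G̃_l(x)`, the limits of
`G_{l ± iε}(x) = (1/2π) ∫_0^∞ e^{ixξ} / (ξ - (l ± iε)) dξ` as `ε ↘ 0`. -/
def greenKernel : Side → ℝ → ℝ → ℂ
  | Side.upper, l, x => (Ioi (0 : ℝ)).indicator (fun t => Complex.I * planeWave l t) x - tildeG l x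
  | Side.lower, l, x =>
      (Iio (0 : ℝ)).indicator (fun t => -(Complex.I * planeWave l t)) x - tildeG l x

/-- `m ∈ L^∞_{-r}(ℝ)` solves `m = g + G_{l ± 0i} * (u m)`, as an identity between elements of
`L^∞_{-r}(ℝ)` (almost everywhere), the convolution integral being absolutely convergent. -/
def SolvesJostEquation (u : ℝ → ℝ) (r : ℝ) (σ : Side) (l : ℝ) (g m : ℝ → ℂ) : Prop :=
  MemWeightedLp ⊤ (-r) m ∧
  ∀ᵐ x : ℝ, Integrable (fun y : ℝ => greenKernel σ l (x - y) * ((u y : ℂ) * m y)) ∧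
    m x = g x + ∫ y : ℝ, greenKernel σ l (x - y) * ((u y : ℂ) * m y)

/-- `m` is the Jost solution `m_1(·, l ± 0i)`. -/
def IsJostOne (u : ℝ → ℝ) (r : ℝ) (σ : Side) (l : ℝ) (m : ℝ → ℂ) : Prop :=
  SolvesJostEquation u r σ l (fun _ => 1) m

/-- `m` is the Jost solution `m_e(·, l ± 0i)`. -/
def IsJostExp (u : ℝ → ℝ) (r : ℝ) (σ : Side) (l : ℝ) (m : ℝ → ℂ) : Prop :=
  SolvesJostEquation u r σ l (planeWave l) m

/-- `∫ u(x) m(x) e^{-i l x} dx`. -/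
def pairing (u : ℝ → ℝ) (l : ℝ) (m : ℝ → ℂ) : ℂ :=
  ∫ x : ℝ, (u x : ℂ) * m x * Complex.exp (-(Complex.I * l * x))

/-- `Γ(l)`, where `m` is `m_e(·, l + 0i)`. -/
def Gam (u : ℝ → ℝ) (l : ℝ) (m : ℝ → ℂ) : ℂ := 1 + Complex.I * pairing u l m

/-- `β(l)`, where `m` is `m_1(·, l + 0i)`. -/
def bet (u : ℝ → ℝ) (l : ℝ) (m : ℝ → ℂ) : ℂ := Complex.I * pairing u l m

/-- `f(l)`, where `m` is `m_e(·, l - 0i)`. -/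
def fCoeff (u : ℝ → ℝ) (l : ℝ) (m : ℝ → ℂ) : ℂ :=
  -(1 / (2 * (Real.pi : ℂ) * (l : ℂ))) * ∫ x : ℝ, (u x : ℂ) * m x

/-- `D ∈ L^∞_{-r}(ℝ)` is the derivative at `l` of `μ ↦ F μ` in the norm of `L^∞_{-r}(ℝ)`. -/
def HasWeightedDerivAt (r : ℝ) (F : ℝ → ℝ → ℂ) (D : ℝ → ℂ) (l : ℝ) : Prop :=
  MemWeightedLp ⊤ (-r) D ∧
  Tendsto
    (fun h : ℝ => eLpNorm
      (fun x : ℝ => (weight x ^ (-r)) • (h⁻¹ • (F (l + h) x - F l x) - D x)) ⊤ volume)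
    (𝓝[≠] 0) (𝓝 0)

end

end BOScattering

open BOScattering

/-! Put `r = s - s₁`, let `w` be the weight, and write a Jost solution as `m = e^{ilx} w^r φ`.
Conjugation by the plane wave replaces `G_{l±0i}` by `K = ±i χ_{ℝ^±} + (1/2π) ∫_l^∞ e^{-ixη}/η dη`
(`modKernel_eq`), the sum of a bounded function and an `L²` function. The Jost equation becomes `φ =
ψ + T φ` on bounded continuous functions, where `T` is convolution with `K` weighted by `w^{-r}`
outside and `w^r u` inside. The outer weight makes `T` compact, so invertibility of `1 - T` reduces
to injectivity (`isUnit_one_sub_weightedConvCLM`).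

Injectivity (`eq_zero_of_homogeneous`) is the absence of embedded eigenvalues. Let `n = K * f` with
`f = u n`; since `u` is real, `conj f · n` is real. The kernel is Hermitian up to the constant `±i`,
so the imaginary part of `∬ conj f(x) K(x-y) f(y)` is a multiple of `|∫ f|²`, and `∫ f = 0`. Mean
zero and the surplus decay of `u` then bootstrap the decay of `n` until `x f` is integrable. Now `n`
has the Fourier representation `(1/2π) ∫_{-l}^∞ e^{ixη} f^(η)/η dη`. Reality of `∫ x f conj n`,
combined with the derivative of `|f^|²/η`, gives `∫_{-l}^∞ |f^/η|² = -|f^(-l)|²/l`. The two sides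
have opposite signs, so `f^` vanishes on `(-l, ∞)` and `n = 0`.

The algebraic relations follow from uniqueness. The kernels on the two sides of the cut differ by `i
e^{ilx}`, whose convolution with `u m` is a multiple of `e^{ilx}`; a solution for one sign therefore
solves the equation for the other sign with a multiple of `e^{ilx}` added to the right hand side.

For the derivative, `∂_l K = -e^{-ilx}/(2πl)` is again a character, so `∂_l T` sends the
representative of `m_e` to `f(l)` times the right hand side of the `m_1` equation. The conjugated
equation for `m_e` has right hand side `w^{-r}`, independent of `l`, so differentiating `(1 -
T)^{-1} w^{-r}` gives `f(l)` times the representative of `m_1`. -/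

namespace BOScattering

/-! ### Integral operators of convolution type -/

/-- A convolution kernel that is the sum of a bounded function, continuous away from the origin,
and a square integrable function. -/
def AdmissibleKernel (K : ℝ → ℂ) : Prop :=
  ∃ b k : ℝ → ℂ, (∀ x, K x = b x + k x) ∧ AEStronglyMeasurable b volume ∧
    (∃ C, ∀ x, ‖b x‖ ≤ C) ∧ (∀ x ≠ 0, ContinuousAt b x) ∧ MemLp k 2 volume

theorem measurePreserving_const_sub (x : ℝ) :
    MeasurePreserving (fun y : ℝ => x - y) volume volume :=
  Measure.measurePreserving_sub_left volume x

theorem memLp_const_sub {k : ℝ → ℂ} {p : ENNReal} (hk : MemLp k p volume) (x : ℝ) :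
    MemLp (fun y => k (x - y)) p volume :=
  hk.comp_measurePreserving (measurePreserving_const_sub x)

theorem aestronglyMeasurable_const_sub {k : ℝ → ℂ} (hk : AEStronglyMeasurable k volume) (x : ℝ) :
    AEStronglyMeasurable (fun y => k (x - y)) volume :=
  hk.comp_measurePreserving (measurePreserving_const_sub x)

theorem memLp_two_integrable_sq {k : ℝ → ℂ} (hk : MemLp k 2 volume) :
    Integrable (fun x => ‖k x‖ ^ 2) volume :=
  (memLp_two_iff_integrable_sq_norm hk.1).1 hk

theorem integrable_translate_mul {k v : ℝ → ℂ} (hk : MemLp k 2 volume) (hv : MemLp v 2 volume)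
    (x : ℝ) : Integrable (fun y => k (x - y) * v y) volume :=
  (memLp_const_sub hk x).integrable_mul hv

/-- The elementary inequality `ab ≤ a² + b²` is enough here: what matters is that the bound does not
depend on `x`. -/
theorem integral_norm_translate_mul_le {k v : ℝ → ℂ} (hk : MemLp k 2 volume)
    (hv : MemLp v 2 volume) (x : ℝ) :
    ∫ y, ‖k (x - y) * v y‖ ≤ (∫ y, ‖k y‖ ^ 2) + ∫ y, ‖v y‖ ^ 2 := by
  have h1 : ∫ y, ‖k y‖ ^ 2 = ∫ y, ‖k (x - y)‖ ^ 2 :=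
    (integral_sub_left_eq_self (fun y => ‖k y‖ ^ 2) volume x).symm
  have hkx := memLp_two_integrable_sq (memLp_const_sub hk x)
  rw [h1, ← integral_add hkx (memLp_two_integrable_sq hv)]
  refine integral_mono (integrable_translate_mul hk hv x).norm
    (hkx.add (memLp_two_integrable_sq hv)) fun y => ?_
  simp only [norm_mul]
  nlinarith [sq_nonneg (‖k (x - y)‖ - ‖v y‖), norm_nonneg (k (x - y)), norm_nonneg (v y)]

theorem integral_mul_le_sqrt {a v : ℝ → ℂ} (ha : MemLp a 2 volume) (hv : MemLp v 2 volume) :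
    ∫ y, ‖a y‖ * ‖v y‖ ≤ (eLpNorm a 2 volume).toReal * (eLpNorm v 2 volume).toReal := by
  have h := integral_mul_norm_le_Lp_mul_Lq (f := a) (g := v) (μ := volume)
    Real.HolderConjugate.two_two (by simpa using ha) (by simpa using hv)
  rw [ha.eLpNorm_eq_integral_rpow_norm two_ne_zero ENNReal.ofNat_ne_top,
    hv.eLpNorm_eq_integral_rpow_norm two_ne_zero ENNReal.ofNat_ne_top,
    ENNReal.toReal_ofReal (by positivity), ENNReal.toReal_ofReal (by positivity)]
  simpa using h

theorem AdmissibleKernel.integrable {K q : ℝ → ℂ} (hK : AdmissibleKernel K)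
    (hq : Integrable q volume) (hq2 : MemLp q 2 volume) (x : ℝ) :
    Integrable (fun y => K (x - y) * q y) volume := by
  obtain ⟨b, k, hbk, hb, ⟨C, hC⟩, -, hk⟩ := hK
  have h1 : Integrable (fun y => b (x - y) * q y) volume :=
    hq.bdd_mul (aestronglyMeasurable_const_sub hb x) (Eventually.of_forall fun y => hC _)
  refine (h1.add (integrable_translate_mul hk hq2 x)).congr (Eventually.of_forall fun y => ?_)
  simp [hbk, add_mul]

theorem AdmissibleKernel.exists_bound {K q : ℝ → ℂ} (hK : AdmissibleKernel K)
    (hq : Integrable q volume) (hq2 : MemLp q 2 volume) :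
    ∃ M, 0 ≤ M ∧ ∀ x, ∫ y, ‖K (x - y) * q y‖ ≤ M := by
  have hi := fun x => hK.integrable hq hq2 x
  obtain ⟨b, k, hbk, hb, ⟨C, hC⟩, -, hk⟩ := hK
  have hC0 : 0 ≤ C := (norm_nonneg _).trans (hC 0)
  refine ⟨C * (∫ y, ‖q y‖) + ((∫ y, ‖k y‖ ^ 2) + ∫ y, ‖q y‖ ^ 2), by positivity, fun x => ?_⟩
  calc ∫ y, ‖K (x - y) * q y‖
      ≤ ∫ y, (C * ‖q y‖ + ‖k (x - y) * q y‖) := by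
        refine integral_mono (hi x).norm
          ((hq.norm.const_mul C).add (integrable_translate_mul hk hq2 x).norm) fun y => ?_
        simp only [hbk, add_mul]
        refine (norm_add_le _ _).trans ?_
        gcongr
        rw [norm_mul]
        gcongr
        exact hC _
    _ = C * (∫ y, ‖q y‖) + ∫ y, ‖k (x - y) * q y‖ := by
        rw [integral_add (hq.norm.const_mul C) (integrable_translate_mul hk hq2 x).norm,
          integral_const_mul]
    _ ≤ _ := by
        gcongr
        exact integral_norm_translate_mul_le hk hq2 x

/-- Translation is continuous in `L²`. -/
theorem tendsto_eLpNorm_translate {k : ℝ → ℂ} (hk : MemLp k 2 volume) (x₀ : ℝ) :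
    Tendsto (fun x => (eLpNorm (fun y => k (x - y) - k (x₀ - y)) 2 volume).toReal)
      (𝓝 x₀) (𝓝 0) := by
  let g : ℝ → C(ℝ, ℝ) := fun x => ⟨fun y => x - y, by fun_prop⟩
  have hg : Continuous g :=
    ContinuousMap.continuous_of_continuous_uncurry g (by
      simp only [Function.uncurry_def, g, ContinuousMap.coe_mk]; fun_prop)
  have hgm : ∀ x, MeasurePreserving (g x) volume volume := fun x => measurePreserving_const_sub x
  have : Fact ((1 : ENNReal) ≤ 2) := ⟨one_le_two⟩
  have hc := (continuous_const (y := hk.toLp k)).compMeasurePreservingLp hg hgm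
    ENNReal.ofNat_ne_top
  have h0 := tendsto_iff_norm_sub_tendsto_zero.1 (hc.tendsto x₀)
  refine h0.congr fun x => ?_
  rw [Lp.norm_def]
  congr 1
  refine eLpNorm_congr_ae ?_
  have e : ∀ z, Lp.compMeasurePreserving (g z) (hgm z) (hk.toLp k) =ᵐ[volume]
      fun y => k (z - y) := fun z =>
    (Lp.coeFn_compMeasurePreserving _ (hgm z)).trans
      ((hgm z).quasiMeasurePreserving.ae_eq_comp hk.coeFn_toLp)
  filter_upwards [Lp.coeFn_sub (Lp.compMeasurePreserving (g x) (hgm x) (hk.toLp k))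
    (Lp.compMeasurePreserving (g x₀) (hgm x₀) (hk.toLp k)), e x, e x₀] with y h1 h2 h3
  rw [h1, Pi.sub_apply, h2, h3]

/-- For the bounded part, dominated convergence applies because continuity of `b` at `x₀ - y` fails
at most for `y = x₀`. For the `L²` part, Cauchy–Schwarz reduces the claim to continuity of
translation. The result is a modulus of continuity that serves all bounded `φ` at once. -/
theorem AdmissibleKernel.tendsto_integral_sub {K q : ℝ → ℂ} (hK : AdmissibleKernel K)
    (hq : Integrable q volume) (hq2 : MemLp q 2 volume) (x₀ : ℝ) :
    Tendsto (fun x => ∫ y, ‖K (x - y) * q y - K (x₀ - y) * q y‖) (𝓝 x₀) (𝓝 0) := by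
  have hi := fun x => hK.integrable hq hq2 x
  obtain ⟨b, k, hbk, hb, ⟨C, hC⟩, hbc, hk⟩ := hK
  have hC0 : 0 ≤ C := (norm_nonneg _).trans (hC 0)
  have hbi : ∀ x, Integrable (fun y => b (x - y) * q y) volume := fun x =>
    hq.bdd_mul (aestronglyMeasurable_const_sub hb x) (Eventually.of_forall fun y => hC _)
  have hki := fun x => integrable_translate_mul hk hq2 x
  have t1 : Tendsto (fun x => ∫ y, ‖b (x - y) * q y - b (x₀ - y) * q y‖) (𝓝 x₀) (𝓝 0) := by
    have := tendsto_integral_filter_of_dominated_convergence (μ := volume) (l := 𝓝 x₀)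
      (F := fun x y => ‖b (x - y) * q y - b (x₀ - y) * q y‖) (f := fun _ => (0 : ℝ))
      (fun y => 2 * C * ‖q y‖)
      (Eventually.of_forall fun x => ((hbi x).sub (hbi x₀)).norm.aestronglyMeasurable)
      (Eventually.of_forall fun x => Eventually.of_forall fun y => by
        rw [← sub_mul, norm_norm, norm_mul]
        gcongr
        refine (norm_sub_le _ _).trans ?_
        linarith [hC (x - y), hC (x₀ - y)])
      (hq.norm.const_mul _)
      (by
        filter_upwards [compl_mem_ae_iff.2 (measure_singleton x₀)] with y hy
        have hy' : x₀ - y ≠ 0 := fun h => hy (by simpa using (sub_eq_zero.1 h).symm)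
        have hcont : ContinuousAt (fun x => b (x - y)) x₀ :=
          ContinuousAt.comp (f := fun x : ℝ => x - y) (hbc _ hy') (by fun_prop)
        have h2 : Tendsto (fun x => ‖b (x - y) * q y - b (x₀ - y) * q y‖) (𝓝 x₀)
            (𝓝 ‖b (x₀ - y) * q y - b (x₀ - y) * q y‖) :=
          ((hcont.tendsto.mul_const _).sub_const _).norm
        simpa using h2)
    simpa using this
  have t2 : Tendsto (fun x => (eLpNorm (fun y => k (x - y) - k (x₀ - y)) 2 volume).toReal *
      (eLpNorm q 2 volume).toReal) (𝓝 x₀) (𝓝 0) := by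
    simpa using (tendsto_eLpNorm_translate hk x₀).mul_const (eLpNorm q 2 volume).toReal
  refine squeeze_zero (fun x => by positivity) (fun x => ?_) (by simpa using t1.add t2)
  have hksub : MemLp (fun y => k (x - y) - k (x₀ - y)) 2 volume :=
    (memLp_const_sub hk x).sub (memLp_const_sub hk x₀)
  have hi3 : Integrable (fun y => ‖k (x - y) - k (x₀ - y)‖ * ‖q y‖) volume :=
    (((hki x).sub (hki x₀)).norm).congr (Eventually.of_forall fun y => by
      simp [← sub_mul])
  calc ∫ y, ‖K (x - y) * q y - K (x₀ - y) * q y‖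
      ≤ ∫ y, (‖b (x - y) * q y - b (x₀ - y) * q y‖ + ‖k (x - y) - k (x₀ - y)‖ * ‖q y‖) := by
        refine integral_mono ((hi x).sub (hi x₀)).norm
          (((hbi x).sub (hbi x₀)).norm.add hi3) fun y => ?_
        simp only [hbk]
        rw [← norm_mul]
        refine le_trans (le_of_eq ?_) (norm_add_le _ _)
        congr 1
        ring
    _ = (∫ y, ‖b (x - y) * q y - b (x₀ - y) * q y‖) +
        ∫ y, ‖k (x - y) - k (x₀ - y)‖ * ‖q y‖ :=
        integral_add ((hbi x).sub (hbi x₀)).norm hi3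
    _ ≤ _ := by
        gcongr
        exact integral_mul_le_sqrt hksub hq2

end BOScattering

namespace BOScattering

open scoped BoundedContinuousFunction

/-! ### Weights and weighted convolution operators -/

theorem one_le_weight (x : ℝ) : 1 ≤ weight x := by
  unfold weight; linarith [abs_nonneg x]

theorem weight_pos (x : ℝ) : 0 < weight x := zero_lt_one.trans_le (one_le_weight x)

theorem continuous_weight_rpow (r : ℝ) : Continuous fun x => weight x ^ r := by
  refine Continuous.rpow_const ?_ fun x => Or.inl (weight_pos x).ne'
  unfold weight
  fun_prop

theorem weight_rpow_pos (r x : ℝ) : 0 < weight x ^ r := Real.rpow_pos_of_pos (weight_pos x) r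

theorem weight_rpow_neg_le_one {r : ℝ} (hr : 0 ≤ r) (x : ℝ) : weight x ^ (-r) ≤ 1 :=
  Real.rpow_le_one_of_one_le_of_nonpos (one_le_weight x) (by linarith)

theorem weight_rpow_mul_neg (r x : ℝ) : weight x ^ r * weight x ^ (-r) = 1 := by
  rw [← Real.rpow_add (weight_pos x)]; simp

theorem tendsto_weight_rpow_neg {r : ℝ} (hr : 0 < r) :
    Tendsto (fun x => weight x ^ (-r)) (cocompact ℝ) (𝓝 0) := by
  refine (tendsto_rpow_neg_atTop hr).comp ?_
  exact tendsto_atTop_add_const_left _ _ (tendsto_norm_cocompact_atTop (E := ℝ))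

/-- The weighted convolution `x ↦ w(x)^{-r} ∫ K(x - y) q(y) φ(y) dy`. -/
noncomputable def weightedConv (K q : ℝ → ℂ) (r : ℝ) (φ : ℝ → ℂ) (x : ℝ) : ℂ :=
  ((weight x ^ (-r) : ℝ) : ℂ) * ∫ y, K (x - y) * q y * φ y

theorem integrable_mul_bcf {g : ℝ → ℂ} (hg : Integrable g volume) (φ : ℝ →ᵇ ℂ) :
    Integrable (fun y => g y * φ y) volume := by
  refine (hg.bdd_mul (c := ‖φ‖) φ.continuous.aestronglyMeasurable
    (Eventually.of_forall fun y => φ.norm_coe_le_norm y)).congr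
    (Eventually.of_forall fun y => mul_comm _ _)

theorem norm_integral_mul_bcf_le {g : ℝ → ℂ} (hg : Integrable g volume) (φ : ℝ →ᵇ ℂ) :
    ‖∫ y, g y * φ y‖ ≤ (∫ y, ‖g y‖) * ‖φ‖ := by
  rw [← integral_mul_const]
  refine norm_integral_le_of_norm_le (hg.norm.mul_const _) (Eventually.of_forall fun y => ?_)
  rw [norm_mul]
  gcongr
  exact φ.norm_coe_le_norm y

variable {K q : ℝ → ℂ} {r : ℝ}

theorem norm_weightedConv_le (hK : AdmissibleKernel K) (hq : Integrable q volume)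
    (hq2 : MemLp q 2 volume) (φ : ℝ →ᵇ ℂ) (x : ℝ) :
    ‖weightedConv K q r φ x‖ ≤ (weight x ^ (-r) * ∫ y, ‖K (x - y) * q y‖) * ‖φ‖ := by
  unfold weightedConv
  rw [norm_mul, Complex.norm_real, Real.norm_of_nonneg (weight_rpow_pos _ _).le, mul_assoc]
  gcongr
  · exact (weight_rpow_pos _ _).le
  · exact norm_integral_mul_bcf_le (hK.integrable hq hq2 x) φ

theorem norm_integral_sub_le (hK : AdmissibleKernel K) (hq : Integrable q volume)
    (hq2 : MemLp q 2 volume) (φ : ℝ →ᵇ ℂ) (x x₀ : ℝ) :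
    ‖(∫ y, K (x - y) * q y * φ y) - ∫ y, K (x₀ - y) * q y * φ y‖ ≤
      (∫ y, ‖K (x - y) * q y - K (x₀ - y) * q y‖) * ‖φ‖ := by
  have hi := fun x => hK.integrable hq hq2 x
  rw [← integral_sub (integrable_mul_bcf (hi x) φ) (integrable_mul_bcf (hi x₀) φ)]
  simp only [← sub_mul (_ * _) (_ * _)]
  exact norm_integral_mul_bcf_le ((hi x).sub (hi x₀)) φ

theorem continuous_integral_mul_bcf (hK : AdmissibleKernel K) (hq : Integrable q volume)
    (hq2 : MemLp q 2 volume) (φ : ℝ →ᵇ ℂ) :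
    Continuous fun x => ∫ y, K (x - y) * q y * φ y := by
  rw [continuous_iff_continuousAt]
  intro x₀
  rw [ContinuousAt, tendsto_iff_norm_sub_tendsto_zero]
  refine squeeze_zero (fun x => norm_nonneg _)
    (fun x => norm_integral_sub_le hK hq hq2 φ x x₀) ?_
  simpa using (hK.tendsto_integral_sub hq hq2 x₀).mul_const ‖φ‖

theorem continuous_weightedConv (hK : AdmissibleKernel K) (hq : Integrable q volume)
    (hq2 : MemLp q 2 volume) (φ : ℝ →ᵇ ℂ) : Continuous (weightedConv K q r φ) :=
  (Complex.continuous_ofReal.comp (continuous_weight_rpow (-r))).mul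
    (continuous_integral_mul_bcf hK hq hq2 φ)

theorem norm_weightedConv_le_choose (hr : 0 ≤ r) (hK : AdmissibleKernel K)
    (hq : Integrable q volume) (hq2 : MemLp q 2 volume) (φ : ℝ →ᵇ ℂ) (x : ℝ) :
    ‖weightedConv K q r φ x‖ ≤ (hK.exists_bound hq hq2).choose * ‖φ‖ := by
  refine (norm_weightedConv_le hK hq hq2 φ x).trans ?_
  gcongr
  refine (mul_le_of_le_one_left (by positivity) (weight_rpow_neg_le_one hr x)).trans ?_
  exact (hK.exists_bound hq hq2).choose_spec.2 x

/-- The operator `weightedConv K q r` on bounded continuous functions. -/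
noncomputable def weightedConvCLM (hr : 0 ≤ r) (hK : AdmissibleKernel K)
    (hq : Integrable q volume) (hq2 : MemLp q 2 volume) : (ℝ →ᵇ ℂ) →L[ℂ] (ℝ →ᵇ ℂ) :=
  LinearMap.mkContinuous
    { toFun := fun φ => BoundedContinuousFunction.ofNormedAddCommGroup (weightedConv K q r φ)
        (continuous_weightedConv hK hq hq2 φ) ((hK.exists_bound hq hq2).choose * ‖φ‖) 
        (norm_weightedConv_le_choose hr hK hq hq2 φ)
      map_add' := fun φ ψ => by
        ext x
        simp only [BoundedContinuousFunction.coe_ofNormedAddCommGroup, weightedConv,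
          BoundedContinuousFunction.add_apply, mul_add]
        rw [integral_add (integrable_mul_bcf (hK.integrable hq hq2 x) φ)
          (integrable_mul_bcf (hK.integrable hq hq2 x) ψ), mul_add]
      map_smul' := fun c φ => by
        ext x
        simp only [BoundedContinuousFunction.coe_ofNormedAddCommGroup, weightedConv,
          BoundedContinuousFunction.smul_apply, smul_eq_mul, RingHom.id_apply]
        have h : ∫ y, K (x - y) * q y * (c * φ y) = c * ∫ y, K (x - y) * q y * φ y := by
          rw [← integral_const_mul]
          exact integral_congr_ae (Eventually.of_forall fun y => mul_left_comm _ _ _)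
        rw [h, mul_left_comm] }
    (hK.exists_bound hq hq2).choose (fun φ =>
      BoundedContinuousFunction.norm_ofNormedAddCommGroup_le _ (mul_nonneg
        (hK.exists_bound hq hq2).choose_spec.1 (norm_nonneg _))
        (norm_weightedConv_le_choose hr hK hq hq2 φ))

@[simp] theorem weightedConvCLM_apply (hr : 0 ≤ r) (hK : AdmissibleKernel K)
    (hq : Integrable q volume) (hq2 : MemLp q 2 volume) (φ : ℝ →ᵇ ℂ) (x : ℝ) :
    weightedConvCLM hr hK hq hq2 φ x = weightedConv K q r φ x := rfl

/-! ### Compactness and the Fredholm alternative -/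

/-- Uniform decay lets every `T φ` extend by `0` to the one-point compactification, where
Arzelà–Ascoli is available: `hloc` gives equicontinuity at finite points and `hinf` gives it at
infinity. Restriction back to the line is continuous and carries the compact set along. -/
theorem isCompactOperator_of_equicontinuous (T : (ℝ →ᵇ ℂ) →L[ℂ] (ℝ →ᵇ ℂ))
    (hloc : ∀ x₀, ∃ ω : ℝ → ℝ, Tendsto ω (𝓝 x₀) (𝓝 0) ∧
      ∀ φ : ℝ →ᵇ ℂ, ∀ x, ‖T φ x - T φ x₀‖ ≤ ω x * ‖φ‖)
    (hinf : ∃ ω : ℝ → ℝ, Tendsto ω (cocompact ℝ) (𝓝 0) ∧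
      ∀ φ : ℝ →ᵇ ℂ, ∀ x, ‖T φ x‖ ≤ ω x * ‖φ‖) : IsCompactOperator T := by
  obtain ⟨ω, hω, hωT⟩ := hinf
  have hlim : ∀ φ : ℝ →ᵇ ℂ, Tendsto (T φ) (coclosedCompact ℝ) (𝓝 0) := fun φ => by
    rw [coclosedCompact_eq_cocompact]
    exact squeeze_zero_norm (hωT φ) (by simpa using hω.mul_const ‖φ‖)
  let e : (ℝ →ᵇ ℂ) → (OnePoint ℝ →ᵇ ℂ) := fun φ =>
    BoundedContinuousFunction.mkOfCompact (OnePoint.continuousMapMk (T φ).toContinuousMap 0 (hlim φ))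
  have he : ∀ φ (x : ℝ), e φ x = T φ x := fun φ x => rfl
  have he' : ∀ φ, e φ OnePoint.infty = 0 := fun φ => rfl
  let A : Set (OnePoint ℝ →ᵇ ℂ) := e '' Metric.closedBall 0 1
  have hA : IsCompact (closure A) := by
    refine BoundedContinuousFunction.arzela_ascoli (Metric.closedBall 0 ‖T‖)
      (isCompact_closedBall _ _) A ?_ ?_
    · rintro _ x ⟨φ, hφ, rfl⟩
      rw [mem_closedBall_zero_iff] at hφ ⊢
      induction x using OnePoint.rec with
      | infty => rw [he', norm_zero]; positivity
      | coe x =>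
        rw [he]
        exact ((T φ).norm_coe_le_norm x).trans ((T.le_opNorm φ).trans
          (mul_le_of_le_one_right (norm_nonneg _) hφ))
    · intro x₀
      have key : ∃ W : OnePoint ℝ → ℝ, Tendsto W (𝓝 x₀) (𝓝 0) ∧
          ∀ φ ∈ Metric.closedBall (0 : ℝ →ᵇ ℂ) 1, ∀ x, ‖e φ x - e φ x₀‖ ≤ W x := by
        induction x₀ using OnePoint.rec with
        | infty =>
          refine ⟨fun x => OnePoint.elim x 0 (fun x => |ω x|), ?_, ?_⟩
          · rw [OnePoint.tendsto_nhds_infty']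
            refine ⟨tendsto_pure_nhds _ _, ?_⟩
            rw [coclosedCompact_eq_cocompact]
            have := hω.abs
            rw [abs_zero] at this
            exact this
          · intro φ hφ x
            rw [mem_closedBall_zero_iff] at hφ
            rw [he', sub_zero]
            induction x using OnePoint.rec with
            | infty => rw [he', norm_zero]; exact le_rfl
            | coe x =>
              rw [he]
              refine (hωT φ x).trans ((mul_le_mul_of_nonneg_right (le_abs_self _)
                (norm_nonneg _)).trans ?_)
              exact mul_le_of_le_one_right (abs_nonneg _) hφ
        | coe x₀ =>
          obtain ⟨ν, hν, hνT⟩ := hloc x₀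
          -- The value at infinity does not affect the limit at the finite point `x₀`; it only has
          -- to dominate `‖T φ x₀‖`.
          refine ⟨fun x => OnePoint.elim x (2 * ‖T‖) (fun x => |ν x|), ?_, ?_⟩
          · rw [OnePoint.nhds_coe_eq, tendsto_map'_iff]
            have := hν.abs
            rw [abs_zero] at this
            exact this
          · intro φ hφ x
            rw [mem_closedBall_zero_iff] at hφ
            induction x using OnePoint.rec with
            | infty =>
              rw [he', he, zero_sub, norm_neg]
              refine ((T φ).norm_coe_le_norm x₀).trans ((T.le_opNorm φ).trans
                ((mul_le_of_le_one_right (norm_nonneg _) hφ).trans ?_))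
              change ‖T‖ ≤ 2 * ‖T‖
              linarith [norm_nonneg T]
            | coe x =>
              rw [he, he]
              refine (hνT φ x).trans ((mul_le_mul_of_nonneg_right (le_abs_self _)
                (norm_nonneg _)).trans ?_)
              exact mul_le_of_le_one_right (abs_nonneg _) hφ
      obtain ⟨W, hW, hWe⟩ := key
      refine Metric.equicontinuousAt_of_continuity_modulus W hW _ (Eventually.of_forall ?_)
      rintro x ⟨_, φ, hφ, rfl⟩
      rw [dist_comm, dist_eq_norm]
      exact hWe φ hφ x
  let ρ : (OnePoint ℝ →ᵇ ℂ) → (ℝ →ᵇ ℂ) := fun g =>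
    g.compContinuous ⟨OnePoint.some, OnePoint.continuous_coe⟩
  have hρ : Continuous ρ := BoundedContinuousFunction.continuous_compContinuous _
  refine (isCompactOperator_iff_image_closedBall_subset_compact (𝕜₁ := ℂ) (𝕜₂ := ℂ)
    (σ₁₂ := RingHom.id ℂ) (T : (ℝ →ᵇ ℂ) →ₗ[ℂ] (ℝ →ᵇ ℂ)) zero_lt_one).2 ⟨ρ '' closure A, hA.image hρ, ?_⟩
  rintro _ ⟨φ, hφ, rfl⟩
  refine ⟨e φ, subset_closure ⟨φ, hφ, rfl⟩, ?_⟩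
  ext x
  rfl

/-- The unweighted integral is bounded uniformly in `x`, so the factor `w^{-r}` alone supplies the
decay at infinity; this is where `r > 0` is needed. -/
theorem isCompactOperator_weightedConvCLM (hr : 0 < r) (hK : AdmissibleKernel K)
    (hq : Integrable q volume) (hq2 : MemLp q 2 volume) :
    IsCompactOperator (weightedConvCLM hr.le hK hq hq2) := by
  obtain ⟨M, hM0, hM⟩ := hK.exists_bound hq hq2
  refine isCompactOperator_of_equicontinuous _ (fun x₀ => ?_)
    ⟨fun x => weight x ^ (-r) * M, by simpa using (tendsto_weight_rpow_neg hr).mul_const M,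
      fun φ x => ?_⟩
  · refine ⟨fun x => (∫ y, ‖K (x - y) * q y - K (x₀ - y) * q y‖) +
      |weight x ^ (-r) - weight x₀ ^ (-r)| * M, ?_, fun φ x => ?_⟩
    · have h1 : Tendsto (fun x => |weight x ^ (-r) - weight x₀ ^ (-r)| * M) (𝓝 x₀) (𝓝 0) := by
        have := ((((continuous_weight_rpow (-r)).tendsto x₀).sub_const
          (weight x₀ ^ (-r))).abs).mul_const M
        simpa using this
      simpa using (hK.tendsto_integral_sub hq hq2 x₀).add h1
    · simp only [weightedConvCLM_apply, weightedConv]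
      have e : ∀ a b I J : ℂ, a * I - b * J = a * (I - J) + (a - b) * J := by intros; ring
      rw [e, add_mul]
      refine (norm_add_le _ _).trans (add_le_add ?_ ?_)
      · rw [norm_mul, Complex.norm_real, Real.norm_of_nonneg (weight_rpow_pos _ _).le]
        refine (mul_le_of_le_one_left (norm_nonneg _) (weight_rpow_neg_le_one hr.le x)).trans ?_
        exact norm_integral_sub_le hK hq hq2 φ x x₀
      · rw [norm_mul, ← Complex.ofReal_sub, Complex.norm_real, Real.norm_eq_abs, mul_assoc]
        gcongr
        exact (norm_integral_mul_bcf_le (hK.integrable hq hq2 x₀) φ).trans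
          (mul_le_mul_of_nonneg_right (hM x₀) (norm_nonneg _))
  · rw [weightedConvCLM_apply]
    refine (norm_weightedConv_le hK hq hq2 φ x).trans ?_
    exact mul_le_mul_of_nonneg_right (mul_le_mul_of_nonneg_left (hM x)
      (weight_rpow_pos _ _).le) (norm_nonneg _)

/-- Fredholm alternative for `1 - T` with `T` a weighted convolution operator. -/
theorem isUnit_one_sub_weightedConvCLM (hr : 0 < r) (hK : AdmissibleKernel K)
    (hq : Integrable q volume) (hq2 : MemLp q 2 volume)
    (hinj : ∀ φ : ℝ →ᵇ ℂ, weightedConvCLM hr.le hK hq hq2 φ = φ → φ = 0) :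
    IsUnit (1 - weightedConvCLM hr.le hK hq hq2) := by
  rcases (isCompactOperator_weightedConvCLM hr hK hq hq2).hasEigenvalue_or_mem_resolventSet
    one_ne_zero with h | h
  · obtain ⟨φ, hφ⟩ := h.exists_hasEigenvector
    exact absurd (hinj φ (by simpa using hφ.apply_eq_smul)) hφ.2
  · simpa [spectrum.mem_resolventSet_iff] using h

end BOScattering

namespace BOScattering

/-! ### The oscillatory integral `∫_l^∞ e^{-ixη} / η dη` -/

/-- The truncated oscillatory integral `∫_a^R e^{-ixη} / η dη`. -/
noncomputable def oscTrunc (a R x : ℝ) : ℂ :=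
  ∫ η in a..R, Complex.exp (-(Complex.I * x * η)) / η

/-- The improper integral `∫_a^∞ e^{-ixη} / η dη`. -/
noncomputable def oscLim (a x : ℝ) : ℂ := limUnder atTop fun R => oscTrunc a R x

theorem norm_exp_neg_I_mul (x η : ℝ) : ‖Complex.exp (-(Complex.I * x * η))‖ = 1 := by
  rw [Complex.norm_exp]
  simp

theorem uIcc_pos {a b η : ℝ} (ha : 0 < a) (hb : 0 < b) (hη : η ∈ uIcc a b) : 0 < η :=
  (lt_min ha hb).trans_le hη.1

theorem intervalIntegrable_osc {a b : ℝ} (ha : 0 < a) (hb : 0 < b) (x : ℝ) :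
    IntervalIntegrable (fun η : ℝ => Complex.exp (-(Complex.I * x * η)) / η) volume a b := by
  refine ContinuousOn.intervalIntegrable fun η hη => ContinuousAt.continuousWithinAt ?_
  have : (η : ℂ) ≠ 0 := by exact_mod_cast (uIcc_pos ha hb hη).ne'
  fun_prop (disch := assumption)

theorem oscTrunc_add {a b c : ℝ} (ha : 0 < a) (hb : 0 < b) (hc : 0 < c) (x : ℝ) :
    oscTrunc a b x + oscTrunc b c x = oscTrunc a c x :=
  intervalIntegral.integral_add_adjacent_intervals (intervalIntegrable_osc ha hb x)
    (intervalIntegrable_osc hb hc x)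

theorem norm_oscTrunc_le_log {a R : ℝ} (ha : 0 < a) (haR : a ≤ R) (x : ℝ) :
    ‖oscTrunc a R x‖ ≤ Real.log (R / a) := by
  rw [← integral_inv_of_pos ha (ha.trans_le haR)]
  refine intervalIntegral.norm_integral_le_of_norm_le haR
    (Eventually.of_forall fun η hη => ?_) ?_
  · rw [norm_div, norm_exp_neg_I_mul, Complex.norm_real, Real.norm_of_nonneg (ha.trans hη.1).le,
      one_div]
  · exact intervalIntegral.intervalIntegrable_inv (fun η hη =>
      (uIcc_pos ha (ha.trans_le haR) hη).ne') continuousOn_id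

/-- One integration by parts. The boundary terms cost `(R⁻¹ + a⁻¹)/|x|` and the remaining integral
`(a⁻¹ - R⁻¹)/|x|`, so `R` drops out of the sum. -/
theorem norm_oscTrunc_le {a R x : ℝ} (ha : 0 < a) (haR : a ≤ R) (hx : x ≠ 0) :
    ‖oscTrunc a R x‖ ≤ 2 / (a * |x|) := by
  have hR : 0 < R := ha.trans_le haR
  have hxa : 0 < |x| := abs_pos.2 hx
  have hxc : (x : ℂ) ≠ 0 := by exact_mod_cast hx
  have hu : ∀ η ∈ uIcc a R, HasDerivAt (fun η : ℝ => ((η⁻¹ : ℝ) : ℂ)) ((-(η ^ 2)⁻¹ : ℝ) : ℂ) η :=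
    fun η hη => (hasDerivAt_inv (uIcc_pos ha hR hη).ne').ofReal_comp
  have hv : ∀ η ∈ uIcc a R, HasDerivAt
      (fun η : ℝ => Complex.exp (-(Complex.I * x * η)) / (-(Complex.I * x)))
      (Complex.exp (-(Complex.I * x * η))) η := fun η _ => by
    have h1 : HasDerivAt (fun η : ℝ => -(Complex.I * x * (η : ℂ))) (-(Complex.I * x * 1)) η :=
      ((hasDerivAt_id (η : ℂ)).comp_ofReal.const_mul _).neg
    refine (h1.cexp.div_const _).congr_deriv ?_
    have : Complex.I * x ≠ 0 := mul_ne_zero Complex.I_ne_zero hxc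
    field_simp
  have hcont : ContinuousOn (fun η : ℝ => ((-(η ^ 2)⁻¹ : ℝ) : ℂ)) (uIcc a R) := by
    refine Complex.continuous_ofReal.comp_continuousOn (ContinuousOn.neg (ContinuousOn.inv₀
      (by fun_prop) fun η hη => ?_))
    exact pow_ne_zero 2 (uIcc_pos ha hR hη).ne'
  have key := intervalIntegral.integral_mul_deriv_eq_deriv_mul hu hv hcont.intervalIntegrable
    (Continuous.intervalIntegrable (by fun_prop) _ _)
  have e : oscTrunc a R x = ∫ η in a..R, ((η⁻¹ : ℝ) : ℂ) * Complex.exp (-(Complex.I * x * η)) := by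
    unfold oscTrunc
    refine intervalIntegral.integral_congr fun η _ => ?_
    simp only [Complex.ofReal_inv]
    rw [div_eq_mul_inv, mul_comm]
  have nv : ∀ η : ℝ, ‖Complex.exp (-(Complex.I * x * η)) / (-(Complex.I * x))‖ = |x|⁻¹ := fun η => by
    rw [norm_div, norm_exp_neg_I_mul, norm_neg, norm_mul, Complex.norm_I, Complex.norm_real,
      Real.norm_eq_abs, one_mul, one_div]
  have b3 : ‖∫ η in a..R, ((-(η ^ 2)⁻¹ : ℝ) : ℂ) *
      (Complex.exp (-(Complex.I * x * η)) / (-(Complex.I * x)))‖ ≤ (a⁻¹ - R⁻¹) * |x|⁻¹ := by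
    have hint : ∫ η in a..R, (η ^ 2)⁻¹ * |x|⁻¹ = (a⁻¹ - R⁻¹) * |x|⁻¹ := by
      rw [intervalIntegral.integral_mul_const]
      congr 1
      have := intervalIntegral.integral_eq_sub_of_hasDerivAt (a := a) (b := R)
        (f := fun η : ℝ => -η⁻¹) (f' := fun η : ℝ => (η ^ 2)⁻¹) (fun η hη => by
          have := (hasDerivAt_inv (uIcc_pos ha hR hη).ne').neg
          rw [neg_neg] at this
          exact this)
        (ContinuousOn.intervalIntegrable (ContinuousOn.inv₀ (by fun_prop) fun η hη =>
          pow_ne_zero 2 (uIcc_pos ha hR hη).ne'))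
      rw [this]; ring
    rw [← hint]
    refine intervalIntegral.norm_integral_le_of_norm_le haR
      (Eventually.of_forall fun η hη => ?_) ?_
    · rw [norm_mul, nv, Complex.norm_real, norm_neg, Real.norm_of_nonneg (by positivity)]
    · exact ContinuousOn.intervalIntegrable (ContinuousOn.mul (ContinuousOn.inv₀ (by fun_prop)
        fun η hη => pow_ne_zero 2 (uIcc_pos ha hR hη).ne') continuousOn_const)
  rw [e, key]
  calc _ ≤ R⁻¹ * |x|⁻¹ + a⁻¹ * |x|⁻¹ + (a⁻¹ - R⁻¹) * |x|⁻¹ := by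
        refine (norm_sub_le _ _).trans (add_le_add ((norm_sub_le _ _).trans (add_le_add ?_ ?_)) b3)
        · rw [norm_mul, nv, Complex.norm_real, Real.norm_of_nonneg (by positivity)]
        · rw [norm_mul, nv, Complex.norm_real, Real.norm_of_nonneg (by positivity)]
    _ = 2 / (a * |x|) := by field_simp; ring

/-- A square integrable majorant of the oscillatory integrals. -/
noncomputable def oscMajorant (x : ℝ) : ℝ := if |x| ≤ 1 then |x| ^ (-(1 / 4) : ℝ) else |x|⁻¹

theorem oscMajorant_nonneg (x : ℝ) : 0 ≤ oscMajorant x := by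
  unfold oscMajorant; split_ifs <;> positivity

theorem oscMajorant_abs (x : ℝ) : oscMajorant |x| = oscMajorant x := by simp [oscMajorant]

theorem measurable_oscMajorant : Measurable oscMajorant := by
  unfold oscMajorant
  refine Measurable.ite (measurableSet_le (by fun_prop) measurable_const) ?_ ?_ <;> fun_prop

theorem integrable_comp_abs_of_integrableOn_Ioi {f : ℝ → ℝ} (hf : IntegrableOn f (Ioi 0) volume) :
    Integrable (fun x => f |x|) volume := by
  have h1 : IntegrableOn (fun x => f |x|) (Ioi 0) volume :=
    hf.congr_fun (fun x hx => by simp only [abs_of_pos hx.out]) measurableSet_Ioi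
  have h2 : IntegrableOn (fun x => f |x|) (Iio 0) volume := by
    have := ((Measure.measurePreserving_neg (volume : Measure ℝ)).integrableOn_comp_preimage
      (MeasurableEquiv.neg ℝ).measurableEmbedding (f := fun x => f |x|) (s := Ioi 0)).2 h1
    simpa [Function.comp_def] using this
  have h3 : IntegrableOn (fun x => f |x|) (Iic 0) volume := h2.congr_set_ae Iio_ae_eq_Iic.symm
  rw [← integrableOn_univ, ← Iic_union_Ioi (a := (0 : ℝ))]
  exact h3.union h1

theorem integrable_oscMajorant_sq : Integrable (fun x => oscMajorant x ^ 2) volume := by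
  have h : Integrable (fun x => oscMajorant |x| ^ 2) volume := by
    refine integrable_comp_abs_of_integrableOn_Ioi (f := fun x => oscMajorant x ^ 2) ?_
    rw [← Ioc_union_Ioi_eq_Ioi zero_le_one]
    refine IntegrableOn.union ?_ ?_
    · have h1 : IntegrableOn (fun x : ℝ => x ^ (-(1 / 2) : ℝ)) (Ioc 0 1) volume :=
        (intervalIntegrable_iff_integrableOn_Ioc_of_le zero_le_one).1
          (intervalIntegral.intervalIntegrable_rpow' (by norm_num))
      refine h1.congr_fun (fun x hx => ?_) measurableSet_Ioc
      simp only [oscMajorant, abs_of_pos hx.1, hx.2, if_true]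
      rw [← Real.rpow_natCast, ← Real.rpow_mul hx.1.le]
      norm_num
    · have h1 : IntegrableOn (fun x : ℝ => x ^ (-2 : ℝ)) (Ioi 1) volume :=
        integrableOn_Ioi_rpow_of_lt (by norm_num) zero_lt_one
      refine h1.congr_fun (fun x (hx : 1 < x) => ?_) measurableSet_Ioi
      have hx0 : 0 < x := zero_lt_one.trans hx
      simp only [oscMajorant, abs_of_pos hx0, not_le.2 hx, if_false]
      rw [Real.rpow_neg hx0.le]
      norm_num
  simpa only [oscMajorant_abs] using h

/-- For `|x| ≤ 1` the range is split at `η = l/|x|`: the lower piece is at most `log (1/|x|)` by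
absolute values, the upper at most `2/l` by integration by parts. The power `|x|^{-1/4}` absorbs the
logarithm and is still square integrable at `0`. For `|x| > 1` integration by parts suffices. -/
theorem norm_oscTrunc_le_majorant {l R x : ℝ} (hl : 0 < l) (hlR : l ≤ R) (hx : x ≠ 0) :
    ‖oscTrunc l R x‖ ≤ (4 + 2 / l) * oscMajorant x := by
  have hxa : 0 < |x| := abs_pos.2 hx
  have h2l : 0 < 2 / l := by positivity
  unfold oscMajorant
  split_ifs with h1
  · set t := |x| ^ (-(1 / 4) : ℝ) with ht
    have ht1 : 1 ≤ t := Real.one_le_rpow_of_pos_of_le_one_of_nonpos hxa h1 (by norm_num)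
    -- This is `log t ≤ t - 1` for `t = |x|^{-1/4}`; the factor `4` undoes the exponent.
    have hlog : Real.log (1 / |x|) ≤ 4 * t := by
      have : Real.log t = -(1 / 4) * Real.log |x| := Real.log_rpow hxa _
      have h3 := Real.log_le_sub_one_of_pos (zero_lt_one.trans_le ht1)
      rw [one_div, Real.log_inv]
      linarith
    have hlx : l ≤ l / |x| := by rw [le_div_iff₀ hxa]; nlinarith
    have hlx0 : 0 < l / |x| := by positivity
    rcases le_total R (l / |x|) with h | h
    · refine (norm_oscTrunc_le_log hl hlR x).trans ?_
      have : Real.log (R / l) ≤ Real.log (1 / |x|) := by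
        refine Real.log_le_log (div_pos (hl.trans_le hlR) hl) ?_
        rw [div_le_iff₀ hl]
        exact h.trans_eq (by ring)
      nlinarith
    · rw [← oscTrunc_add hl hlx0 (hl.trans_le hlR)]
      refine (norm_add_le _ _).trans ?_
      have e1 := norm_oscTrunc_le_log hl hlx x
      have e2 := norm_oscTrunc_le hlx0 h hx
      rw [show l / |x| / l = 1 / |x| by field_simp] at e1
      rw [show 2 / (l / |x| * |x|) = 2 / l by field_simp] at e2
      nlinarith
  · refine (norm_oscTrunc_le hl hlR hx).trans ?_
    rw [show 2 / (l * |x|) = 2 / l * |x|⁻¹ by field_simp]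
    gcongr
    linarith

theorem exists_tendsto_oscTrunc {l x : ℝ} (hl : 0 < l) (hx : x ≠ 0) :
    ∃ z, Tendsto (fun R => oscTrunc l R x) atTop (𝓝 z) := by
  have hxa : 0 < |x| := abs_pos.2 hx
  -- Truncating at `max l R` keeps every endpoint positive, so the tail estimate applies for all
  -- `R`.
  have hc : CauchySeq fun R => oscTrunc l (max l R) x := by
    refine cauchySeq_of_le_tendsto_0 (fun N : ℝ => 2 / (max l N * |x|)) (fun n m N hn hm => ?_) ?_
    · wlog hnm : n ≤ m generalizing n m
      · rw [dist_comm]; exact this m n hm hn (le_of_not_ge hnm)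
      have hn0 : 0 < max l n := lt_max_of_lt_left hl
      have hN0 : 0 < max l N := lt_max_of_lt_left hl
      rw [dist_comm, dist_eq_norm, ← oscTrunc_add hl hn0 (lt_max_of_lt_left hl), add_sub_cancel_left]
      refine (norm_oscTrunc_le hn0 (max_le_max le_rfl hnm) hx).trans ?_
      gcongr
    · refine Tendsto.div_atTop tendsto_const_nhds (Tendsto.atTop_mul_const hxa ?_)
      exact tendsto_atTop_mono (fun N => le_max_right _ _) tendsto_id
  obtain ⟨z, hz⟩ := cauchySeq_tendsto_of_complete hc
  refine ⟨z, hz.congr' ?_⟩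
  filter_upwards [eventually_ge_atTop l] with R hR
  rw [max_eq_right hR]

theorem tendsto_oscTrunc {l x : ℝ} (hl : 0 < l) (hx : x ≠ 0) :
    Tendsto (fun R => oscTrunc l R x) atTop (𝓝 (oscLim l x)) :=
  tendsto_nhds_limUnder (exists_tendsto_oscTrunc hl hx)

theorem norm_oscLim_le {l x : ℝ} (hl : 0 < l) (hx : x ≠ 0) :
    ‖oscLim l x‖ ≤ (4 + 2 / l) * oscMajorant x :=
  le_of_tendsto (tendsto_oscTrunc hl hx).norm (by
    filter_upwards [eventually_ge_atTop l] with R hR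
    exact norm_oscTrunc_le_majorant hl hR hx)

theorem continuous_oscTrunc {l R : ℝ} (hl : 0 < l) (hR : 0 < R) : Continuous (oscTrunc l R) := by
  -- Clamping the denominator leaves the integrand unchanged on the interval and makes it jointly
  -- continuous on the whole plane.
  have e : oscTrunc l R = fun x : ℝ => ∫ η in l..R,
      Complex.exp (-(Complex.I * x * η)) / ((max η (min l R) : ℝ) : ℂ) := by
    funext x
    refine intervalIntegral.integral_congr fun η hη => ?_
    rw [max_eq_left hη.1]
  rw [e]
  refine intervalIntegral.continuous_parametric_intervalIntegral_of_continuous' ?_ _ _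
  have h : ∀ p : ℝ × ℝ, ((max p.2 (min l R) : ℝ) : ℂ) ≠ 0 := fun p => by
    exact_mod_cast (lt_max_of_lt_right (lt_min hl hR)).ne'
  simp only [Function.uncurry_def]
  exact Continuous.div (by fun_prop) (by fun_prop) h

theorem ae_ne_zero : ∀ᵐ x : ℝ, x ≠ 0 := compl_mem_ae_iff.2 (measure_singleton 0)

theorem aestronglyMeasurable_oscLim {l : ℝ} (hl : 0 < l) :
    AEStronglyMeasurable (oscLim l) volume := by
  refine aestronglyMeasurable_of_tendsto_ae atTop (f := fun (n : ℕ) x => oscTrunc l (l + n) x)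
    (fun n => (continuous_oscTrunc hl (by positivity)).aestronglyMeasurable) ?_
  filter_upwards [ae_ne_zero] with x hx
  exact (tendsto_oscTrunc hl hx).comp
    (tendsto_atTop_add_const_left _ _ tendsto_natCast_atTop_atTop)

theorem memLp_oscMajorant : MemLp oscMajorant 2 volume := by
  refine (memLp_two_iff_integrable_sq_norm measurable_oscMajorant.aestronglyMeasurable).2 ?_
  simpa using integrable_oscMajorant_sq

theorem memLp_oscLim {l : ℝ} (hl : 0 < l) : MemLp (oscLim l) 2 volume := by
  refine (memLp_oscMajorant.const_mul (4 + 2 / l)).of_le (aestronglyMeasurable_oscLim hl) ?_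
  filter_upwards [ae_ne_zero] with x hx
  rw [Real.norm_of_nonneg (mul_nonneg (by positivity) (oscMajorant_nonneg x))]
  exact norm_oscLim_le hl hx

theorem conj_oscTrunc (a R x : ℝ) : (starRingEnd ℂ) (oscTrunc a R x) = oscTrunc a R (-x) := by
  unfold oscTrunc
  rw [← intervalIntegral.intervalIntegral_conj]
  refine intervalIntegral.integral_congr fun η _ => ?_
  simp [← Complex.exp_conj]

theorem conj_oscLim {l x : ℝ} (hl : 0 < l) (hx : x ≠ 0) :
    (starRingEnd ℂ) (oscLim l x) = oscLim l (-x) := by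
  refine tendsto_nhds_unique ((Complex.continuous_conj.tendsto _).comp (tendsto_oscTrunc hl hx)) ?_
  exact (tendsto_oscTrunc hl (neg_ne_zero.2 hx)).congr fun R => (conj_oscTrunc l R x).symm

theorem oscTrunc_add_oscLim {a b x : ℝ} (ha : 0 < a) (hb : 0 < b) (hx : x ≠ 0) :
    oscTrunc a b x + oscLim b x = oscLim a x := by
  refine tendsto_nhds_unique (tendsto_const_nhds.add (tendsto_oscTrunc hb hx))
    ((tendsto_oscTrunc ha hx).congr' ?_)
  filter_upwards [eventually_ge_atTop b] with R hR
  exact (oscTrunc_add ha hb (hb.trans_le hR) x).symm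

/-- The substitution `ξ = l - η` pulls out `e^{ilx}` and turns the half line `ξ < 0` into `η > l`.
-/
theorem tildeG_eq {l x : ℝ} (hl : 0 < l) (hx : x ≠ 0) :
    tildeG l x = -(planeWave l x * (oscLim l x / (2 * Real.pi))) := by
  have h : Tendsto (fun R : ℝ => ∫ ξ in (-R)..(0 : ℝ),
      Complex.exp (Complex.I * x * ξ) / ((ξ : ℂ) - (l : ℂ))) atTop
      (𝓝 (-(planeWave l x) * oscLim l x)) := by
    refine (((tendsto_oscTrunc hl hx).comp (tendsto_atTop_add_const_left atTop l
      tendsto_id)).const_mul (-(planeWave l x))).congr fun R => ?_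
    have := intervalIntegral.integral_comp_sub_left (a := l) (b := l + R)
      (fun ξ : ℝ => Complex.exp (Complex.I * x * ξ) / ((ξ : ℂ) - (l : ℂ))) l
    rw [show l - (l + R) = -R by ring, sub_self] at this
    rw [← this, Function.comp_apply, id, oscTrunc, ← intervalIntegral.integral_const_mul]
    refine intervalIntegral.integral_congr fun η _ => ?_
    simp only [planeWave, Complex.ofReal_sub]
    rw [show Complex.I * x * (l - η : ℂ) = Complex.I * l * x + -(Complex.I * x * η) by ring,
      Complex.exp_add, sub_sub_cancel_left, div_neg]
    ring
  rw [tildeG, h.limUnder_eq]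
  ring

/-! ### The boundary kernels conjugated by the plane wave -/

/-- The jump part `± i χ_{ℝ^±}` of the boundary kernels. -/
noncomputable def jumpPart : Side → ℝ → ℂ
  | Side.upper, x => (Ioi (0 : ℝ)).indicator (fun _ => Complex.I) x
  | Side.lower, x => (Iio (0 : ℝ)).indicator (fun _ => -Complex.I) x

/-- The boundary kernel conjugated by the plane wave. -/
noncomputable def modKernel (σ : Side) (l x : ℝ) : ℂ :=
  (starRingEnd ℂ) (planeWave l x) * greenKernel σ l x

theorem conj_planeWave (l x : ℝ) :
    (starRingEnd ℂ) (planeWave l x) = Complex.exp (-(Complex.I * l * x)) := by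
  simp [planeWave, ← Complex.exp_conj]

theorem conj_planeWave_mul (l x : ℝ) : (starRingEnd ℂ) (planeWave l x) * planeWave l x = 1 := by
  rw [conj_planeWave, planeWave, ← Complex.exp_add]
  simp

theorem norm_planeWave (l x : ℝ) : ‖planeWave l x‖ = 1 := by
  rw [planeWave, Complex.norm_exp]
  simp

theorem planeWave_sub (l x y : ℝ) :
    planeWave l (x - y) = planeWave l x * (starRingEnd ℂ) (planeWave l y) := by
  rw [conj_planeWave, planeWave, planeWave, ← Complex.exp_add]
  congr 1
  push_cast
  ring

theorem continuous_planeWave (l : ℝ) : Continuous (planeWave l) := by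
  unfold planeWave; fun_prop

/-- After conjugation the jump is a constant on each half line, and `l` enters only through the
lower limit of an oscillatory integral. Compactness, the symmetry of the kernel and its derivative
in `l` are all read off from this form. -/
theorem modKernel_eq {l x : ℝ} (σ : Side) (hl : 0 < l) (hx : x ≠ 0) :
    modKernel σ l x = jumpPart σ x + oscLim l x / (2 * Real.pi) := by
  have h := conj_planeWave_mul l x
  cases σ <;> simp only [modKernel, greenKernel, jumpPart, tildeG_eq hl hx, indicator] <;>
    split_ifs
  · linear_combination (oscLim l x / (2 * Real.pi) + Complex.I) * h
  · linear_combination (oscLim l x / (2 * Real.pi)) * h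
  · linear_combination (oscLim l x / (2 * Real.pi) - Complex.I) * h
  · linear_combination (oscLim l x / (2 * Real.pi)) * h

theorem measurable_jumpPart (σ : Side) : Measurable (jumpPart σ) := by
  cases σ
  · exact measurable_const.indicator measurableSet_Ioi
  · exact measurable_const.indicator measurableSet_Iio

theorem norm_jumpPart_le (σ : Side) (x : ℝ) : ‖jumpPart σ x‖ ≤ 1 := by
  cases σ
  · exact (norm_indicator_le_norm_self (fun _ : ℝ => Complex.I) x).trans (by simp)
  · exact (norm_indicator_le_norm_self (fun _ : ℝ => -Complex.I) x).trans (by simp)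

theorem continuousAt_jumpPart (σ : Side) {x : ℝ} (hx : x ≠ 0) : ContinuousAt (jumpPart σ) x := by
  have h : jumpPart σ =ᶠ[𝓝 x] fun _ => jumpPart σ x := by
    rcases lt_or_gt_of_ne hx with h | h
    · filter_upwards [Iio_mem_nhds h] with y hy
      have hy : y < 0 := hy
      cases σ <;> simp [jumpPart, indicator, h, hy, h.not_gt, hy.not_gt]
    · filter_upwards [Ioi_mem_nhds h] with y hy
      have hy : 0 < y := hy
      cases σ <;> simp [jumpPart, indicator, h, hy, h.not_gt, hy.not_gt]
  exact continuousAt_const.congr h.symm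

theorem admissibleKernel_modKernel (σ : Side) {l : ℝ} (hl : 0 < l) :
    AdmissibleKernel (modKernel σ l) := by
  -- The square integrable part is taken as a difference so that the decomposition also holds at `x
  -- = 0`, where `modKernel_eq` does not apply.
  refine ⟨jumpPart σ, fun x => modKernel σ l x - jumpPart σ x, fun x => by ring,
    (measurable_jumpPart σ).aestronglyMeasurable, ⟨1, norm_jumpPart_le σ⟩,
    fun x hx => continuousAt_jumpPart σ hx, ?_⟩
  refine ((memLp_oscLim hl).mul_const (2 * (Real.pi : ℂ))⁻¹).ae_eq ?_
  filter_upwards [ae_ne_zero] with x hx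
  rw [modKernel_eq σ hl hx]
  ring

end BOScattering

namespace BOScattering

open scoped FourierTransform SchwartzMap ContDiff

/-! ### The Fourier transform of integrable, square integrable functions -/

theorem continuous_fourier {f : ℝ → ℂ} (hf : Integrable f volume) : Continuous (𝓕 f) :=
  VectorFourier.fourierIntegral_continuous Real.continuous_fourierChar continuous_inner hf

/-- Plancherel: the Fourier transform of a function in `L¹ ∩ L²` is square integrable. -/
theorem memLp_two_fourier {f : ℝ → ℂ} (hf : Integrable f volume) (hf2 : MemLp f 2 volume) :
    MemLp (𝓕 f) 2 volume := by
  have h := Lp.fourier_toTemperedDistribution_eq (hf2.toLp f)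
  have hcont : Continuous (𝓕 f) := continuous_fourier hf
  have hL : LocallyIntegrable (fun x => (𝓕 (hf2.toLp f) : Lp ℂ 2 volume) x) volume :=
    (Lp.memLp _).locallyIntegrable one_le_two
  -- The integral transform and the `L²` transform are identified by testing against smooth
  -- compactly supported functions and moving the transform between factors.
  have hae : ∀ᵐ x : ℝ, 𝓕 f x = (𝓕 (hf2.toLp f) : Lp ℂ 2 volume) x := by
    refine ae_eq_of_integral_contDiff_smul_eq hcont.locallyIntegrable hL fun g hg hgc => ?_
    have hgc' : HasCompactSupport (fun x => (g x : ℂ)) :=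
      hgc.comp_left (g := fun z : ℝ => (z : ℂ)) (by simp)
    let G : 𝓢(ℝ, ℂ) := hgc'.toSchwartzMap (Complex.ofRealCLM.contDiff.comp hg)
    have hG : ∀ x, G x = (g x : ℂ) := fun x => rfl
    have h1 := congrArg (fun T : 𝓢'(ℝ, ℂ) => T G) h
    simp only [TemperedDistribution.fourier_apply, Lp.toTemperedDistribution_apply] at h1
    have h2 : ∫ x, (𝓕 G : 𝓢(ℝ, ℂ)) x • (hf2.toLp f) x = ∫ x, G x • 𝓕 f x := by
      have e : ∫ x, (𝓕 G : 𝓢(ℝ, ℂ)) x • (hf2.toLp f) x = ∫ x, (𝓕 G : 𝓢(ℝ, ℂ)) x • f x := by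
        refine integral_congr_ae ?_
        filter_upwards [hf2.coeFn_toLp] with x hx
        rw [hx]
      rw [e]
      have := VectorFourier.integral_fourierIntegral_smul_eq_flip (L := innerₗ ℝ)
        (μ := volume) (ν := volume) Real.continuous_fourierChar continuous_inner G.integrable hf
      simpa using! this
    rw [h2] at h1
    simpa [hG] using h1
  exact (memLp_congr_ae hae).2 (Lp.memLp _)

/-- The Fourier transform `η ↦ ∫ e^{-iηy} f(y) dy`. -/
noncomputable def hat (f : ℝ → ℂ) (η : ℝ) : ℂ := ∫ y : ℝ, Complex.exp (-(Complex.I * η * y)) * f y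

theorem fourier_eq_hat (f : ℝ → ℂ) (ξ : ℝ) : 𝓕 f ξ = hat f (2 * Real.pi * ξ) := by
  rw [Real.fourier_eq', hat]
  refine integral_congr_ae (Eventually.of_forall fun y => ?_)
  simp only [smul_eq_mul]
  congr 2
  simp
  ring

theorem integrable_exp_mul {f : ℝ → ℂ} (hf : Integrable f volume) (η : ℝ) :
    Integrable (fun y : ℝ => Complex.exp (-(Complex.I * η * y)) * f y) volume :=
  hf.bdd_mul (c := 1) (Continuous.aestronglyMeasurable (by fun_prop))
    (Eventually.of_forall fun y => (norm_exp_neg_I_mul η y).le)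

theorem norm_hat_le (f : ℝ → ℂ) (η : ℝ) : ‖hat f η‖ ≤ ∫ y, ‖f y‖ := by
  refine (norm_integral_le_integral_norm _).trans_eq ?_
  simp [norm_exp_neg_I_mul]

theorem continuous_hat {f : ℝ → ℂ} (hf : Integrable f volume) : Continuous (hat f) := by
  have : hat f = fun η => 𝓕 f ((2 * Real.pi)⁻¹ * η) := by
    funext η
    rw [fourier_eq_hat]
    congr 1
    field_simp
  rw [this]
  exact (continuous_fourier hf).comp (by fun_prop)

theorem integrable_norm_hat_sq {f : ℝ → ℂ} (hf : Integrable f volume) (hf2 : MemLp f 2 volume) :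
    Integrable (fun η => ‖hat f η‖ ^ 2) volume := by
  have h := memLp_two_integrable_sq (memLp_two_fourier hf hf2)
  simp only [fourier_eq_hat] at h
  exact (integrable_comp_mul_left_iff (fun η => ‖hat f η‖ ^ 2)
    (by positivity : (2 * Real.pi : ℝ) ≠ 0)).1 h

theorem eq_integral_hat {F : ℝ → ℂ} (hc : Continuous F) (hF : Integrable F volume)
    (hh : Integrable (hat F) volume) (x : ℝ) :
    F x = (1 / (2 * Real.pi : ℂ)) * ∫ η : ℝ, Complex.exp (Complex.I * x * η) * hat F η := by
  have hpi : (2 * Real.pi : ℝ) ≠ 0 := by positivity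
  have hFi : Integrable (𝓕 F) volume := by
    have : 𝓕 F = fun ξ => hat F (2 * Real.pi * ξ) := funext (fourier_eq_hat F)
    rw [this]
    exact (integrable_comp_mul_left_iff _ hpi).2 hh
  have h := congrFun (hc.fourierInv_fourier_eq hF hFi) x
  rw [← h, Real.fourierInv_eq']
  have e : ∀ ξ : ℝ, Complex.exp (((2 * Real.pi * inner ℝ ξ x : ℝ) : ℂ) * Complex.I) • 𝓕 F ξ =
      (fun η : ℝ => Complex.exp (Complex.I * x * η) * hat F η) (2 * Real.pi * ξ) := fun ξ => by
    rw [fourier_eq_hat, smul_eq_mul]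
    simp only
    congr 2
    simp
    ring
  simp only [e]
  rw [Measure.integral_comp_mul_left (fun η : ℝ => Complex.exp (Complex.I * x * η) * hat F η),
    abs_of_pos (by positivity)]
  simp

theorem norm_exp_sub_one_le (t : ℝ) : ‖Complex.exp (-(Complex.I * t)) - 1‖ ≤ |t| := by
  have := Real.norm_exp_I_mul_ofReal_sub_one_le (x := -t)
  simpa using this

/-- Mean zero means that the transform vanishes at `0`; the first moment is a Lipschitz constant for
it. -/
theorem norm_hat_le_mul_abs {f : ℝ → ℂ} (hf : Integrable f volume)
    (hxf : Integrable (fun y : ℝ => (y : ℂ) * f y) volume) (h0 : ∫ y, f y = 0) (η : ℝ) :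
    ‖hat f η‖ ≤ (∫ y : ℝ, ‖(y : ℂ) * f y‖) * |η| := by
  have e : hat f η = ∫ y : ℝ, (Complex.exp (-(Complex.I * η * y)) - 1) * f y := by
    simp only [sub_mul, one_mul]
    rw [integral_sub (integrable_exp_mul hf η) hf, h0, sub_zero, hat]
  rw [e, ← integral_mul_const]
  refine norm_integral_le_of_norm_le (hxf.norm.mul_const _) (Eventually.of_forall fun y => ?_)
  have := norm_exp_sub_one_le (η * y)
  rw [norm_mul, norm_mul, Complex.norm_real, Real.norm_eq_abs]
  calc _ ≤ |η * y| * ‖f y‖ := by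
        gcongr
        simpa [mul_assoc] using this
    _ = _ := by rw [abs_mul]; ring

theorem hasDerivAt_hat {f : ℝ → ℂ} (hf : Integrable f volume)
    (hxf : Integrable (fun y : ℝ => (y : ℂ) * f y) volume) (η : ℝ) :
    HasDerivAt (hat f) (-Complex.I * hat (fun y : ℝ => (y : ℂ) * f y) η) η := by
  have h := (hasDerivAt_integral_of_dominated_loc_of_deriv_le (μ := volume) (𝕜 := ℝ)
    (F := fun (η : ℝ) (y : ℝ) => Complex.exp (-(Complex.I * η * y)) * f y)
    (F' := fun (η : ℝ) (y : ℝ) => -Complex.I * (Complex.exp (-(Complex.I * η * y)) * (y * f y)))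
    (x₀ := η) (s := univ) (bound := fun y : ℝ => ‖(y : ℂ) * f y‖) univ_mem
    (Eventually.of_forall fun η => (integrable_exp_mul hf η).aestronglyMeasurable)
    (integrable_exp_mul hf η)
    ((integrable_exp_mul hxf η).const_mul (-Complex.I)).aestronglyMeasurable
    (Eventually.of_forall fun y η _ => by
      rw [norm_mul, norm_mul _ ((y : ℂ) * f y), norm_exp_neg_I_mul]; simp)
    hxf.norm
    (Eventually.of_forall fun y η _ => by
      have h1 : HasDerivAt (fun η : ℝ => -(Complex.I * (η : ℂ) * y)) (-(Complex.I * 1 * y)) η :=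
        (((hasDerivAt_id (η : ℂ)).comp_ofReal.const_mul _).mul_const _).neg
      refine (h1.cexp.mul_const _).congr_deriv ?_
      ring)).2
  refine h.congr_deriv ?_
  rw [integral_const_mul, hat]

/-- For `f` in `L¹ ∩ L²` with integrable first moment and mean zero, `f^(η) / η` is integrable. -/
theorem integrable_hat_div {f : ℝ → ℂ} (hf : Integrable f volume) (hf2 : MemLp f 2 volume)
    (hxf : Integrable (fun y : ℝ => (y : ℂ) * f y) volume) (h0 : ∫ y, f y = 0) :
    Integrable (fun η : ℝ => hat f η / η) volume := by
  have hm : AEStronglyMeasurable (fun η : ℝ => hat f η / η) volume :=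
    ((continuous_hat hf).measurable.div Complex.measurable_ofReal).aestronglyMeasurable
  set B := ∫ y : ℝ, ‖(y : ℂ) * f y‖
  have hB : 0 ≤ B := by positivity
  -- For `|η| > 1` the majorant is just `1/|η|`, so the quotient is controlled by a product of two
  -- square integrable functions; near `0` it is bounded by `B`.
  have hfar : Integrable (fun η => ‖hat f η‖ ^ 2 + oscMajorant η ^ 2) volume :=
    (integrable_norm_hat_sq hf hf2).add integrable_oscMajorant_sq
  have hnear : Integrable ((Icc (-1 : ℝ) 1).indicator fun _ => B) volume :=
    (integrable_indicator_iff measurableSet_Icc).2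
      (integrableOn_const (by simp))
  refine (hfar.add hnear).mono' hm (Eventually.of_forall fun η => ?_)
  rw [norm_div, Complex.norm_real, Real.norm_eq_abs, Pi.add_apply]
  rcases le_or_gt |η| 1 with h | h
  · rw [indicator_of_mem (show η ∈ Icc (-1 : ℝ) 1 from abs_le.1 h)]
    have : ‖hat f η‖ / |η| ≤ B :=
      div_le_of_le_mul₀ (abs_nonneg _) hB (norm_hat_le_mul_abs hf hxf h0 η)
    have h3 : 0 ≤ ‖hat f η‖ ^ 2 + oscMajorant η ^ 2 := by positivity
    linarith
  · rw [indicator_of_notMem (fun h2 : η ∈ Icc (-1 : ℝ) 1 => not_le.2 h (abs_le.2 h2)), add_zero,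
      oscMajorant, if_neg (not_le.2 h), div_eq_mul_inv]
    nlinarith [sq_nonneg (‖hat f η‖ - |η|⁻¹), sq_nonneg (‖hat f η‖), sq_nonneg (|η|⁻¹)]

/-! ### Primitives of mean zero functions -/

/-- The oriented indicator of the interval between `0` and `y`. -/
noncomputable def orientedInd (x y : ℝ) : ℂ :=
  (Ioc (0 : ℝ) y).indicator (fun _ => (1 : ℂ)) x - (Ioc y 0).indicator (fun _ => (1 : ℂ)) x

theorem integral_mul_orientedInd {g : ℝ → ℂ} (hg : Continuous g) (y : ℝ) :
    ∫ x, g x * orientedInd x y = ∫ x in (0 : ℝ)..y, g x := by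
  have hi : ∀ a b : ℝ, Integrable ((Ioc a b).indicator g) volume := fun a b =>
    (integrable_indicator_iff measurableSet_Ioc).2
      ((hg.integrableOn_Icc (a := a) (b := b)).mono_set Ioc_subset_Icc_self)
  have e : ∀ x, g x * orientedInd x y = (Ioc (0 : ℝ) y).indicator g x - (Ioc y 0).indicator g x :=
    fun x => by
      simp only [orientedInd, indicator]
      split_ifs <;> simp
  simp only [e]
  rw [integral_sub (hi _ _) (hi _ _), integral_indicator measurableSet_Ioc,
    integral_indicator measurableSet_Ioc, intervalIntegral]

theorem norm_orientedInd (x y : ℝ) :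
    ‖orientedInd x y‖ = (uIoc 0 y).indicator (fun _ => (1 : ℝ)) x := by
  rcases le_total 0 y with h | h
  · rw [uIoc_of_le h, orientedInd, Ioc_eq_empty (not_lt.2 h)]
    simp only [indicator]
    split_ifs <;> simp_all
  · rw [uIoc_of_ge h, orientedInd, Ioc_eq_empty (not_lt.2 h)]
    simp only [indicator]
    split_ifs <;> simp_all

theorem measurable_orientedInd : Measurable fun p : ℝ × ℝ => orientedInd p.1 p.2 := by
  have h1 : MeasurableSet {p : ℝ × ℝ | p.1 ∈ Ioc 0 p.2} :=
    (measurableSet_lt measurable_const measurable_fst).inter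
      (measurableSet_le measurable_fst measurable_snd)
  have h2 : MeasurableSet {p : ℝ × ℝ | p.1 ∈ Ioc p.2 0} :=
    (measurableSet_lt measurable_snd measurable_fst).inter
      (measurableSet_le measurable_fst measurable_const)
  exact ((measurable_const (a := (1 : ℂ))).indicator h1).sub
    ((measurable_const (a := (1 : ℂ))).indicator h2)

/-- The `x`-integral of the modulus of the indicator is `|y|`, so by Tonelli the total mass is the
first absolute moment of `f`. -/
theorem integrable_orientedInd_mul {f : ℝ → ℂ} (hf : Integrable f volume)
    (hxf : Integrable (fun y : ℝ => (y : ℂ) * f y) volume) :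
    Integrable (fun p : ℝ × ℝ => orientedInd p.1 p.2 * f p.2) (volume.prod volume) := by
  have hm : AEStronglyMeasurable (fun p : ℝ × ℝ => orientedInd p.1 p.2 * f p.2)
      (volume.prod volume) :=
    measurable_orientedInd.aestronglyMeasurable.mul hf.aestronglyMeasurable.comp_snd
  have hi : ∀ y, Integrable (fun x => ‖orientedInd x y‖) volume := fun y => by
    simp only [norm_orientedInd]
    exact (integrable_indicator_iff measurableSet_uIoc).2 (integrableOn_const (by simp [uIoc]))
  rw [integrable_prod_iff' hm]
  refine ⟨Eventually.of_forall fun y => ?_, ?_⟩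
  · have : Integrable (fun x => orientedInd x y) volume :=
      (integrable_norm_iff (measurable_orientedInd.comp
        (measurable_id.prodMk measurable_const)).aestronglyMeasurable).1 (hi y)
    exact this.mul_const (f y)
  · refine hxf.norm.congr (Eventually.of_forall fun y => ?_)
    simp only [norm_mul]
    rw [integral_mul_const]
    congr 1
    simp only [norm_orientedInd]
    rw [integral_indicator measurableSet_uIoc]
    simp [uIoc, max_sub_min_eq_abs']

/-- Mean zero allows the tail on the far side from the origin to be used for either sign of `x`. In
this form integrability of the primitive and its Fourier transform follow from Fubini. -/
theorem integral_Iic_eq {f : ℝ → ℂ} (hf : Integrable f volume) (h0 : ∫ y, f y = 0) (x : ℝ) :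
    ∫ y in Iic x, f y = -∫ y, orientedInd x y * f y := by
  rcases le_or_gt x 0 with h | h
  · have e : ∀ y, orientedInd x y * f y = -(Iio x).indicator f y := fun y => by
      simp only [orientedInd, indicator, mem_Ioc, mem_Iio, not_lt.2 h, h]
      split_ifs <;> simp_all
    simp only [e]
    rw [integral_neg, neg_neg, integral_indicator measurableSet_Iio, integral_Iic_eq_integral_Iio]
  · have e : ∀ y, orientedInd x y * f y = (Ici x).indicator f y := fun y => by
      simp only [orientedInd, indicator, mem_Ioc, mem_Ici, not_le.2 h, h]
      split_ifs <;> simp_all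
    simp only [e]
    rw [integral_indicator measurableSet_Ici, integral_Iic_eq_integral_Iio]
    have := integral_add_compl (measurableSet_Iio (a := x)) hf
    rw [compl_Iio, h0] at this
    exact eq_neg_of_add_eq_zero_left this

theorem integrable_primitive {f : ℝ → ℂ} (hf : Integrable f volume)
    (hxf : Integrable (fun y : ℝ => (y : ℂ) * f y) volume) (h0 : ∫ y, f y = 0) :
    Integrable (fun x => ∫ y in Iic x, f y) volume := by
  simp only [integral_Iic_eq hf h0]
  exact (integrable_orientedInd_mul hf hxf).integral_prod_left.neg

/-- Fubini leaves the elementary integral of `e^{-iηx}` between `0` and `y`; mean zero removes the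
contribution of its endpoint `0`. -/
theorem hat_primitive {f : ℝ → ℂ} (hf : Integrable f volume)
    (hxf : Integrable (fun y : ℝ => (y : ℂ) * f y) volume) (h0 : ∫ y, f y = 0) {η : ℝ} (hη : η ≠ 0) :
    hat (fun x => ∫ y in Iic x, f y) η = hat f η / (Complex.I * η) := by
  have hηc : (η : ℂ) ≠ 0 := by exact_mod_cast hη
  have hIη : Complex.I * η ≠ 0 := mul_ne_zero Complex.I_ne_zero hηc
  have hprod : Integrable (fun p : ℝ × ℝ => Complex.exp (-(Complex.I * η * p.1)) *
      (orientedInd p.1 p.2 * f p.2)) (volume.prod volume) :=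
    (integrable_orientedInd_mul hf hxf).bdd_mul (c := 1)
      (Continuous.aestronglyMeasurable (by fun_prop))
      (Eventually.of_forall fun p => (norm_exp_neg_I_mul η p.1).le)
  have inner : ∀ y : ℝ, ∫ x : ℝ, Complex.exp (-(Complex.I * η * x)) * (orientedInd x y * f y) =
      -(Complex.exp (-(Complex.I * η * y)) * f y - f y) / (Complex.I * η) := fun y => by
    simp only [← mul_assoc]
    rw [integral_mul_const, integral_mul_orientedInd (by fun_prop)]
    have := integral_exp_mul_complex (a := 0) (b := y) (c := -(Complex.I * η)) (neg_ne_zero.2 hIη)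
    simp only [neg_mul, Complex.ofReal_zero, mul_zero, Complex.exp_zero] at this
    rw [this]
    field_simp
  calc hat (fun x => ∫ y in Iic x, f y) η
      = -∫ x : ℝ, ∫ y : ℝ, Complex.exp (-(Complex.I * η * x)) * (orientedInd x y * f y) := by
        rw [hat, ← integral_neg]
        refine integral_congr_ae (Eventually.of_forall fun x => ?_)
        simp only
        rw [integral_Iic_eq hf h0, integral_const_mul, mul_neg]
    _ = -∫ y : ℝ, ∫ x : ℝ, Complex.exp (-(Complex.I * η * x)) * (orientedInd x y * f y) := by
        rw [integral_integral_swap hprod]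
    _ = hat f η / (Complex.I * η) := by
        simp only [inner]
        rw [integral_div, integral_neg, integral_sub (integrable_exp_mul hf η) hf, h0, hat]
        ring

theorem continuous_primitive {f : ℝ → ℂ} (hf : Integrable f volume) :
    Continuous fun x => ∫ y in Iic x, f y := by
  have e : (fun x => ∫ y in Iic x, f y) = fun x => (∫ y in Iic 0, f y) + ∫ y in (0 : ℝ)..x, f y := by
    funext x
    rw [← intervalIntegral.integral_Iic_sub_Iic hf.integrableOn hf.integrableOn]
    ring
  rw [e]
  exact continuous_const.add
    (intervalIntegral.continuous_primitive (fun a b => hf.intervalIntegrable) 0)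

/-- Fourier representation of the primitive of a mean zero function. -/
theorem primitive_eq_integral {f : ℝ → ℂ} (hf : Integrable f volume) (hf2 : MemLp f 2 volume)
    (hxf : Integrable (fun y : ℝ => (y : ℂ) * f y) volume) (h0 : ∫ y, f y = 0) (x : ℝ) :
    Complex.I * ∫ y in Iic x, f y =
      (1 / (2 * Real.pi : ℂ)) * ∫ η : ℝ, Complex.exp (Complex.I * x * η) * (hat f η / η) := by
  have e : hat (fun x => ∫ y in Iic x, f y) =ᵐ[volume] fun η : ℝ => Complex.I⁻¹ * (hat f η / η) := by
    filter_upwards [ae_ne_zero] with η hη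
    rw [hat_primitive hf hxf h0 hη, div_mul_eq_div_div_swap]
    ring
  have hint : Integrable (hat fun x => ∫ y in Iic x, f y) volume :=
    (integrable_congr e).2 ((integrable_hat_div hf hf2 hxf h0).const_mul _)
  rw [eq_integral_hat (continuous_primitive hf) (integrable_primitive hf hxf h0) hint x]
  have e2 : ∫ η : ℝ, Complex.exp (Complex.I * x * η) * hat (fun x => ∫ y in Iic x, f y) η =
      Complex.I⁻¹ * ∫ η : ℝ, Complex.exp (Complex.I * x * η) * (hat f η / η) := by
    rw [← integral_const_mul]
    refine integral_congr_ae ?_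
    filter_upwards [e] with η hη
    rw [hη]
    ring
  rw [e2, mul_left_comm, mul_inv_cancel_left₀ Complex.I_ne_zero]

end BOScattering

namespace BOScattering

/-! ### The virial identity -/

theorem norm_exp_I_mul (x η : ℝ) : ‖Complex.exp (Complex.I * x * η)‖ = 1 := by
  rw [Complex.norm_exp]
  simp

theorem integral_oscTrunc_mul {f : ℝ → ℂ} (hf : Integrable f volume) {l R : ℝ} (hl : 0 < l)
    (hR : l ≤ R) (x : ℝ) :
    ∫ y, oscTrunc l R (x - y) * f y =
      ∫ η in l..R, Complex.exp (-(Complex.I * x * η)) * (hat f (-η) / η) := by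
  have h1 : Integrable (fun η : ℝ => ((η : ℂ))⁻¹) (volume.restrict (Ioc l R)) := by
    refine IntegrableOn.mono_set ?_ Ioc_subset_Icc_self
    refine ContinuousOn.integrableOn_Icc (ContinuousOn.inv₀ (by fun_prop) fun η hη => ?_)
    exact_mod_cast (hl.trans_le hη.1).ne'
  have h2 : Integrable (fun p : ℝ × ℝ => Complex.exp (-(Complex.I * (x - p.1 : ℝ) * p.2)) *
      (f p.1 * ((p.2 : ℂ))⁻¹)) (volume.prod (volume.restrict (Ioc l R))) :=
    (hf.mul_prod h1).bdd_mul (c := 1) (Continuous.aestronglyMeasurable (by fun_prop))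
      (Eventually.of_forall fun p => (norm_exp_neg_I_mul _ _).le)
  calc ∫ y, oscTrunc l R (x - y) * f y
      = ∫ y : ℝ, ∫ η : ℝ in Ioc l R, Complex.exp (-(Complex.I * (x - y : ℝ) * η)) *
          (f y * ((η : ℂ))⁻¹) := by
        refine integral_congr_ae (Eventually.of_forall fun y => ?_)
        simp only [oscTrunc]
        rw [intervalIntegral.integral_of_le hR, ← integral_mul_const]
        refine integral_congr_ae (Eventually.of_forall fun η => ?_)
        simp only [div_eq_mul_inv]
        ring
    _ = ∫ η : ℝ in Ioc l R, ∫ y : ℝ, Complex.exp (-(Complex.I * (x - y : ℝ) * η)) *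
          (f y * ((η : ℂ))⁻¹) := integral_integral_swap h2
    _ = _ := by
        rw [intervalIntegral.integral_of_le hR]
        refine integral_congr_ae (Eventually.of_forall fun η => ?_)
        simp only [hat]
        rw [← integral_div, ← integral_const_mul]
        refine integral_congr_ae (Eventually.of_forall fun y => ?_)
        simp only
        rw [div_eq_mul_inv, ← mul_assoc, ← mul_assoc, ← mul_assoc, ← Complex.exp_add]
        congr 3
        push_cast
        ring

variable {f n : ℝ → ℂ} {l : ℝ}

/-- The truncated identity is Fubini. As `R → ∞`, the left side converges by domination with
`oscMajorant`, and the right side because `f^(η)/η` is integrable. -/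
theorem integral_oscLim_mul (hf : Integrable f volume) (hf2 : MemLp f 2 volume)
    (hxf : Integrable (fun y : ℝ => (y : ℂ) * f y) volume) (h0 : ∫ y, f y = 0) (hl : 0 < l)
    (x : ℝ) :
    ∫ y, oscLim l (x - y) * f y =
      -∫ η in Iic (-l), Complex.exp (Complex.I * x * η) * (hat f η / η) := by
  have hQ := integrable_hat_div hf hf2 hxf h0
  have hQ' : Integrable (fun η : ℝ => Complex.exp (-(Complex.I * x * η)) * (hat f (-η) / η))
      volume := by
    have h1 : Integrable (fun η : ℝ => hat f (-η) / η) volume := by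
      refine hQ.comp_neg.neg.congr (Eventually.of_forall fun η => ?_)
      simp only [Pi.neg_apply, Complex.ofReal_neg, div_neg, neg_neg]
    exact h1.bdd_mul (c := 1) (Continuous.aestronglyMeasurable (by fun_prop))
      (Eventually.of_forall fun η => (norm_exp_neg_I_mul _ _).le)
  have t1 : Tendsto (fun R => ∫ y, oscTrunc l R (x - y) * f y) atTop
      (𝓝 (∫ y, oscLim l (x - y) * f y)) := by
    have hne : ∀ᵐ y : ℝ, x - y ≠ 0 := by
      filter_upwards [compl_mem_ae_iff.2 (measure_singleton x)] with y hy
      exact fun h => hy (sub_eq_zero.1 h).symm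
    have hdom : Integrable (fun y => ‖(((4 + 2 / l) * oscMajorant (x - y) : ℝ) : ℂ) * f y‖)
        volume := by
      refine (integrable_translate_mul (k := fun t => (((4 + 2 / l) * oscMajorant t : ℝ) : ℂ))
        ?_ hf2 x).norm
      exact (memLp_oscMajorant.const_mul _).ofReal
    refine tendsto_integral_filter_of_dominated_convergence _ ?_ ?_ hdom ?_
    · filter_upwards [eventually_ge_atTop l] with R hR
      exact ((continuous_oscTrunc hl (hl.trans_le hR)).comp
        (by fun_prop : Continuous fun y : ℝ => x - y)).aestronglyMeasurable.mul
        hf.aestronglyMeasurable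
    · filter_upwards [eventually_ge_atTop l] with R hR
      filter_upwards [hne] with y hy
      rw [norm_mul, norm_mul, Complex.norm_real, Real.norm_of_nonneg
        (mul_nonneg (by positivity) (oscMajorant_nonneg _))]
      gcongr
      exact norm_oscTrunc_le_majorant hl hR hy
    · filter_upwards [hne] with y hy
      exact (tendsto_oscTrunc hl hy).mul_const _
  have t2 : Tendsto (fun R => ∫ y, oscTrunc l R (x - y) * f y) atTop
      (𝓝 (∫ η in Ioi l, Complex.exp (-(Complex.I * x * η)) * (hat f (-η) / η))) := by
    refine (intervalIntegral_tendsto_integral_Ioi l hQ'.integrableOn tendsto_id).congr' ?_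
    filter_upwards [eventually_ge_atTop l] with R hR
    exact (integral_oscTrunc_mul hf hl hR x).symm
  rw [tendsto_nhds_unique t1 t2, ← integral_neg, ← integral_comp_neg_Ioi]
  refine integral_congr_ae (Eventually.of_forall fun η => ?_)
  simp only [Complex.ofReal_neg, div_neg, mul_neg, neg_neg]

/-- The Fourier representation of `G * f` for `f` with vanishing mean. -/
theorem primitive_add_oscLim_eq (hf : Integrable f volume) (hf2 : MemLp f 2 volume)
    (hxf : Integrable (fun y : ℝ => (y : ℂ) * f y) volume) (h0 : ∫ y, f y = 0) (hl : 0 < l)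
    (x : ℝ) :
    Complex.I * (∫ y in Iic x, f y) + (1 / (2 * Real.pi : ℂ)) * ∫ y, oscLim l (x - y) * f y =
      (1 / (2 * Real.pi : ℂ)) *
        ∫ η in Ioi (-l), Complex.exp (Complex.I * x * η) * (hat f η / η) := by
  have hQ : Integrable (fun η : ℝ => Complex.exp (Complex.I * x * η) * (hat f η / η)) volume :=
    (integrable_hat_div hf hf2 hxf h0).bdd_mul (c := 1)
      (Continuous.aestronglyMeasurable (by fun_prop))
      (Eventually.of_forall fun η => (norm_exp_I_mul _ _).le)
  rw [primitive_eq_integral hf hf2 hxf h0, integral_oscLim_mul hf hf2 hxf h0 hl,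
    ← intervalIntegral.integral_Iic_add_Ioi hQ.integrableOn hQ.integrableOn (b := -l)]
  ring

/-- A Parseval identity, obtained by inserting the Fourier representation of `n` and applying
Fubini; integrability of `x f` and of `f^(η)/η` justifies the exchange. -/
theorem integral_moment_mul_conj (hf : Integrable f volume) (hf2 : MemLp f 2 volume)
    (hxf : Integrable (fun y : ℝ => (y : ℂ) * f y) volume) (h0 : ∫ y, f y = 0)
    (hn : ∀ x : ℝ, n x = (1 / (2 * Real.pi : ℂ)) *
        ∫ η in Ioi (-l), Complex.exp (Complex.I * x * η) * (hat f η / η)) :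
    ∫ x : ℝ, (x : ℂ) * f x * (starRingEnd ℂ) (n x) = (1 / (2 * Real.pi : ℂ)) *
      ∫ η in Ioi (-l), (starRingEnd ℂ) (hat f η / η) * hat (fun y : ℝ => (y : ℂ) * f y) η := by
  have hQ := (integrable_hat_div hf hf2 hxf h0).integrableOn (s := Ioi (-l))
  have hQc : Integrable (fun η : ℝ => (starRingEnd ℂ) (hat f η / η)) (volume.restrict (Ioi (-l))) :=
    (LinearIsometryEquiv.integrable_comp_iff Complex.conjLIE).2 hQ
  have hprod : Integrable (fun p : ℝ × ℝ => Complex.exp (-(Complex.I * p.1 * p.2)) *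
      (((p.1 : ℂ) * f p.1) * (starRingEnd ℂ) (hat f p.2 / p.2)))
      (volume.prod (volume.restrict (Ioi (-l)))) :=
    (hxf.mul_prod hQc).bdd_mul (c := 1) (Continuous.aestronglyMeasurable (by fun_prop))
      (Eventually.of_forall fun p => (norm_exp_neg_I_mul _ _).le)
  calc ∫ x : ℝ, (x : ℂ) * f x * (starRingEnd ℂ) (n x)
      = (1 / (2 * Real.pi : ℂ)) * ∫ x : ℝ, ∫ η : ℝ in Ioi (-l),
          Complex.exp (-(Complex.I * x * η)) *
            (((x : ℂ) * f x) * (starRingEnd ℂ) (hat f η / η)) := by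
        rw [← integral_const_mul]
        refine integral_congr_ae (Eventually.of_forall fun x => ?_)
        simp only [hn x, map_mul]
        rw [← integral_conj, mul_left_comm, ← integral_const_mul]
        congr 1
        · simp [Complex.conj_ofNat]
        · refine integral_congr_ae (Eventually.of_forall fun η => ?_)
          simp only [map_mul, ← Complex.exp_conj, Complex.conj_I, Complex.conj_ofReal]
          rw [show -Complex.I * x * η = -(Complex.I * x * η) by ring]
          ring
    _ = (1 / (2 * Real.pi : ℂ)) * ∫ η : ℝ in Ioi (-l), ∫ x : ℝ,
          Complex.exp (-(Complex.I * x * η)) *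
            (((x : ℂ) * f x) * (starRingEnd ℂ) (hat f η / η)) := by
        rw [integral_integral_swap hprod]
    _ = _ := by
        congr 1
        refine integral_congr_ae (Eventually.of_forall fun η => ?_)
        simp only [hat]
        rw [← integral_const_mul]
        refine integral_congr_ae (Eventually.of_forall fun x => ?_)
        simp only
        rw [mul_right_comm Complex.I (x : ℂ) (η : ℂ)]
        ring

/-- If `g^` vanishes at `0` and `∫_{-l}^∞ Re (conj g^ (g^)') / η = 0`, then `g^` vanishes on
`(-l, ∞)`: this is the absence of positive eigenvalues. -/
theorem hat_div_ae_eq_zero (hf : Integrable f volume) (hf2 : MemLp f 2 volume)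
    (hxf : Integrable (fun y : ℝ => (y : ℂ) * f y) volume) (h0 : ∫ y, f y = 0) (hl : 0 < l)
    (him : (∫ η : ℝ in Ioi (-l), (starRingEnd ℂ) (hat f η / η) *
      hat (fun y : ℝ => (y : ℂ) * f y) η).im = 0) :
    ∀ᵐ η : ℝ, η ∈ Ioi (-l) → hat f η / η = 0 := by
  set g := hat f
  set m := hat (fun y : ℝ => (y : ℂ) * f y)
  set B := ∫ y : ℝ, ‖(y : ℂ) * f y‖
  have hQ : Integrable (fun η : ℝ => g η / η) volume := integrable_hat_div hf hf2 hxf h0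
  have hQm : Integrable (fun η : ℝ => (starRingEnd ℂ) (g η / η) * m η) volume :=
    ((LinearIsometryEquiv.integrable_comp_iff Complex.conjLIE).2 hQ).mul_bdd (c := B)
      (continuous_hat hxf).aestronglyMeasurable (Eventually.of_forall fun η => norm_hat_le _ η)
  have hP : Integrable (fun η : ℝ => 2 * ((starRingEnd ℂ) (g η / η) * m η).im) volume :=
    (hQm.im).const_mul 2
  have hgB : ∀ η : ℝ, ‖g η / η‖ ≤ B := fun η => by
    rw [norm_div, Complex.norm_real, Real.norm_eq_abs]
    exact div_le_of_le_mul₀ (abs_nonneg _) (by positivity) (norm_hat_le_mul_abs hf hxf h0 η)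
  have hS : Integrable (fun η : ℝ => ‖g η / η‖ ^ 2) volume := by
    refine (hQ.norm.mul_const B).mono' (hQ.norm.aestronglyMeasurable.pow 2)
      (Eventually.of_forall fun η => ?_)
    rw [Real.norm_of_nonneg (by positivity), sq]
    exact mul_le_mul_of_nonneg_left (hgB η) (norm_nonneg _)
  have hPS : Integrable (fun η : ℝ => 2 * ((starRingEnd ℂ) (g η / η) * m η).im -
      ‖g η / η‖ ^ 2) volume := hP.sub hS
  -- Since `m = i g'`, the first term equals `2 Re (conj g · g') / η`; the second comes from
  -- differentiating `1/η`.
  have hderiv : ∀ η : ℝ, η ≠ 0 → HasDerivAt (fun η => ‖g η‖ ^ 2 / η)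
      (2 * ((starRingEnd ℂ) (g η / η) * m η).im - ‖g η / η‖ ^ 2) η := fun η hη => by
    have h1 := ((hasDerivAt_hat hf hxf η).norm_sq).div (hasDerivAt_id η) hη
    refine h1.congr_deriv ?_
    have hηc : (η : ℂ) ≠ 0 := by exact_mod_cast hη
    have h2 : inner ℝ (g η) (-Complex.I * m η) = ((starRingEnd ℂ) (g η) * m η).im := by
      rw [Complex.inner]
      simp
      ring
    have h3 : ((starRingEnd ℂ) (g η / η) * m η).im = ((starRingEnd ℂ) (g η) * m η).im / η := by
      rw [map_div₀, Complex.conj_ofReal, div_mul_eq_mul_div, Complex.div_ofReal_im]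
    rw [h2, h3, norm_div, Complex.norm_real, div_pow, Real.norm_eq_abs, sq_abs]
    simp only [id]
    change (2 * _ * η - ‖g η‖ ^ 2 * 1) / η ^ 2 = _
    field_simp
  have hG0 : ∀ η : ℝ, |‖g η‖ ^ 2 / η| ≤ B * B * |η| := fun η => by
    rw [abs_div, abs_of_nonneg (by positivity)]
    refine div_le_of_le_mul₀ (abs_nonneg _) (by positivity) ?_
    have := norm_hat_le_mul_abs hf hxf h0 η
    calc ‖g η‖ ^ 2 ≤ (B * |η|) ^ 2 := by gcongr
      _ = _ := by ring
  -- The convention `a / 0 = 0` gives the correct limit, because `|g|² ≤ B² η²`. The fundamental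
  -- theorem of calculus is then used on each side of `0`, where the derivative is not known.
  have hcont0 : ContinuousAt (fun η => ‖g η‖ ^ 2 / η) 0 := by
    rw [ContinuousAt, div_zero]
    refine squeeze_zero_norm hG0 ?_
    have : Continuous fun η : ℝ => B * B * |η| := by fun_prop
    simpa using this.tendsto 0
  have hcont : Continuous fun η => ‖g η‖ ^ 2 / η := continuous_iff_continuousAt.2 fun η => by
    rcases eq_or_ne η 0 with rfl | h
    · exact hcont0
    · exact (hderiv η h).continuousAt
  have i1 : ∫ η in Ioi (0 : ℝ), (2 * ((starRingEnd ℂ) (g η / η) * m η).im - ‖g η / η‖ ^ 2) = 0 := by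
    have hinf : Tendsto (fun η => ‖g η‖ ^ 2 / η) atTop (𝓝 0) := by
      have hM : ∀ η, ‖g η‖ ≤ ∫ y, ‖f y‖ := norm_hat_le f
      refine squeeze_zero' (g := fun η => (∫ y, ‖f y‖) ^ 2 / η) ?_ ?_
        (tendsto_const_nhds.div_atTop tendsto_id)
      · filter_upwards [eventually_gt_atTop 0] with η hη
        positivity
      · filter_upwards [eventually_gt_atTop 0] with η hη
        gcongr
        exact hM η
    have := integral_Ioi_of_hasDerivAt_of_tendsto hcont.continuousWithinAt
      (fun η (hη : 0 < η) => hderiv η hη.ne') hPS.integrableOn hinf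
    simpa using this
  have i2 : ∫ η in (-l)..(0 : ℝ), (2 * ((starRingEnd ℂ) (g η / η) * m η).im - ‖g η / η‖ ^ 2) =
      ‖g (-l)‖ ^ 2 / l := by
    have := intervalIntegral.integral_eq_sub_of_hasDerivAt_of_le (by linarith : -l ≤ 0)
      hcont.continuousOn (fun η hη => hderiv η hη.2.ne) hPS.intervalIntegrable
    rw [this]
    simp [div_neg]
  -- The boundary value of `|g|²/η` at `-l` is negative, which puts the opposite sign on the right.
  -- This is where `l > 0` forces vanishing.
  have i3 : ∫ η in Ioi (-l), ‖g η / η‖ ^ 2 = -(‖g (-l)‖ ^ 2 / l) := by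
    have e1 : ∫ η in Ioi (-l), (2 * ((starRingEnd ℂ) (g η / η) * m η).im - ‖g η / η‖ ^ 2) =
        ‖g (-l)‖ ^ 2 / l := by
      rw [← intervalIntegral.integral_Ioi_sub_Ioi hPS.integrableOn (by linarith : -l ≤ 0)] at i2
      linarith
    have e2 : ∫ η in Ioi (-l), 2 * ((starRingEnd ℂ) (g η / η) * m η).im = 0 := by
      rw [integral_const_mul]
      have h := integral_im (𝕜 := ℂ) (hQm.integrableOn (s := Ioi (-l)))
      simp only [RCLike.im_to_complex] at h
      rw [h, him, mul_zero]
    rw [integral_sub hP.integrableOn hS.integrableOn, e2] at e1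
    linarith
  have i4 : ∫ η in Ioi (-l), ‖g η / η‖ ^ 2 = 0 := by
    refine le_antisymm ?_ (by positivity)
    rw [i3]
    have : 0 ≤ ‖g (-l)‖ ^ 2 / l := by positivity
    linarith
  rw [integral_eq_zero_iff_of_nonneg (fun η => by positivity) hS.integrableOn] at i4
  have i5 := (ae_restrict_iff' measurableSet_Ioi).1 i4
  filter_upwards [i5] with η h hη
  simpa using h hη

/-- As `x` is real, reality of `conj f · n` makes `∫ x f conj n` real, which is the vanishing
imaginary part required by `hat_div_ae_eq_zero`. Only frequencies above `-l` enter the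
representation of `n`, so their vanishing kills `n` everywhere. -/
theorem eq_zero_of_virial (hf : Integrable f volume) (hf2 : MemLp f 2 volume)
    (hxf : Integrable (fun y : ℝ => (y : ℂ) * f y) volume) (h0 : ∫ y, f y = 0) (hl : 0 < l)
    (hn : ∀ x : ℝ, n x = Complex.I * (∫ y in Iic x, f y) +
      (1 / (2 * Real.pi : ℂ)) * ∫ y, oscLim l (x - y) * f y)
    (hreal : ∀ x, ((starRingEnd ℂ) (f x) * n x).im = 0) (x : ℝ) : n x = 0 := by
  have hn' := fun x => (hn x).trans (primitive_add_oscLim_eq hf hf2 hxf h0 hl x)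
  have key := integral_moment_mul_conj hf hf2 hxf h0 hn'
  have him : (∫ x : ℝ, (x : ℂ) * f x * (starRingEnd ℂ) (n x)).im = 0 := by
    have e : ∀ x : ℝ, (x : ℂ) * f x * (starRingEnd ℂ) (n x) =
        ((x * ((starRingEnd ℂ) (f x) * n x).re : ℝ) : ℂ) := fun x => by
      have h1 : f x * (starRingEnd ℂ) (n x) = (starRingEnd ℂ) ((starRingEnd ℂ) (f x) * n x) := by
        simp
      rw [mul_assoc, h1, Complex.conj_eq_iff_im.2 (hreal x), Complex.ofReal_mul]
      congr 1
      exact Complex.ext rfl (hreal x)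
    simp only [e]
    exact (congrArg Complex.im (integral_ofReal (𝕜 := ℂ))).trans (Complex.ofReal_im _)
  rw [key] at him
  have hpi : (1 / (2 * Real.pi : ℂ)) = ((1 / (2 * Real.pi) : ℝ) : ℂ) := by push_cast; rfl
  rw [hpi, Complex.im_ofReal_mul, mul_eq_zero] at him
  have hae := hat_div_ae_eq_zero hf hf2 hxf h0 hl (him.resolve_left (by positivity))
  rw [hn' x, setIntegral_congr_ae (g := fun _ => 0) measurableSet_Ioi ?_, integral_zero, mul_zero]
  filter_upwards [hae] with η h hη
  rw [h hη, mul_zero]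

end BOScattering

namespace BOScattering

open scoped BoundedContinuousFunction

variable {f n : ℝ → ℂ} {l : ℝ} {σ : Side}

/-! ### Mean zero -/

/-- The sign `±i` attached to the side of the cut. -/
noncomputable def sideSign : Side → ℂ
  | Side.upper => Complex.I
  | Side.lower => -Complex.I

theorem sideSign_ne_zero (σ : Side) : sideSign σ ≠ 0 := by cases σ <;> simp [sideSign]

/-- The oscillatory part satisfies `conj k(-x) = k(x)` and cancels. The jump and its reflected
conjugate fill complementary half lines, leaving the same constant on both. -/
theorem modKernel_sub_conj (hl : 0 < l) {x : ℝ} (hx : x ≠ 0) :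
    modKernel σ l x - (starRingEnd ℂ) (modKernel σ l (-x)) = sideSign σ := by
  rw [modKernel_eq σ hl hx, modKernel_eq σ hl (neg_ne_zero.2 hx), map_add, map_div₀,
    conj_oscLim hl (neg_ne_zero.2 hx), neg_neg]
  simp only [map_mul, Complex.conj_ofNat, Complex.conj_ofReal]
  have : jumpPart σ x - (starRingEnd ℂ) (jumpPart σ (-x)) = sideSign σ := by
    rcases lt_or_gt_of_ne hx with h | h <;> cases σ <;>
      simp [jumpPart, sideSign, indicator, h, h.not_gt]
  rw [← this]
  ring

theorem aestronglyMeasurable_modKernel (σ : Side) (hl : 0 < l) :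
    AEStronglyMeasurable (modKernel σ l) volume := by
  obtain ⟨b, k, hbk, hb, -, -, hk⟩ := admissibleKernel_modKernel σ hl
  exact (hb.add hk.1).congr (Eventually.of_forall fun x => (hbk x).symm)

theorem integrable_modKernel_form (hf : Integrable f volume) (hf2 : MemLp f 2 volume)
    (hl : 0 < l) :
    Integrable (fun p : ℝ × ℝ => (starRingEnd ℂ) (f p.1) * (modKernel σ l (p.1 - p.2) * f p.2))
      (volume.prod volume) := by
  have hK := admissibleKernel_modKernel σ hl
  obtain ⟨M, hM0, hM⟩ := hK.exists_bound hf hf2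
  have hfc : Integrable (fun x => (starRingEnd ℂ) (f x)) volume :=
    (LinearIsometryEquiv.integrable_comp_iff Complex.conjLIE).2 hf
  have hm1 := AEStronglyMeasurable.convolution_integrand (μ := volume) (ν := volume)
    (ContinuousLinearMap.mul ℝ ℂ) hf.aestronglyMeasurable (aestronglyMeasurable_modKernel σ hl)
  have hm : AEStronglyMeasurable (fun p : ℝ × ℝ => (starRingEnd ℂ) (f p.1) *
      (modKernel σ l (p.1 - p.2) * f p.2)) (volume.prod volume) := by
    refine hfc.aestronglyMeasurable.comp_fst.mul (hm1.congr (Eventually.of_forall fun p => ?_))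
    simp only [ContinuousLinearMap.mul_apply', mul_comm]
  rw [integrable_prod_iff hm]
  refine ⟨Eventually.of_forall fun x => (hK.integrable hf hf2 x).const_mul ((starRingEnd ℂ) (f x)), ?_⟩
  refine (hf.norm.mul_const M).mono' hm.norm.integral_prod_right' (Eventually.of_forall fun x => ?_)
  rw [Real.norm_of_nonneg (integral_nonneg fun y => norm_nonneg _)]
  simp only [norm_mul (_ : ℂ) (modKernel σ l _ * _), RCLike.norm_conj]
  rw [integral_const_mul]
  gcongr
  exact hM x

/-- The form `∬ conj f(x) K(x-y) f(y)` is real, so it equals its own conjugate. By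
`modKernel_sub_conj`, form minus conjugate is `±i |∫ f|²`. -/
theorem integral_eq_zero_of_real (hf : Integrable f volume) (hf2 : MemLp f 2 volume) (hl : 0 < l)
    (hn : ∀ x, n x = ∫ y, modKernel σ l (x - y) * f y)
    (hreal : ∀ x, ((starRingEnd ℂ) (f x) * n x).im = 0) : ∫ y, f y = 0 := by
  have hP := integrable_modKernel_form (σ := σ) hf hf2 hl
  set P : ℝ → ℝ → ℂ := fun x y => (starRingEnd ℂ) (f x) * (modKernel σ l (x - y) * f y)
  have hPc : Integrable (fun p : ℝ × ℝ => (starRingEnd ℂ) (P p.2 p.1)) (volume.prod volume) :=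
    (LinearIsometryEquiv.integrable_comp_iff Complex.conjLIE).2 hP.swap
  have h1 : ∀ x, (starRingEnd ℂ) (f x) * n x = ∫ y, P x y := fun x => by
    rw [hn x, ← integral_const_mul]
  have h2 : (starRingEnd ℂ) (∫ x, ∫ y, P x y) = ∫ x, ∫ y, P x y := by
    rw [← integral_conj]
    refine integral_congr_ae (Eventually.of_forall fun x => ?_)
    simp only [← h1 x]
    exact Complex.conj_eq_iff_im.2 (hreal x)
  have h3 : (starRingEnd ℂ) (∫ x, ∫ y, P x y) = ∫ x, ∫ y, (starRingEnd ℂ) (P y x) := by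
    rw [integral_integral_swap hP, ← integral_conj]
    simp only [← integral_conj]
  have h4 : ∫ x, ∫ y, (P x y - (starRingEnd ℂ) (P y x)) = 0 := by
    rw [integral_integral_sub hP hPc, ← h3, h2, sub_self]
  have h5 : ∀ x, ∫ y, (P x y - (starRingEnd ℂ) (P y x)) =
      (starRingEnd ℂ) (f x) * (sideSign σ * ∫ y, f y) := fun x => by
    rw [← integral_const_mul, ← integral_const_mul]
    refine integral_congr_ae ?_
    filter_upwards [compl_mem_ae_iff.2 (measure_singleton x)] with y hy
    have hne : x - y ≠ 0 := fun h => hy (sub_eq_zero.1 h).symm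
    rw [← modKernel_sub_conj (σ := σ) hl hne]
    simp only [P, map_mul, Complex.conj_conj, neg_sub]
    ring
  simp only [h5] at h4
  rw [integral_mul_const, integral_conj] at h4
  rcases mul_eq_zero.1 h4 with h | h
  · simpa using h
  · exact (mul_eq_zero.1 h).resolve_left (sideSign_ne_zero σ)

theorem integrable_oscLim_translate_mul (hl : 0 < l) (hf2 : MemLp f 2 volume) (x : ℝ) :
    Integrable (fun y => oscLim l (x - y) * f y) volume :=
  integrable_translate_mul (memLp_oscLim hl) hf2 x

/-- With mean zero, `-i ∫_x^∞ f = i ∫_{-∞}^x f`: the two sides of the cut give the same function,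
and one virial argument covers both. -/
theorem integral_modKernel_eq (hf : Integrable f volume) (hf2 : MemLp f 2 volume)
    (h0 : ∫ y, f y = 0) (hl : 0 < l) (x : ℝ) :
    ∫ y, modKernel σ l (x - y) * f y = Complex.I * (∫ y in Iic x, f y) +
      (1 / (2 * Real.pi : ℂ)) * ∫ y, oscLim l (x - y) * f y := by
  have hj : Integrable (fun y => jumpPart σ (x - y) * f y) volume :=
    hf.bdd_mul (c := 1) (aestronglyMeasurable_const_sub
      (measurable_jumpPart σ).aestronglyMeasurable x)
      (Eventually.of_forall fun y => norm_jumpPart_le σ _)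
  have e1 : ∫ y, modKernel σ l (x - y) * f y = ∫ y, (jumpPart σ (x - y) * f y +
      (1 / (2 * Real.pi : ℂ)) * (oscLim l (x - y) * f y)) := by
    refine integral_congr_ae ?_
    filter_upwards [compl_mem_ae_iff.2 (measure_singleton x)] with y hy
    have hne : x - y ≠ 0 := fun h => hy (sub_eq_zero.1 h).symm
    rw [modKernel_eq σ hl hne]
    ring
  rw [e1, integral_add hj ((integrable_oscLim_translate_mul hl hf2 x).const_mul _),
    integral_const_mul]
  congr 1
  cases σ
  · have e : ∀ y, jumpPart Side.upper (x - y) * f y =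
        Complex.I * (Iio x).indicator f y := fun y => by
      simp only [jumpPart, indicator, mem_Ioi, mem_Iio, sub_pos]
      split_ifs <;> simp
    simp only [e]
    rw [integral_const_mul, integral_indicator measurableSet_Iio, integral_Iic_eq_integral_Iio]
  · have e : ∀ y, jumpPart Side.lower (x - y) * f y =
        -Complex.I * (Ioi x).indicator f y := fun y => by
      simp only [jumpPart, indicator, mem_Ioi, mem_Iio, sub_neg]
      split_ifs <;> simp
    simp only [e]
    rw [integral_const_mul, integral_indicator measurableSet_Ioi]
    have := integral_add_compl (measurableSet_Iic (a := x)) hf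
    rw [compl_Iic, h0] at this
    rw [eq_neg_of_add_eq_zero_left this]
    ring

/-! ### Decay of solutions of the homogeneous equation -/

theorem weight_le_add (x y : ℝ) : weight x ≤ weight y + |x - y| := by
  unfold weight
  have := abs_add_le y (x - y)
  rw [add_sub_cancel] at this
  linarith

theorem abs_mul_oscMajorant_le (t : ℝ) : |t| * oscMajorant t ≤ 1 := by
  unfold oscMajorant
  split_ifs with h
  · rcases eq_or_ne t 0 with rfl | ht
    · simp
    · have ht' : 0 < |t| := abs_pos.2 ht
      calc |t| * |t| ^ (-(1 / 4) : ℝ) = |t| ^ (1 + -(1 / 4) : ℝ) := by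
            rw [Real.rpow_add ht', Real.rpow_one]
        _ ≤ 1 := Real.rpow_le_one (abs_nonneg _) h (by norm_num)
  · exact mul_inv_le_one

/-- Moves the weight from `x` to `y`. The excess is at most `1 + |x - y|`, and the majorant absorbs
one power of `|x - y|` but no more, which is why `b ≤ 1`. -/
theorem weight_rpow_mul_oscMajorant_le {b : ℝ} (hb0 : 0 ≤ b) (hb1 : b ≤ 1) (x y : ℝ) :
    weight x ^ b * oscMajorant (x - y) ≤ 2 * weight y ^ b * oscMajorant (x - y) + 1 := by
  have h1 : weight x ^ b ≤ weight y ^ b + (1 + |x - y|) := by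
    calc weight x ^ b ≤ (weight y + |x - y|) ^ b :=
          Real.rpow_le_rpow (weight_pos x).le (weight_le_add x y) hb0
      _ ≤ weight y ^ b + |x - y| ^ b :=
          Real.rpow_add_le_add_rpow (weight_pos y).le (abs_nonneg _) hb0 hb1
      _ ≤ _ := by
          gcongr
          rcases le_total |x - y| 1 with h | h
          · exact (Real.rpow_le_one (abs_nonneg _) h hb0).trans (by linarith [abs_nonneg (x - y)])
          · exact (Real.rpow_le_rpow_of_exponent_le h hb1).trans (by rw [Real.rpow_one]; linarith)
  have h2 : 1 ≤ weight y ^ b := Real.one_le_rpow (one_le_weight y) hb0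
  have h3 := abs_mul_oscMajorant_le (x - y)
  have h4 := oscMajorant_nonneg (x - y)
  nlinarith

/-- One round of the decay bootstrap: a weight on `f` passes to `n`. For the primitive, mean zero
permits the tail with `|y| ≥ |x|`, on which `w(x)^b ≤ w(y)^b`; for the oscillatory part the weight
is moved by `weight_rpow_mul_oscMajorant_le`. -/
theorem exists_weighted_bound {b : ℝ} (hb0 : 0 ≤ b) (hb1 : b ≤ 1) (hl : 0 < l)
    (hf : Integrable f volume) (hf2 : MemLp f 2 volume) (h0 : ∫ y, f y = 0)
    (hg : Integrable (fun y => ((weight y ^ b : ℝ) : ℂ) * f y) volume)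
    (hg2 : MemLp (fun y => ((weight y ^ b : ℝ) : ℂ) * f y) 2 volume)
    (hn : ∀ x : ℝ, n x = Complex.I * (∫ y in Iic x, f y) +
      (1 / (2 * Real.pi : ℂ)) * ∫ y, oscLim l (x - y) * f y) :
    ∃ C, ∀ x, ‖n x‖ ≤ C * weight x ^ (-b) := by
  set g : ℝ → ℂ := fun y => ((weight y ^ b : ℝ) : ℂ) * f y
  have hgn : ∀ y, ‖g y‖ = weight y ^ b * ‖f y‖ := fun y => by
    rw [norm_mul, Complex.norm_real, Real.norm_of_nonneg (weight_rpow_pos _ _).le]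
  have hmaj : MemLp (fun t => (oscMajorant t : ℂ)) 2 volume := memLp_oscMajorant.ofReal
  set c := 4 + 2 / l
  have hc : 0 ≤ c := by positivity
  set A := (∫ y, ‖(oscMajorant y : ℂ)‖ ^ 2) + ∫ y, ‖g y‖ ^ 2
  have htail : ∀ x, weight x ^ b * ‖∫ y in Iic x, f y‖ ≤ ∫ y, ‖g y‖ := by
    intro x
    have key : ∀ s : Set ℝ, MeasurableSet s → (∀ y ∈ s, |x| ≤ |y|) →
        weight x ^ b * ‖∫ y in s, f y‖ ≤ ∫ y, ‖g y‖ := fun s hs hsx => by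
      calc weight x ^ b * ‖∫ y in s, f y‖ ≤ weight x ^ b * ∫ y in s, ‖f y‖ := by
            gcongr
            · exact (weight_rpow_pos _ _).le
            · exact norm_integral_le_integral_norm _
        _ = ∫ y in s, weight x ^ b * ‖f y‖ := (integral_const_mul _ _).symm
        _ ≤ ∫ y in s, ‖g y‖ := by
            refine setIntegral_mono_on (hf.norm.const_mul _).integrableOn hg.norm.integrableOn hs
              fun y hy => ?_
            rw [hgn]
            gcongr
            · exact (weight_pos x).le
            · unfold weight
              linarith [hsx y hy]
        _ ≤ ∫ y, ‖g y‖ := setIntegral_le_integral hg.norm (Eventually.of_forall fun y => norm_nonneg _)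
    rcases le_or_gt x 0 with h | h
    · refine key (Iic x) measurableSet_Iic fun y (hy : y ≤ x) => ?_
      rw [abs_of_nonpos h, abs_of_nonpos (hy.trans h)]
      linarith
    · have := integral_add_compl (measurableSet_Iic (a := x)) hf
      rw [compl_Iic, h0] at this
      rw [eq_neg_of_add_eq_zero_left this, norm_neg]
      refine key (Ioi x) measurableSet_Ioi fun y (hy : x < y) => ?_
      rw [abs_of_pos h, abs_of_pos (h.trans hy)]
      exact hy.le
  have hosc : ∀ x, weight x ^ b * ‖∫ y, oscLim l (x - y) * f y‖ ≤ c * (2 * A + ∫ y, ‖f y‖) := by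
    intro x
    have hint := integrable_translate_mul hmaj hg2 x
    have hne : ∀ᵐ y : ℝ, x - y ≠ 0 := by
      filter_upwards [compl_mem_ae_iff.2 (measure_singleton x)] with y hy
      exact fun h => hy (sub_eq_zero.1 h).symm
    calc weight x ^ b * ‖∫ y, oscLim l (x - y) * f y‖
        ≤ weight x ^ b * ∫ y, ‖oscLim l (x - y) * f y‖ := by
          gcongr
          · exact (weight_rpow_pos _ _).le
          · exact norm_integral_le_integral_norm _
      _ = ∫ y, weight x ^ b * ‖oscLim l (x - y) * f y‖ := (integral_const_mul _ _).symm
      _ ≤ ∫ y, c * (2 * ‖(oscMajorant (x - y) : ℂ) * g y‖ + ‖f y‖) := by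
          refine integral_mono_ae ((integrable_oscLim_translate_mul hl hf2 x).norm.const_mul _)
            (((hint.norm.const_mul 2).add hf.norm).const_mul c) ?_
          filter_upwards [hne] with y hy
          have h1 := norm_oscLim_le hl hy
          have h2 := weight_rpow_mul_oscMajorant_le hb0 hb1 x y
          rw [norm_mul, norm_mul, hgn, Complex.norm_real,
            Real.norm_of_nonneg (oscMajorant_nonneg _)]
          calc weight x ^ b * (‖oscLim l (x - y)‖ * ‖f y‖)
              ≤ weight x ^ b * ((c * oscMajorant (x - y)) * ‖f y‖) := by
                gcongr
                exact (weight_rpow_pos _ _).le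
            _ = c * ((weight x ^ b * oscMajorant (x - y)) * ‖f y‖) := by ring
            _ ≤ c * ((2 * weight y ^ b * oscMajorant (x - y) + 1) * ‖f y‖) := by gcongr
            _ = _ := by ring
      _ = c * (2 * (∫ y, ‖(oscMajorant (x - y) : ℂ) * g y‖) + ∫ y, ‖f y‖) := by
          rw [integral_const_mul, integral_add (hint.norm.const_mul 2) hf.norm, integral_const_mul]
      _ ≤ _ := by
          gcongr
          exact integral_norm_translate_mul_le hmaj hg2 x
  refine ⟨(∫ y, ‖g y‖) + (1 / (2 * Real.pi)) * (c * (2 * A + ∫ y, ‖f y‖)), fun x => ?_⟩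
  have hw := weight_rpow_pos b x
  rw [Real.rpow_neg (weight_pos x).le, ← div_eq_mul_inv, le_div_iff₀ hw, mul_comm, hn x]
  calc weight x ^ b * ‖Complex.I * (∫ y in Iic x, f y) +
      (1 / (2 * Real.pi : ℂ)) * ∫ y, oscLim l (x - y) * f y‖
      ≤ weight x ^ b * (‖∫ y in Iic x, f y‖ +
          (1 / (2 * Real.pi)) * ‖∫ y, oscLim l (x - y) * f y‖) := by
        gcongr
        refine (norm_add_le _ _).trans (le_of_eq ?_)
        rw [norm_mul, norm_mul, Complex.norm_I, one_mul]
        congr 2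
        simp [abs_of_pos Real.pi_pos]
    _ = weight x ^ b * ‖∫ y in Iic x, f y‖ + (1 / (2 * Real.pi)) *
          (weight x ^ b * ‖∫ y, oscLim l (x - y) * f y‖) := by ring
    _ ≤ _ := add_le_add (htail x) (mul_le_mul_of_nonneg_left (hosc x) (by positivity))

theorem aestronglyMeasurable_weight_mul {g : ℝ → ℂ} (b : ℝ) (hg : AEStronglyMeasurable g volume) :
    AEStronglyMeasurable (fun y => ((weight y ^ b : ℝ) : ℂ) * g y) volume :=
  (Complex.continuous_ofReal.comp (continuous_weight_rpow b)).aestronglyMeasurable.mul hg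

/-- The homogeneous equation `n = K * (u n)` has no nontrivial bounded solution. -/
theorem eq_zero_of_homogeneous {u : ℝ → ℝ} {ε C : ℝ} (hε : 0 < ε) (hl : 0 < l)
    (hv : Integrable (fun y => ((weight y ^ ε : ℝ) : ℂ) * (u y : ℂ)) volume)
    (hv2 : MemLp (fun y => ((weight y ^ ε : ℝ) : ℂ) * (u y : ℂ)) 2 volume)
    (hum : AEStronglyMeasurable (fun y => (u y : ℂ) * n y) volume)
    (hC : ∀ x, ‖n x‖ ≤ C)
    (hn : ∀ x, n x = ∫ y, modKernel σ l (x - y) * ((u y : ℂ) * n y)) (x : ℝ) : n x = 0 := by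
  set f : ℝ → ℂ := fun y => (u y : ℂ) * n y
  have hreal : ∀ x, ((starRingEnd ℂ) (f x) * n x).im = 0 := fun x => by
    have : (starRingEnd ℂ) (f x) * n x = ((u x * Complex.normSq (n x) : ℝ) : ℂ) := by
      simp only [f, map_mul, Complex.conj_ofReal, Complex.ofReal_mul, Complex.normSq_eq_conj_mul_self]
      ring
    rw [this, Complex.ofReal_im]
  -- Since `w^ε u` still lies in `L¹ ∩ L²`, the product `f = u n` carries `ε` more weight than `n`
  -- does.
  have decay : ∀ a b C' : ℝ, b ≤ a + ε → (∀ x, ‖n x‖ ≤ C' * weight x ^ (-a)) →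
      Integrable (fun y => ((weight y ^ b : ℝ) : ℂ) * f y) volume ∧
      MemLp (fun y => ((weight y ^ b : ℝ) : ℂ) * f y) 2 volume := by
    intro a b C' hab hC'
    have hle : ∀ y, ‖((weight y ^ b : ℝ) : ℂ) * f y‖ ≤
        ‖(C' : ℂ) * (((weight y ^ ε : ℝ) : ℂ) * (u y : ℂ))‖ := fun y => by
      have hC0 : 0 ≤ C' := by
        have := (norm_nonneg _).trans (hC' y)
        exact nonneg_of_mul_nonneg_left this (weight_rpow_pos _ _)
      simp only [f, norm_mul, Complex.norm_real, Real.norm_of_nonneg (weight_rpow_pos _ _).le,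
        Real.norm_of_nonneg hC0]
      have h1 : weight y ^ b * weight y ^ (-a) ≤ weight y ^ ε := by
        rw [← Real.rpow_add (weight_pos y)]
        exact Real.rpow_le_rpow_of_exponent_le (one_le_weight y) (by linarith)
      calc weight y ^ b * (‖u y‖ * ‖n y‖) ≤ weight y ^ b * (‖u y‖ * (C' * weight y ^ (-a))) := by
            gcongr
            · exact (weight_rpow_pos _ _).le
            · exact hC' y
        _ = C' * ((weight y ^ b * weight y ^ (-a)) * ‖u y‖) := by ring
        _ ≤ _ := by gcongr
    have hm := aestronglyMeasurable_weight_mul b hum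
    exact ⟨(hv.const_mul (C' : ℂ)).mono hm (Eventually.of_forall hle),
      (hv2.const_mul (C' : ℂ)).of_le hm (Eventually.of_forall hle)⟩
  have hbase : ∀ x, ‖n x‖ ≤ C * weight x ^ (-(0 : ℝ)) := fun x => by simpa using hC x
  obtain ⟨hf, hf2⟩ := decay 0 0 C (by linarith) hbase
  simp only [Real.rpow_zero, Complex.ofReal_one, one_mul] at hf hf2
  have h0 := integral_eq_zero_of_real hf hf2 hl hn hreal
  have hn' := fun x => (hn x).trans (integral_modKernel_eq hf hf2 h0 hl x)
  -- Each round gains `ε`, capped at `1` by the kernel; exponent `1` already makes `x f` integrable.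
  have boot : ∀ j : ℕ, ∃ C', ∀ x, ‖n x‖ ≤ C' * weight x ^ (-(min 1 (j * ε))) := by
    intro j
    induction j with
    | zero => exact ⟨C, fun x => by simpa using hC x⟩
    | succ j ih =>
      obtain ⟨C', hC'⟩ := ih
      have hb : min 1 (((j + 1 : ℕ) : ℝ) * ε) ≤ min 1 (j * ε) + ε := by
        rw [← min_add_add_right]
        refine min_le_min (by linarith) ?_
        push_cast
        linarith
      obtain ⟨hg, hg2⟩ := decay _ _ C' hb hC'
      exact exists_weighted_bound (le_min zero_le_one (by positivity)) (min_le_left _ _) hl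
        hf hf2 h0 hg hg2 hn'
  obtain ⟨j, hj⟩ := exists_nat_ge (1 / ε)
  obtain ⟨C', hC'⟩ := boot j
  rw [min_eq_left (by rwa [div_le_iff₀ hε] at hj)] at hC'
  obtain ⟨hw, -⟩ := decay 1 1 C' (by linarith) hC'
  have hxf : Integrable (fun y : ℝ => (y : ℂ) * f y) volume := by
    refine hw.mono (Complex.continuous_ofReal.aestronglyMeasurable.mul hum)
      (Eventually.of_forall fun y => ?_)
    rw [norm_mul _ (f y), norm_mul _ (f y), Complex.norm_real, Complex.norm_real, Real.rpow_one,
      Real.norm_of_nonneg (weight_pos y).le, Real.norm_eq_abs]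
    gcongr
    unfold weight
    linarith
  exact eq_zero_of_virial hf hf2 hxf h0 hl hn' hreal x

end BOScattering

namespace BOScattering

open scoped BoundedContinuousFunction

/-! ### Weighted potentials -/

/-- The potential multiplied by `w^t`. -/
noncomputable def weightedPotential (u : ℝ → ℝ) (t y : ℝ) : ℂ := ((weight y ^ t : ℝ) : ℂ) * (u y : ℂ)

theorem memLp_weight_rpow {a : ℝ} (ha : a < -(1 / 2)) :
    MemLp (fun x => ((weight x ^ a : ℝ) : ℂ)) 2 volume := by
  refine (memLp_two_iff_integrable_sq_norm (Complex.continuous_ofReal.comp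
    (continuous_weight_rpow a)).aestronglyMeasurable).2 ?_
  have h := integrable_one_add_norm (E := ℝ) (μ := volume) (r := -(2 * a)) (by simp; linarith)
  refine h.congr (Eventually.of_forall fun x => ?_)
  simp only [Complex.norm_real, neg_neg, Function.comp_apply]
  rw [Real.norm_of_nonneg (weight_rpow_pos _ _).le, ← Real.rpow_natCast,
    ← Real.rpow_mul (weight_pos x).le, mul_comm]
  rfl

variable {u : ℝ → ℝ} {s t : ℝ}

theorem weightedPotential_eq (u : ℝ → ℝ) (s t y : ℝ) :
    weightedPotential u t y = ((weight y ^ (t - s) : ℝ) : ℂ) * weightedPotential u s y := by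
  unfold weightedPotential
  have h : weight y ^ t = weight y ^ (t - s) * weight y ^ s := by
    rw [← Real.rpow_add (weight_pos y), sub_add_cancel]
  rw [h, Complex.ofReal_mul, mul_assoc]

theorem MemWeightedLp.memLp_self (hu : MemWeightedLp 2 s u) :
    MemLp (weightedPotential u s) 2 volume := by
  have := MemLp.ofReal (K := ℂ) hu
  refine this.ae_eq (Eventually.of_forall fun y => ?_)
  simp [weightedPotential]

theorem MemWeightedLp.memLp (hu : MemWeightedLp 2 s u) (ht : t ≤ s) :
    MemLp (weightedPotential u t) 2 volume := by
  have hs := hu.memLp_self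
  have e : weightedPotential u t = fun y => ((weight y ^ (t - s) : ℝ) : ℂ) * weightedPotential u s y :=
    funext (weightedPotential_eq u s t)
  rw [e]
  refine hs.of_le (aestronglyMeasurable_weight_mul _ hs.1) (Eventually.of_forall fun y => ?_)
  rw [norm_mul, Complex.norm_real, Real.norm_of_nonneg (weight_rpow_pos _ _).le]
  exact mul_le_of_le_one_left (norm_nonneg _)
    (Real.rpow_le_one_of_one_le_of_nonpos (one_le_weight y) (by linarith))

/-- Cauchy–Schwarz against `w^{t-s}`, which is square integrable exactly in the stated range of `t`.
-/
theorem MemWeightedLp.integrable (hu : MemWeightedLp 2 s u) (ht : t < s - 1 / 2) :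
    Integrable (weightedPotential u t) volume := by
  have e : weightedPotential u t = fun y => ((weight y ^ (t - s) : ℝ) : ℂ) * weightedPotential u s y :=
    funext (weightedPotential_eq u s t)
  rw [e]
  exact (memLp_weight_rpow (by linarith)).integrable_mul hu.memLp_self

theorem weightedPotential_mul (u : ℝ → ℝ) (r y : ℝ) (z : ℂ) :
    weightedPotential u r y * z = (u y : ℂ) * (((weight y ^ r : ℝ) : ℂ) * z) := by
  unfold weightedPotential; ring

theorem ofReal_weight_rpow_mul_neg (r x : ℝ) :
    ((weight x ^ r : ℝ) : ℂ) * ((weight x ^ (-r) : ℝ) : ℂ) = 1 := by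
  rw [← Complex.ofReal_mul, weight_rpow_mul_neg, Complex.ofReal_one]

/-! ### The Jost equation as an equation in the space of bounded continuous functions -/

variable {s₁ l : ℝ} {σ : Side}

/-- The parameters of the problem. -/
structure JostData (u : ℝ → ℝ) (s s₁ : ℝ) : Prop where
  half_lt : 1 / 2 < s₁
  lt : s₁ < s
  mem : MemWeightedLp 2 s u

namespace JostData

theorem pos (d : JostData u s s₁) : 0 < s - s₁ := sub_pos.2 d.lt

theorem integrable_q (d : JostData u s s₁) :
    Integrable (weightedPotential u (s - s₁)) volume :=
  d.mem.integrable (by linarith [d.half_lt])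

theorem memLp_q (d : JostData u s s₁) : MemLp (weightedPotential u (s - s₁)) 2 volume :=
  d.mem.memLp (by linarith [d.half_lt])

/-- The conjugated operator `φ ↦ w^{-r} (e^{-il·} G_{l ± i0}) * (u w^r φ)`. -/
noncomputable def op (d : JostData u s s₁) (σ : Side) (hl : 0 < l) :
    (ℝ →ᵇ ℂ) →L[ℂ] (ℝ →ᵇ ℂ) :=
  weightedConvCLM d.pos.le (admissibleKernel_modKernel σ hl) d.integrable_q d.memLp_q

theorem op_apply (d : JostData u s s₁) (hl : 0 < l) (φ : ℝ →ᵇ ℂ) (x : ℝ) :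
    d.op σ hl φ x = ((weight x ^ (-(s - s₁)) : ℝ) : ℂ) *
      ∫ y, modKernel σ l (x - y) * weightedPotential u (s - s₁) y * φ y := rfl

/-- A priori `n = w^r φ` may grow, but the fixed point equation exhibits it as an unweighted
convolution integral, which is bounded. -/
theorem eq_zero_of_op_eq (d : JostData u s s₁) (hl : 0 < l) (φ : ℝ →ᵇ ℂ)
    (h : d.op σ hl φ = φ) : φ = 0 := by
  set r := s - s₁ with hr
  set q := weightedPotential u r
  have hK := admissibleKernel_modKernel σ hl
  obtain ⟨M, hM0, hM⟩ := hK.exists_bound d.integrable_q d.memLp_q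
  set n : ℝ → ℂ := fun y => ((weight y ^ r : ℝ) : ℂ) * φ y
  have hun : ∀ y, (u y : ℂ) * n y = q y * φ y := fun y => (weightedPotential_mul u r y _).symm
  have hn : ∀ x, n x = ∫ y, modKernel σ l (x - y) * q y * φ y := fun x => by
    simp only [n]
    rw [← h, op_apply, ← mul_assoc, ofReal_weight_rpow_mul_neg, one_mul, h]
  -- Half of the available room `s - 1/2` is taken as `ε`; any positive `ε` below `s - 1/2` keeps
  -- `w^ε u` in `L¹ ∩ L²`.
  have key := eq_zero_of_homogeneous (n := n) (l := l) (σ := σ) (u := u)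
    (ε := (s - 1 / 2) / 2) (C := M * ‖φ‖) (by linarith [d.half_lt, d.lt]) hl
    (d.mem.integrable (by linarith [d.half_lt, d.lt])) (d.mem.memLp (by linarith [d.half_lt, d.lt]))
    ?_ (fun x => ?_) (fun x => ?_)
  · ext x
    have := key x
    simp only [n, mul_eq_zero, Complex.ofReal_eq_zero, (weight_rpow_pos r x).ne', false_or] at this
    simpa using this
  · simp only [hun]
    exact d.integrable_q.aestronglyMeasurable.mul φ.continuous.aestronglyMeasurable
  · rw [hn x]
    exact (norm_integral_mul_bcf_le (hK.integrable d.integrable_q d.memLp_q x) φ).trans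
      (mul_le_mul_of_nonneg_right (hM x) (norm_nonneg _))
  · simp only [hun, ← mul_assoc, hn x]

theorem isUnit_one_sub_op (d : JostData u s s₁) (σ : Side) (hl : 0 < l) :
    IsUnit (1 - d.op σ hl) :=
  isUnit_one_sub_weightedConvCLM d.pos _ _ _ fun φ h => d.eq_zero_of_op_eq hl φ h

end JostData

theorem norm_weighted_rhs_le {r : ℝ} (hr : 0 ≤ r) (l : ℝ) (g : ℝ →ᵇ ℂ) (x : ℝ) :
    ‖((weight x ^ (-r) : ℝ) : ℂ) * ((starRingEnd ℂ) (planeWave l x) * g x)‖ ≤ ‖g‖ := by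
  rw [norm_mul, norm_mul, RCLike.norm_conj, norm_planeWave, one_mul, Complex.norm_real,
    Real.norm_of_nonneg (weight_rpow_pos _ _).le]
  exact (mul_le_of_le_one_left (norm_nonneg _) (weight_rpow_neg_le_one hr x)).trans
    (g.norm_coe_le_norm x)

/-- The right hand side `w^{-r} e^{-il·} g`. -/
noncomputable def weightedRhs {r : ℝ} (hr : 0 ≤ r) (l : ℝ) (g : ℝ →ᵇ ℂ) : ℝ →ᵇ ℂ :=
  BoundedContinuousFunction.ofNormedAddCommGroup
    (fun x => ((weight x ^ (-r) : ℝ) : ℂ) * ((starRingEnd ℂ) (planeWave l x) * g x))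
    ((Complex.continuous_ofReal.comp (continuous_weight_rpow (-r))).mul
      ((Complex.continuous_conj.comp (continuous_planeWave l)).mul g.continuous))
    ‖g‖ (norm_weighted_rhs_le hr l g)

theorem weightedRhs_apply {r : ℝ} (hr : 0 ≤ r) (l : ℝ) (g : ℝ →ᵇ ℂ) (x : ℝ) :
    weightedRhs hr l g x =
      ((weight x ^ (-r) : ℝ) : ℂ) * ((starRingEnd ℂ) (planeWave l x) * g x) := rfl

theorem greenKernel_sub_mul (σ : Side) (l x y : ℝ) (z : ℂ) :
    greenKernel σ l (x - y) * z =
      planeWave l x * (modKernel σ l (x - y) * ((starRingEnd ℂ) (planeWave l y) * z)) := by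
  have h := conj_planeWave_mul l (x - y)
  have h2 := planeWave_sub l x y
  unfold modKernel
  calc greenKernel σ l (x - y) * z
      = ((starRingEnd ℂ) (planeWave l (x - y)) * planeWave l (x - y)) *
          (greenKernel σ l (x - y) * z) := by rw [h, one_mul]
    _ = (starRingEnd ℂ) (planeWave l (x - y)) * (planeWave l x * (starRingEnd ℂ) (planeWave l y)) *
          (greenKernel σ l (x - y) * z) := by rw [← h2]
    _ = _ := by ring

/-- The function `e^{il·} w^r φ`. -/
noncomputable def unweight (r l : ℝ) (φ : ℝ →ᵇ ℂ) (x : ℝ) : ℂ :=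
  planeWave l x * (((weight x ^ r : ℝ) : ℂ) * φ x)

namespace JostData

theorem conj_mul_unweight (r l : ℝ) (φ : ℝ →ᵇ ℂ) (x : ℝ) :
    (starRingEnd ℂ) (planeWave l x) * unweight r l φ x = ((weight x ^ r : ℝ) : ℂ) * φ x := by
  rw [unweight, ← mul_assoc, conj_planeWave_mul, one_mul]

theorem smul_unweight (r l : ℝ) (φ : ℝ →ᵇ ℂ) (x : ℝ) :
    (weight x ^ (-r)) • unweight r l φ x = planeWave l x * φ x := by
  rw [unweight, Complex.real_smul]
  linear_combination (planeWave l x * φ x) * ofReal_weight_rpow_mul_neg r x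

theorem conj_planeWave_mul_unweight (u : ℝ → ℝ) (r l : ℝ) (φ : ℝ →ᵇ ℂ) (y : ℝ) :
    (starRingEnd ℂ) (planeWave l y) * ((u y : ℂ) * unweight r l φ y) =
      weightedPotential u r y * φ y := by
  rw [mul_left_comm, conj_mul_unweight, weightedPotential_mul]

theorem solvesJostEquation_unweight (d : JostData u s s₁) (hl : 0 < l) (g φ : ℝ →ᵇ ℂ)
    (h : φ = weightedRhs d.pos.le l g + d.op σ hl φ) :
    SolvesJostEquation u (s - s₁) σ l g (unweight (s - s₁) l φ) := by
  set r := s - s₁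
  refine ⟨?_, Eventually.of_forall fun x => ?_⟩
  · unfold MemWeightedLp
    simp only [smul_unweight]
    refine memLp_top_of_bound ((continuous_planeWave l).mul φ.continuous).aestronglyMeasurable ‖φ‖
      (Eventually.of_forall fun x => ?_)
    rw [norm_mul, norm_planeWave, one_mul]
    exact φ.norm_coe_le_norm x
  · simp only [greenKernel_sub_mul, conj_planeWave_mul_unweight, ← mul_assoc (modKernel _ _ _)]
    refine ⟨(integrable_mul_bcf ((admissibleKernel_modKernel σ hl).integrable d.integrable_q
      d.memLp_q x) φ).const_mul _, ?_⟩
    rw [integral_const_mul]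
    have h1 := DFunLike.congr_fun h x
    rw [BoundedContinuousFunction.add_apply, weightedRhs_apply, op_apply] at h1
    rw [unweight, h1]
    have h2 := ofReal_weight_rpow_mul_neg r x
    have h3 := conj_planeWave_mul l x
    generalize (∫ y, modKernel σ l (x - y) * weightedPotential u r y * φ y) = J at *
    linear_combination (planeWave l x * ((starRingEnd ℂ) (planeWave l x) * g x + J)) * h2 +
      g x * h3

/-- Every Jost solution is, up to a null set, of the form `e^{il·} w^r φ` with `φ` bounded and
continuous. -/
theorem exists_bcf_of_solves (d : JostData u s s₁) (hl : 0 < l) (g : ℝ →ᵇ ℂ) {m : ℝ → ℂ}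
    (hm : SolvesJostEquation u (s - s₁) σ l g m) :
    ∃ φ : ℝ →ᵇ ℂ, φ = weightedRhs d.pos.le l g + d.op σ hl φ ∧
      m =ᵐ[volume] unweight (s - s₁) l φ := by
  set r := s - s₁ with hr
  set q := weightedPotential u r with hq
  obtain ⟨hmem, heq⟩ := hm
  set n : ℝ → ℂ := fun y => (starRingEnd ℂ) (planeWave l y) * ((weight y ^ (-r)) • m y) with hn
  have hnm : AEStronglyMeasurable n volume :=
    (Complex.continuous_conj.comp (continuous_planeWave l)).aestronglyMeasurable.mul hmem.1
  obtain ⟨C, hC⟩ : ∃ C, ∀ᵐ y, ‖n y‖ ≤ C := by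
    have hb : ∀ᵐ y, ‖(weight y ^ (-r)) • m y‖ₑ ≤
        eLpNorm (fun x : ℝ => (weight x ^ (-r)) • m x) ⊤ volume := by
      rw [eLpNorm_exponent_top]
      exact ae_le_eLpNormEssSup
    refine ⟨(eLpNorm (fun x : ℝ => (weight x ^ (-r)) • m x) ⊤ volume).toReal, hb.mono fun y hy => ?_⟩
    simp only [n]
    rw [norm_mul, RCLike.norm_conj, norm_planeWave, one_mul, ← toReal_enorm]
    exact ENNReal.toReal_mono hmem.2.ne hy
  have hqn : ∀ y, (starRingEnd ℂ) (planeWave l y) * ((u y : ℂ) * m y) = q y * n y := fun y => by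
    simp only [n, q, weightedPotential, Complex.real_smul]
    linear_combination -(starRingEnd ℂ) (planeWave l y) * u y * m y * ofReal_weight_rpow_mul_neg r y
  have hf : Integrable (fun y => q y * n y) volume := d.integrable_q.mul_bdd hnm hC
  have hf2 : MemLp (fun y => q y * n y) 2 volume := by
    refine (d.memLp_q.const_mul (C : ℂ)).of_le (d.memLp_q.1.mul hnm) ?_
    filter_upwards [hC] with y hy
    rw [norm_mul (q y), norm_mul (C : ℂ), Complex.norm_real, mul_comm]
    gcongr
    exact hy.trans (le_abs_self C)
  have hK := admissibleKernel_modKernel σ hl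
  obtain ⟨φ, hφ⟩ : ∃ φ : ℝ →ᵇ ℂ, ∀ x, φ x = ((weight x ^ (-r) : ℝ) : ℂ) *
      ((starRingEnd ℂ) (planeWave l x) * g x) +
      ((weight x ^ (-r) : ℝ) : ℂ) * ∫ y, modKernel σ l (x - y) * (q y * n y) := by
    -- Here `n` is only measurable and bounded. Treating `q n` as the potential and applying the
    -- operator to the constant `1` shows that the convolution is bounded and continuous.
    refine ⟨weightedRhs d.pos.le l g +
      weightedConvCLM d.pos.le hK hf hf2 (BoundedContinuousFunction.const ℝ 1), fun x => ?_⟩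
    simp only [BoundedContinuousFunction.add_apply, weightedRhs_apply, weightedConvCLM_apply,
      weightedConv, BoundedContinuousFunction.const_apply, mul_one]
    rfl
  have hnφ : ∀ᵐ y, n y = φ y := by
    filter_upwards [heq] with x hx
    have h1 := hx.2
    simp only [greenKernel_sub_mul, hqn] at h1
    rw [integral_const_mul] at h1
    simp only [n]
    rw [hφ, Complex.real_smul, h1]
    generalize (∫ y, modKernel σ l (x - y) * (q y * n y)) = J at *
    linear_combination ((weight x ^ (-r) : ℝ) : ℂ) * J * conj_planeWave_mul l x
  refine ⟨φ, ?_, ?_⟩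
  · refine DFunLike.ext _ _ fun x => ?_
    rw [BoundedContinuousFunction.add_apply, op_apply, weightedRhs_apply, hφ]
    congr 2
    refine integral_congr_ae ?_
    filter_upwards [hnφ] with y hy
    rw [hy, mul_assoc]
  · filter_upwards [hnφ] with x hx
    rw [unweight, ← hx]
    simp only [n, Complex.real_smul]
    have h2 := ofReal_weight_rpow_mul_neg r x
    have h3 := conj_planeWave_mul l x
    linear_combination (-(planeWave l x * (starRingEnd ℂ) (planeWave l x) * m x)) * h2 - m x * h3

/-- The bounded continuous function representing the Jost solution. -/
noncomputable def sol (d : JostData u s s₁) (σ : Side) (hl : 0 < l) (g : ℝ →ᵇ ℂ) : ℝ →ᵇ ℂ :=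
  Ring.inverse (1 - d.op σ hl) (weightedRhs d.pos.le l g)

theorem eq_add_op_iff (d : JostData u s s₁) (hl : 0 < l) (ψ φ : ℝ →ᵇ ℂ) :
    φ = ψ + d.op σ hl φ ↔ φ = Ring.inverse (1 - d.op σ hl) ψ := by
  have hu := d.isUnit_one_sub_op σ hl
  have e : φ = ψ + d.op σ hl φ ↔ (1 - d.op σ hl) φ = ψ := by
    rw [sub_apply, one_apply_eq_self, sub_eq_iff_eq_add]
  rw [e]
  constructor
  · rintro rfl
    rw [← mul_apply_eq_comp, Ring.inverse_mul_cancel _ hu,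
      one_apply_eq_self]
  · rintro rfl
    rw [← mul_apply_eq_comp, Ring.mul_inverse_cancel _ hu,
      one_apply_eq_self]

theorem solves_sol (d : JostData u s s₁) (σ : Side) (hl : 0 < l) (g : ℝ →ᵇ ℂ) :
    SolvesJostEquation u (s - s₁) σ l g (unweight (s - s₁) l (d.sol σ hl g)) :=
  d.solvesJostEquation_unweight hl g _ ((d.eq_add_op_iff hl _ _).2 rfl)

theorem ae_eq_sol (d : JostData u s s₁) (hl : 0 < l) (g : ℝ →ᵇ ℂ) {m : ℝ → ℂ}
    (hm : SolvesJostEquation u (s - s₁) σ l g m) :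
    m =ᵐ[volume] unweight (s - s₁) l (d.sol σ hl g) := by
  obtain ⟨φ, h1, h2⟩ := d.exists_bcf_of_solves hl g hm
  rwa [(d.eq_add_op_iff hl _ _).1 h1] at h2

theorem integrable_mul_of_solves (d : JostData u s s₁) (hl : 0 < l) (g : ℝ →ᵇ ℂ) {m : ℝ → ℂ}
    (hm : SolvesJostEquation u (s - s₁) σ l g m) : Integrable (fun y => (u y : ℂ) * m y) volume := by
  set φ := d.sol σ hl g
  have h1 : Integrable (fun y => planeWave l y * (weightedPotential u (s - s₁) y * φ y)) volume :=
    (integrable_mul_bcf d.integrable_q φ).bdd_mul (c := 1)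
      (continuous_planeWave l).aestronglyMeasurable
      (Eventually.of_forall fun y => (norm_planeWave l y).le)
  refine h1.congr ?_
  filter_upwards [d.ae_eq_sol hl g hm] with y hy
  rw [hy, unweight, weightedPotential_mul]
  ring

end JostData

end BOScattering

namespace BOScattering

open scoped BoundedContinuousFunction

variable {u : ℝ → ℝ} {s s₁ l r : ℝ} {σ : Side} {g g' m m' : ℝ → ℂ}

/-! ### Relations between the Jost solutions -/

/-- The plane wave as a bounded continuous function. -/
noncomputable def planeWaveBCF (l : ℝ) : ℝ →ᵇ ℂ :=
  BoundedContinuousFunction.ofNormedAddCommGroup (planeWave l) (continuous_planeWave l) 1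
    fun x => (norm_planeWave l x).le

theorem SolvesJostEquation.const_mul (h : SolvesJostEquation u r σ l g m) (c : ℂ) :
    SolvesJostEquation u r σ l (fun x => c * g x) (fun x => c * m x) := by
  refine ⟨?_, h.2.mono fun x hx => ?_⟩
  · have := MemLp.const_mul (show MemLp _ _ _ from h.1) c
    refine this.ae_eq (Eventually.of_forall fun x => ?_)
    simp only [Complex.real_smul]
    ring
  · have e : (fun y => greenKernel σ l (x - y) * ((u y : ℂ) * (c * m y))) =
        fun y => c * (greenKernel σ l (x - y) * ((u y : ℂ) * m y)) := by
      funext y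
      ring
    rw [e, integral_const_mul]
    exact ⟨hx.1.const_mul c, by linear_combination c * hx.2⟩

theorem SolvesJostEquation.sub (h : SolvesJostEquation u r σ l g m)
    (h' : SolvesJostEquation u r σ l g' m') :
    SolvesJostEquation u r σ l (fun x => g x - g' x) (fun x => m x - m' x) := by
  refine ⟨?_, ?_⟩
  · have := MemLp.sub (show MemLp _ _ _ from h.1) (show MemLp _ _ _ from h'.1)
    refine this.ae_eq (Eventually.of_forall fun x => ?_)
    simp only [Pi.sub_apply, smul_sub]
  · filter_upwards [h.2, h'.2] with x hx hx'
    have e : (fun y => greenKernel σ l (x - y) * ((u y : ℂ) * (m y - m' y))) =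
        fun y => greenKernel σ l (x - y) * ((u y : ℂ) * m y) -
          greenKernel σ l (x - y) * ((u y : ℂ) * m' y) := by
      funext y
      ring
    rw [e, integral_sub hx.1 hx'.1]
    refine ⟨hx.1.sub hx'.1, ?_⟩
    rw [hx.2, hx'.2]
    ring

theorem unweight_zero (r l x : ℝ) : unweight r l 0 x = 0 := by simp [unweight]

/-- Uniqueness of the solution of the Jost equation. -/
theorem JostData.ae_eq_of_solves (d : JostData u s s₁) (hl : 0 < l)
    (h : SolvesJostEquation u (s - s₁) σ l g m) (h' : SolvesJostEquation u (s - s₁) σ l g m') :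
    m =ᵐ[volume] m' := by
  have h0 := h.sub h'
  have e : (fun x => g x - g x) = ((0 : ℝ →ᵇ ℂ) : ℝ → ℂ) := by
    funext x
    simp
  rw [e] at h0
  have hz : weightedRhs d.pos.le l 0 = 0 := by
    ext x
    simp [weightedRhs_apply]
  filter_upwards [d.ae_eq_sol hl 0 h0] with x hx
  rw [JostData.sol, hz, map_zero, unweight_zero] at hx
  exact sub_eq_zero.1 hx

/-! ### Comparison of the two sides of the cut -/

/-- The jump of the kernel across the cut. -/
theorem greenKernel_upper_sub_lower (l : ℝ) {x : ℝ} (hx : x ≠ 0) :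
    greenKernel Side.upper l x - greenKernel Side.lower l x = Complex.I * planeWave l x := by
  simp only [greenKernel]
  rcases lt_or_gt_of_ne hx with h | h
  · simp only [indicator, mem_Ioi, mem_Iio, h, h.not_gt, if_true, if_false]
    ring
  · simp only [indicator, mem_Ioi, mem_Iio, h, h.not_gt, if_true, if_false]
    ring

theorem integral_planeWave_sub_mul (u : ℝ → ℝ) (l : ℝ) (m : ℝ → ℂ) (x : ℝ) :
    ∫ y, Complex.I * planeWave l (x - y) * ((u y : ℂ) * m y) =
      Complex.I * pairing u l m * planeWave l x := by
  rw [pairing, mul_right_comm, ← integral_const_mul]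
  refine integral_congr_ae (Eventually.of_forall fun y => ?_)
  simp only [planeWave_sub, conj_planeWave]
  ring

theorem integrable_planeWave_sub_mul (hum : Integrable (fun y => (u y : ℂ) * m y) volume) (x : ℝ) :
    Integrable (fun y => Complex.I * planeWave l (x - y) * ((u y : ℂ) * m y)) volume :=
  hum.bdd_mul (c := 1) (Continuous.aestronglyMeasurable
    (continuous_const.mul ((continuous_planeWave l).comp (by fun_prop))))
    (Eventually.of_forall fun y => by rw [norm_mul, norm_planeWave]; simp)

theorem ae_greenKernel_sub (u : ℝ → ℝ) (l : ℝ) (m : ℝ → ℂ) (x : ℝ) :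
    ∀ᵐ y, greenKernel Side.upper l (x - y) * ((u y : ℂ) * m y) =
      greenKernel Side.lower l (x - y) * ((u y : ℂ) * m y) +
        Complex.I * planeWave l (x - y) * ((u y : ℂ) * m y) := by
  filter_upwards [compl_mem_ae_iff.2 (measure_singleton x)] with y hy
  have hne : x - y ≠ 0 := fun h => hy (sub_eq_zero.1 h).symm
  rw [← greenKernel_upper_sub_lower l hne]
  ring

/-- Convolving `u m` with the jump `i e^{ilx}` yields a multiple of the plane wave, so changing
sides only alters the inhomogeneity; `upper_of_lower` is the reverse passage. -/
theorem SolvesJostEquation.lower_of_upper (h : SolvesJostEquation u r Side.upper l g m)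
    (hum : Integrable (fun y => (u y : ℂ) * m y) volume) :
    SolvesJostEquation u r Side.lower l
      (fun x => g x + Complex.I * pairing u l m * planeWave l x) m := by
  refine ⟨h.1, h.2.mono fun x hx => ?_⟩
  have hp := integrable_planeWave_sub_mul (l := l) hum x
  have hi : Integrable (fun y => greenKernel Side.lower l (x - y) * ((u y : ℂ) * m y)) volume := by
    refine (hx.1.sub hp).congr ?_
    filter_upwards [ae_greenKernel_sub u l m x] with y hy
    rw [Pi.sub_apply, hy, add_sub_cancel_right]
  refine ⟨hi, ?_⟩
  rw [hx.2, integral_congr_ae (ae_greenKernel_sub u l m x), integral_add hi hp,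
    integral_planeWave_sub_mul]
  ring

theorem SolvesJostEquation.upper_of_lower (h : SolvesJostEquation u r Side.lower l g m)
    (hum : Integrable (fun y => (u y : ℂ) * m y) volume) :
    SolvesJostEquation u r Side.upper l
      (fun x => g x - Complex.I * pairing u l m * planeWave l x) m := by
  refine ⟨h.1, h.2.mono fun x hx => ?_⟩
  have hp := integrable_planeWave_sub_mul (l := l) hum x
  refine ⟨(integrable_congr (ae_greenKernel_sub u l m x)).2 (hx.1.add hp), ?_⟩
  rw [hx.2, integral_congr_ae (ae_greenKernel_sub u l m x), integral_add hx.1 hp,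
    integral_planeWave_sub_mul]
  ring

namespace JostData

variable {mp mm : ℝ → ℂ}

theorem integrable_one (d : JostData u s s₁) (hl : 0 < l) (h : IsJostOne u (s - s₁) σ l m) :
    Integrable (fun y => (u y : ℂ) * m y) volume :=
  d.integrable_mul_of_solves hl (BoundedContinuousFunction.const ℝ 1) h

theorem integrable_exp (d : JostData u s s₁) (hl : 0 < l) (h : IsJostExp u (s - s₁) σ l m) :
    Integrable (fun y => (u y : ℂ) * m y) volume :=
  d.integrable_mul_of_solves hl (planeWaveBCF l) h

/-- `m_e(l + 0i) = Γ(l) m_e(l - 0i)`. -/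
theorem exp_upper_eq (d : JostData u s s₁) (hl : 0 < l)
    (hp : IsJostExp u (s - s₁) Side.upper l mp) (hm : IsJostExp u (s - s₁) Side.lower l mm) :
    ∀ᵐ x, mp x = Gam u l mp * mm x := by
  have h1 := SolvesJostEquation.lower_of_upper hp (d.integrable_exp hl hp)
  have h2 := SolvesJostEquation.const_mul hm (Gam u l mp)
  refine d.ae_eq_of_solves hl (g := fun x => Gam u l mp * planeWave l x) ?_ h2
  convert h1 using 2 with x
  rw [Gam]
  ring

theorem exp_lower_eq (d : JostData u s s₁) (hl : 0 < l)
    (hp : IsJostExp u (s - s₁) Side.upper l mp) (hm : IsJostExp u (s - s₁) Side.lower l mm) :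
    ∀ᵐ x, mm x = (1 - Complex.I * pairing u l mm) * mp x := by
  have h1 := SolvesJostEquation.upper_of_lower hm (d.integrable_exp hl hm)
  have h2 := SolvesJostEquation.const_mul hp (1 - Complex.I * pairing u l mm)
  refine d.ae_eq_of_solves hl
    (g := fun x => (1 - Complex.I * pairing u l mm) * planeWave l x) ?_ h2
  convert h1 using 2 with x
  ring

theorem exp_not_ae_zero (hm : IsJostExp u r σ l m) : ¬ ∀ᵐ x, m x = 0 := by
  intro h0
  have h1 : ∀ᵐ x : ℝ, False := by
    filter_upwards [hm.2, h0] with x hx hx0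
    have e : ∫ y, greenKernel σ l (x - y) * ((u y : ℂ) * m y) = 0 :=
      integral_eq_zero_of_ae (h0.mono fun y hy => by simp [hy])
    have h2 := hx.2
    rw [hx0, e, add_zero] at h2
    have := norm_planeWave l x
    rw [← h2, norm_zero] at this
    exact zero_ne_one this
  rw [eventually_false_iff_eq_bot, ae_eq_bot] at h1
  exact NeZero.ne (volume : Measure ℝ) h1

/-- Composing the two proportionalities gives `m_e(l - 0i)` as this product times itself, and `m_e(l
- 0i)` is not almost everywhere zero. -/
theorem mul_Gam_eq_one (d : JostData u s s₁) (hl : 0 < l)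
    (hp : IsJostExp u (s - s₁) Side.upper l mp) (hm : IsJostExp u (s - s₁) Side.lower l mm) :
    (1 - Complex.I * pairing u l mm) * Gam u l mp = 1 := by
  by_contra hne
  refine exp_not_ae_zero hm ?_
  filter_upwards [d.exp_upper_eq hl hp hm, d.exp_lower_eq hl hp hm] with x h1 h2
  rw [h1, ← mul_assoc] at h2
  have h3 : (1 - (1 - Complex.I * pairing u l mm) * Gam u l mp) * mm x = 0 := by
    rw [sub_mul, one_mul, ← h2, sub_self]
  exact (mul_eq_zero.1 h3).resolve_left fun h => hne (sub_eq_zero.1 h).symm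

/-- `m_1(l + 0i) - m_1(l - 0i) = β(l) m_e(l - 0i)`. -/
theorem one_upper_sub_lower (d : JostData u s s₁) (hl : 0 < l)
    (hp : IsJostOne u (s - s₁) Side.upper l mp) (hm : IsJostOne u (s - s₁) Side.lower l mm)
    (he : IsJostExp u (s - s₁) Side.lower l m) :
    ∀ᵐ x, mp x - mm x = bet u l mp * m x := by
  have h1 := (SolvesJostEquation.lower_of_upper hp (d.integrable_one hl hp)).sub hm
  have h2 := SolvesJostEquation.const_mul he (bet u l mp)
  refine d.ae_eq_of_solves hl (g := fun x => bet u l mp * planeWave l x) ?_ h2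
  convert h1 using 2 with x
  rw [bet]
  ring

end JostData

/-! ### Dependence on the spectral parameter -/

/-- The derivative in `l` of the conjugated kernel. -/
noncomputable def derivKernel (l x : ℝ) : ℂ :=
  -(Complex.exp (-(Complex.I * l * x)) / (2 * Real.pi * l))

theorem admissibleKernel_derivKernel (l : ℝ) : AdmissibleKernel (derivKernel l) := by
  have hc : Continuous (derivKernel l) := by
    unfold derivKernel
    fun_prop
  refine ⟨derivKernel l, 0, fun x => by simp, hc.aestronglyMeasurable,
    ⟨‖(2 * Real.pi * l : ℂ)‖⁻¹, fun x => ?_⟩, fun x _ => hc.continuousAt, MemLp.zero⟩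
  rw [derivKernel, norm_neg, norm_div, norm_exp_neg_I_mul, one_div]

/-- The crude bound is uniform in `x`; the Lipschitz bound is small in `h` but grows with `x`.
Keeping the minimum permits interpolation with an arbitrarily small power of the weight. -/
theorem norm_exp_div_sub_le {l h η x : ℝ} (hl : 0 < l) (hh : |h| ≤ l / 2) (hη : |η - l| ≤ |h|) :
    ‖Complex.exp (-(Complex.I * x * η)) / η - Complex.exp (-(Complex.I * x * l)) / l‖ ≤
      (2 / l ^ 2 + 3 / l) * min 1 (|h| * weight x) := by
  have hηl : l / 2 ≤ η := by linarith [neg_abs_le (η - l)]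
  have hη0 : 0 < η := by linarith
  have hηc : (η : ℂ) ≠ 0 := by exact_mod_cast hη0.ne'
  have hlc : (l : ℂ) ≠ 0 := by exact_mod_cast hl.ne'
  have n1 : ‖Complex.exp (-(Complex.I * x * η)) / η‖ ≤ 2 / l := by
    rw [norm_div, norm_exp_neg_I_mul, Complex.norm_real, Real.norm_of_nonneg hη0.le,
      div_le_div_iff₀ hη0 hl]
    linarith
  have n2 : ‖Complex.exp (-(Complex.I * x * l)) / l‖ = 1 / l := by
    rw [norm_div, norm_exp_neg_I_mul, Complex.norm_real, Real.norm_of_nonneg hl.le]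
  have hA : ‖Complex.exp (-(Complex.I * x * η)) / η - Complex.exp (-(Complex.I * x * l)) / l‖ ≤
      2 / l ^ 2 + 3 / l := by
    refine (norm_sub_le _ _).trans ?_
    rw [n2]
    have : 0 ≤ 2 / l ^ 2 := by positivity
    have e : 2 / l + 1 / l = 3 / l := by ring
    linarith
  have hB : ‖Complex.exp (-(Complex.I * x * η)) / η - Complex.exp (-(Complex.I * x * l)) / l‖ ≤
      (2 / l ^ 2 + 3 / l) * (|h| * weight x) := by
    have e : Complex.exp (-(Complex.I * x * η)) / η - Complex.exp (-(Complex.I * x * l)) / l =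
        Complex.exp (-(Complex.I * x * η)) * ((l - η) / (η * l)) +
          Complex.exp (-(Complex.I * x * l)) *
            (Complex.exp (-(Complex.I * (x * (η - l) : ℝ))) - 1) / l := by
      rw [mul_sub, ← Complex.exp_add, mul_one]
      have : -(Complex.I * x * l) + -(Complex.I * (x * (η - l) : ℝ)) = -(Complex.I * x * η) := by
        push_cast
        ring
      rw [this]
      field_simp
      ring
    rw [e]
    refine (norm_add_le _ _).trans ?_
    have b1 : ‖Complex.exp (-(Complex.I * x * η)) * ((l - η) / (η * l) : ℂ)‖ ≤
        2 / l ^ 2 * |h| := by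
      rw [norm_mul, norm_exp_neg_I_mul, one_mul, norm_div, norm_mul, Complex.norm_real,
        Complex.norm_real, Real.norm_of_nonneg hη0.le, Real.norm_of_nonneg hl.le,
        ← Complex.ofReal_sub, Complex.norm_real, Real.norm_eq_abs, abs_sub_comm,
        div_le_iff₀ (by positivity)]
      have : 2 / l ^ 2 * |h| * (η * l) = |h| * (2 * η / l) := by field_simp
      rw [this]
      have h2 : 1 ≤ 2 * η / l := by rw [le_div_iff₀ hl]; linarith
      nlinarith [abs_nonneg h]
    have b2 : ‖Complex.exp (-(Complex.I * x * l)) *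
        (Complex.exp (-(Complex.I * (x * (η - l) : ℝ))) - 1) / l‖ ≤ 1 / l * (|x| * |h|) := by
      rw [norm_div, norm_mul, norm_exp_neg_I_mul, one_mul, Complex.norm_real,
        Real.norm_of_nonneg hl.le, div_eq_mul_inv, mul_comm, one_div]
      gcongr
      refine (norm_exp_sub_one_le _).trans ?_
      rw [abs_mul]
      gcongr
    refine (add_le_add b1 b2).trans ?_
    have h1 : 0 ≤ 1 / l := by positivity
    have h2 : 0 ≤ 2 / l ^ 2 := by positivity
    have h3 : 3 / l = 3 * (1 / l) := by ring
    have h4 : 0 ≤ |h| := abs_nonneg h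
    have h5 : 0 ≤ |x| := abs_nonneg x
    unfold weight
    rw [h3]
    have : (2 / l ^ 2 + 3 * (1 / l)) * (|h| * (1 + |x|)) = 2 / l ^ 2 * |h| + 1 / l * (|x| * |h|) +
        (2 / l ^ 2 * (|h| * |x|) + 3 * (1 / l) * |h| + 2 * (1 / l) * (|h| * |x|)) := by ring
    rw [this]
    have : 0 ≤ 2 / l ^ 2 * (|h| * |x|) + 3 * (1 / l) * |h| + 2 * (1 / l) * (|h| * |x|) := by
      positivity
    linarith
  rcases le_total 1 (|h| * weight x) with h1 | h1
  · rwa [min_eq_left h1, mul_one]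
  · rwa [min_eq_right h1]

theorem min_one_le_rpow {t θ : ℝ} (ht : 0 ≤ t) (hθ0 : 0 ≤ θ) (hθ1 : θ ≤ 1) : min 1 t ≤ t ^ θ := by
  rcases le_total 1 t with h | h
  · rw [min_eq_left h]
    exact Real.one_le_rpow h hθ0
  · rw [min_eq_right h]
    rcases ht.eq_or_lt with rfl | h0
    · positivity
    · conv_lhs => rw [← Real.rpow_one t]
      exact Real.rpow_le_rpow_of_exponent_ge h0 h hθ1

/-- The jump part does not depend on `l`, so the remainder is the integral over `[l, l + h]` of the
variation of `e^{-ixη}/η`. Interpolation buys `|h|^θ` beyond first order at the price `w^θ`. -/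
theorem norm_modKernel_remainder_le {h x θ : ℝ} (hl : 0 < l) (hh : |h| ≤ l / 2) (hx : x ≠ 0)
    (hθ0 : 0 ≤ θ) (hθ1 : θ ≤ 1) :
    ‖modKernel σ (l + h) x - modKernel σ l x - h * derivKernel l x‖ ≤
      (2 / l ^ 2 + 3 / l) * (|h| ^ θ * weight x ^ θ) * |h| := by
  have hlh : 0 < l + h := by linarith [neg_abs_le h]
  have hpos : ∀ η ∈ uIcc l (l + h), |η - l| ≤ |h| := fun η hη => by
    have := abs_sub_left_of_mem_uIcc hη
    rwa [add_sub_cancel_left] at this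
  have e : modKernel σ (l + h) x - modKernel σ l x - h * derivKernel l x =
      -(1 / (2 * Real.pi : ℂ)) * ∫ η in l..(l + h),
        (Complex.exp (-(Complex.I * x * η)) / η - Complex.exp (-(Complex.I * x * l)) / l) := by
    rw [intervalIntegral.integral_sub (intervalIntegrable_osc hl hlh x) intervalIntegrable_const,
      intervalIntegral.integral_const, add_sub_cancel_left, modKernel_eq σ hlh hx,
      modKernel_eq σ hl hx, ← oscTrunc_add_oscLim hl hlh hx, Complex.real_smul, derivKernel,
      oscTrunc, mul_right_comm Complex.I (l : ℂ) (x : ℂ)]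
    have hlc : (l : ℂ) ≠ 0 := by exact_mod_cast hl.ne'
    have hpi : (Real.pi : ℂ) ≠ 0 := by exact_mod_cast Real.pi_ne_zero
    field_simp
    ring
  have hC : 0 ≤ 2 / l ^ 2 + 3 / l := by positivity
  rw [e, norm_mul]
  have hb := intervalIntegral.norm_integral_le_of_norm_le_const (a := l) (b := l + h)
    (f := fun η : ℝ => Complex.exp (-(Complex.I * x * η)) / η -
      Complex.exp (-(Complex.I * x * l)) / l)
    (fun η hη => norm_exp_div_sub_le (x := x) hl hh (hpos η (uIoc_subset_uIcc hη)))
  rw [add_sub_cancel_left] at hb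
  have hpi : ‖-(1 / (2 * Real.pi : ℂ))‖ ≤ 1 := by
    rw [norm_neg, norm_div, norm_one, norm_mul, Complex.norm_real,
      Real.norm_of_nonneg Real.pi_pos.le, Complex.norm_ofNat, div_le_one (by positivity)]
    linarith [Real.two_le_pi]
  refine (mul_le_of_le_one_left (norm_nonneg _) hpi).trans (hb.trans ?_)
  rw [← Real.mul_rpow (abs_nonneg h) (weight_pos x).le]
  gcongr
  exact min_one_le_rpow (mul_nonneg (abs_nonneg h) (weight_pos x).le) hθ0 hθ1

theorem weight_sub_le (x y : ℝ) : weight (x - y) ≤ weight x * weight y := by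
  unfold weight
  have := abs_sub x y
  nlinarith [abs_nonneg x, abs_nonneg y]

/-! ### Norm differentiability of the operators and of the exponential Jost solution -/

namespace JostData

/-- The operator family, extended by zero to all real parameters. -/
noncomputable def opFamily (d : JostData u s s₁) (σ : Side) (l : ℝ) : (ℝ →ᵇ ℂ) →L[ℂ] (ℝ →ᵇ ℂ) :=
  if hl : 0 < l then d.op σ hl else 0

theorem opFamily_of_pos (d : JostData u s s₁) (σ : Side) (hl : 0 < l) :
    d.opFamily σ l = d.op σ hl := dif_pos hl

/-- The derivative of the operator family. -/
noncomputable def opDeriv (d : JostData u s s₁) (l : ℝ) : (ℝ →ᵇ ℂ) →L[ℂ] (ℝ →ᵇ ℂ) :=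
  weightedConvCLM d.pos.le (admissibleKernel_derivKernel l) d.integrable_q d.memLp_q

theorem exists_norm_remainder_le (d : JostData u s s₁) (σ : Side) (hl : 0 < l) :
    ∃ θ C : ℝ, 0 < θ ∧ ∀ h : ℝ, |h| ≤ l / 2 →
      ‖d.opFamily σ (l + h) - d.opFamily σ l - (h : ℂ) • d.opDeriv l‖ ≤ C * |h| ^ θ * |h| := by
  set r := s - s₁ with hr
  have hr0 : 0 < r := d.pos
  have hs := d.half_lt
  -- By `w(x-y) ≤ w(x) w(y)` the cost splits: `θ ≤ r` lets `w(x)^{-r}` absorb `w(x)^θ`, and `θ < s₁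
  -- - 1/2` keeps `w^{θ+r} u` integrable. The halving provides the strict inequality; `θ ≤ 1` is
  -- needed for interpolation.
  set θ := min 1 (min r ((s₁ - 1 / 2) / 2))
  have hθ0 : 0 < θ := lt_min one_pos (lt_min hr0 (by linarith))
  have hθ1 : θ ≤ 1 := min_le_left _ _
  have hθr : θ ≤ r := (min_le_right _ _).trans (min_le_left _ _)
  have hθs : θ ≤ (s₁ - 1 / 2) / 2 := (min_le_right _ _).trans (min_le_right _ _)
  set q := weightedPotential u r
  have hwq : Integrable (fun y => weight y ^ θ * ‖q y‖) volume := by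
    have h1 := (d.mem.integrable (t := θ + r) (by linarith)).norm
    refine h1.congr (Eventually.of_forall fun y => ?_)
    simp only [q, weightedPotential, norm_mul, Complex.norm_real,
      Real.norm_of_nonneg (weight_rpow_pos _ _).le]
    rw [Real.rpow_add (weight_pos y)]
    ring
  set A := ∫ y, weight y ^ θ * ‖q y‖
  have hA : 0 ≤ A := integral_nonneg fun y => mul_nonneg (weight_rpow_pos _ _).le (norm_nonneg _)
  set c := 2 / l ^ 2 + 3 / l
  have hc : 0 ≤ c := by positivity
  refine ⟨θ, c * A, hθ0, fun h hh => ?_⟩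
  have hlh : 0 < l + h := by linarith [neg_abs_le h]
  rw [d.opFamily_of_pos σ hlh, d.opFamily_of_pos σ hl]
  refine ContinuousLinearMap.opNorm_le_bound _ (by positivity) fun φ => ?_
  refine (BoundedContinuousFunction.norm_le (by positivity)).2 fun x => ?_
  have i1 := integrable_mul_bcf ((admissibleKernel_modKernel σ hlh).integrable d.integrable_q
    d.memLp_q x) φ
  have i2 := integrable_mul_bcf ((admissibleKernel_modKernel σ hl).integrable d.integrable_q
    d.memLp_q x) φ
  have i3 := integrable_mul_bcf ((admissibleKernel_derivKernel l).integrable d.integrable_q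
    d.memLp_q x) φ
  have e : (d.op σ hlh - d.op σ hl - (h : ℂ) • d.opDeriv l) φ x =
      ((weight x ^ (-r) : ℝ) : ℂ) * ∫ y, (modKernel σ (l + h) (x - y) - modKernel σ l (x - y) -
        h * derivKernel l (x - y)) * q y * φ y := by
    have e1 : ∫ y, (modKernel σ (l + h) (x - y) - modKernel σ l (x - y) -
        h * derivKernel l (x - y)) * q y * φ y =
        (∫ y, modKernel σ (l + h) (x - y) * q y * φ y) - (∫ y, modKernel σ l (x - y) * q y * φ y) -
          h * ∫ y, derivKernel l (x - y) * q y * φ y := by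
      have i12 : Integrable (fun y => modKernel σ (l + h) (x - y) * q y * φ y -
        modKernel σ l (x - y) * q y * φ y) volume := i1.sub i2
      have j := integral_sub i12 (i3.const_mul (h : ℂ))
      rw [integral_const_mul, integral_sub i1 i2] at j
      rw [← j]
      refine integral_congr_ae (Eventually.of_forall fun y => ?_)
      simp only [q]
      ring
    rw [e1]
    change d.op σ hlh φ x - d.op σ hl φ x - h * d.opDeriv l φ x = _
    rw [op_apply, op_apply, opDeriv, weightedConvCLM_apply, weightedConv]
    ring
  rw [e, norm_mul, Complex.norm_real, Real.norm_of_nonneg (weight_rpow_pos _ _).le]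
  have hw : weight x ^ (-r) * weight x ^ θ ≤ 1 := by
    rw [← Real.rpow_add (weight_pos x)]
    exact Real.rpow_le_one_of_one_le_of_nonpos (one_le_weight x) (by linarith)
  have hI : ‖∫ y, (modKernel σ (l + h) (x - y) - modKernel σ l (x - y) -
      h * derivKernel l (x - y)) * q y * φ y‖ ≤
      ∫ y, (c * |h| ^ θ * |h| * ‖φ‖ * weight x ^ θ) * (weight y ^ θ * ‖q y‖) := by
    refine norm_integral_le_of_norm_le (hwq.const_mul _) ?_
    filter_upwards [compl_mem_ae_iff.2 (measure_singleton x)] with y hy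
    have hne : x - y ≠ 0 := fun h => hy (sub_eq_zero.1 h).symm
    have b := norm_modKernel_remainder_le (σ := σ) hl hh hne hθ0.le hθ1
    have hw2 : weight (x - y) ^ θ ≤ weight x ^ θ * weight y ^ θ := by
      rw [← Real.mul_rpow (weight_pos x).le (weight_pos y).le]
      exact Real.rpow_le_rpow (weight_pos _).le (weight_sub_le x y) hθ0.le
    rw [norm_mul, norm_mul]
    calc _ ≤ (c * (|h| ^ θ * weight (x - y) ^ θ) * |h|) * ‖q y‖ * ‖φ‖ := by
          gcongr
          · have := (weight_rpow_pos θ (x - y)).le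
            positivity
          · exact φ.norm_coe_le_norm y
      _ ≤ (c * (|h| ^ θ * (weight x ^ θ * weight y ^ θ)) * |h|) * ‖q y‖ * ‖φ‖ := by gcongr
      _ = _ := by ring
  rw [integral_const_mul] at hI
  calc _ ≤ weight x ^ (-r) * (c * |h| ^ θ * |h| * ‖φ‖ * weight x ^ θ * A) :=
        mul_le_mul_of_nonneg_left hI (weight_rpow_pos _ _).le
    _ = (weight x ^ (-r) * weight x ^ θ) * (c * A * |h| ^ θ * |h| * ‖φ‖) := by ring
    _ ≤ _ := mul_le_of_le_one_left (by positivity) hw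

theorem tendsto_opFamily_slope (d : JostData u s s₁) (σ : Side) (hl : 0 < l) :
    Tendsto (fun h : ℝ => (h : ℂ)⁻¹ • (d.opFamily σ (l + h) - d.opFamily σ l)) (𝓝[≠] 0)
      (𝓝 (d.opDeriv l)) := by
  obtain ⟨θ, C, hθ, hC⟩ := d.exists_norm_remainder_le σ hl
  rw [tendsto_iff_norm_sub_tendsto_zero]
  have t : Tendsto (fun h : ℝ => C * |h| ^ θ) (𝓝[≠] 0) (𝓝 0) := by
    have h1 : Continuous fun h : ℝ => C * |h| ^ θ :=
      continuous_const.mul (continuous_abs.rpow_const fun _ => Or.inr hθ.le)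
    have h2 := h1.tendsto 0
    simp only [abs_zero, Real.zero_rpow hθ.ne', mul_zero] at h2
    exact h2.mono_left nhdsWithin_le_nhds
  have ev : ∀ᶠ h : ℝ in 𝓝[≠] 0, |h| ≤ l / 2 := by
    have : Tendsto (fun h : ℝ => |h|) (𝓝 0) (𝓝 0) := by simpa using continuous_abs.tendsto (0 : ℝ)
    exact nhdsWithin_le_nhds ((this.eventually (gt_mem_nhds (by positivity : (0 : ℝ) < l / 2))).mono
      fun h hh => hh.le)
  refine squeeze_zero' (Eventually.of_forall fun h => norm_nonneg _) ?_ t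
  filter_upwards [ev, self_mem_nhdsWithin] with h h1 h0
  have h0' : (h : ℂ) ≠ 0 := Complex.ofReal_ne_zero.2 h0
  have e : (h : ℂ)⁻¹ • (d.opFamily σ (l + h) - d.opFamily σ l) - d.opDeriv l =
      (h : ℂ)⁻¹ • (d.opFamily σ (l + h) - d.opFamily σ l - (h : ℂ) • d.opDeriv l) := by
    rw [smul_sub _ (d.opFamily σ (l + h) - d.opFamily σ l), inv_smul_smul₀ h0']
  rw [e, norm_smul, norm_inv, Complex.norm_real, Real.norm_eq_abs,
    inv_mul_le_iff₀ (abs_pos.2 h0), mul_comm]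
  exact hC h h1

theorem tendsto_opFamily (d : JostData u s s₁) (σ : Side) (hl : 0 < l) :
    Tendsto (fun h : ℝ => d.opFamily σ (l + h)) (𝓝[≠] 0) (𝓝 (d.opFamily σ l)) := by
  have hc : Tendsto (fun h : ℝ => (h : ℂ)) (𝓝[≠] 0) (𝓝 0) := by
    simpa using (Complex.continuous_ofReal.tendsto 0).mono_left
      (nhdsWithin_le_nhds (s := ({0}ᶜ : Set ℝ)))
  have h1 := (hc.smul (d.tendsto_opFamily_slope σ hl)).add_const (d.opFamily σ l)
  have e : (0 : ℂ) • d.opDeriv l + d.opFamily σ l = d.opFamily σ l := by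
    ext φ x
    change (0 : ℂ) * d.opDeriv l φ x + d.opFamily σ l φ x = _
    rw [zero_mul, zero_add]
  rw [e] at h1
  refine h1.congr' ?_
  filter_upwards [self_mem_nhdsWithin] with h h0
  rw [smul_inv_smul₀ (Complex.ofReal_ne_zero.2 h0), sub_add_cancel]

/-- The function `w^{-r}`. -/
noncomputable def weightNeg (d : JostData u s s₁) : ℝ →ᵇ ℂ :=
  weightedRhs d.pos.le 0 (BoundedContinuousFunction.const ℝ 1)

theorem weightNeg_apply (d : JostData u s s₁) (x : ℝ) :
    d.weightNeg x = ((weight x ^ (-(s - s₁)) : ℝ) : ℂ) := by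
  simp [weightNeg, weightedRhs_apply, planeWave]

/-- The conjugation cancels the plane wave, so this right hand side is independent of `l` and only
the resolvent has to be differentiated. -/
theorem weightedRhs_planeWaveBCF (d : JostData u s s₁) (l : ℝ) :
    weightedRhs d.pos.le l (planeWaveBCF l) = d.weightNeg := by
  ext x
  rw [weightedRhs_apply, weightNeg_apply]
  change _ * ((starRingEnd ℂ) (planeWave l x) * planeWave l x) = _
  rw [conj_planeWave_mul, mul_one]

/-- The weighted and conjugated exponential Jost solution. -/
noncomputable def expFamily (d : JostData u s s₁) (σ : Side) (l : ℝ) : ℝ →ᵇ ℂ :=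
  Ring.inverse (1 - d.opFamily σ l) d.weightNeg

theorem expFamily_of_pos (d : JostData u s s₁) (σ : Side) (hl : 0 < l) :
    d.expFamily σ l = d.sol σ hl (planeWaveBCF l) := by
  rw [expFamily, sol, d.opFamily_of_pos σ hl, weightedRhs_planeWaveBCF]

theorem isUnit_one_sub_opFamily (d : JostData u s s₁) (σ : Side) (hl : 0 < l) :
    IsUnit (1 - d.opFamily σ l) := by
  rw [d.opFamily_of_pos σ hl]
  exact d.isUnit_one_sub_op σ hl

/-- The second resolvent identity, applied to the fixed vector `w^{-r}`. -/
theorem expFamily_sub (d : JostData u s s₁) (σ : Side) {μ : ℝ} (hl : 0 < l) (hμ : 0 < μ) :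
    d.expFamily σ μ - d.expFamily σ l = Ring.inverse (1 - d.opFamily σ μ)
      ((d.opFamily σ μ - d.opFamily σ l) (d.expFamily σ l)) := by
  set A := d.opFamily σ μ
  set B := d.opFamily σ l
  have h1 := Ring.inverse_mul_cancel _ (d.isUnit_one_sub_opFamily σ hμ)
  have h2 := Ring.mul_inverse_cancel _ (d.isUnit_one_sub_opFamily σ hl)
  have e : Ring.inverse (1 - A) - Ring.inverse (1 - B) =
      Ring.inverse (1 - A) * ((A - B) * Ring.inverse (1 - B)) := by
    calc Ring.inverse (1 - A) - Ring.inverse (1 - B)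
        = Ring.inverse (1 - A) * ((1 - B) * Ring.inverse (1 - B)) -
            (Ring.inverse (1 - A) * (1 - A)) * Ring.inverse (1 - B) := by
          rw [h1, h2, mul_one, one_mul]
      _ = _ := by rw [← mul_assoc, ← mul_assoc, ← sub_mul, ← mul_sub, sub_sub_sub_cancel_left]
  have := DFunLike.congr_fun e d.weightNeg
  simpa only [expFamily, sub_apply, mul_apply_eq_comp] using this

theorem tendsto_expFamily_slope (d : JostData u s s₁) (σ : Side) (hl : 0 < l) :
    Tendsto (fun h : ℝ => (h : ℂ)⁻¹ • (d.expFamily σ (l + h) - d.expFamily σ l)) (𝓝[≠] 0)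
      (𝓝 (Ring.inverse (1 - d.opFamily σ l) (d.opDeriv l (d.expFamily σ l)))) := by
  have t1 : Tendsto (fun h : ℝ => Ring.inverse (1 - d.opFamily σ (l + h))) (𝓝[≠] 0)
      (𝓝 (Ring.inverse (1 - d.opFamily σ l))) := by
    obtain ⟨U, hU⟩ := d.isUnit_one_sub_opFamily σ hl
    have hc := NormedRing.inverse_continuousAt (R := (ℝ →ᵇ ℂ) →L[ℂ] (ℝ →ᵇ ℂ)) U
    rw [hU] at hc
    exact hc.tendsto.comp ((d.tendsto_opFamily σ hl).const_sub 1)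
  have t2 : Tendsto (fun h : ℝ => ((h : ℂ)⁻¹ • (d.opFamily σ (l + h) - d.opFamily σ l))
      (d.expFamily σ l)) (𝓝[≠] 0) (𝓝 (d.opDeriv l (d.expFamily σ l))) :=
    (isBoundedBilinearMap_apply.continuous.tendsto (_, _)).comp
      ((d.tendsto_opFamily_slope σ hl).prodMk_nhds tendsto_const_nhds)
  refine ((isBoundedBilinearMap_apply.continuous.tendsto (_, _)).comp (t1.prodMk_nhds t2)).congr' ?_
  have ev : ∀ᶠ h : ℝ in 𝓝[≠] 0, -l < h := nhdsWithin_le_nhds (lt_mem_nhds (by linarith))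
  filter_upwards [ev] with h hh
  rw [d.expFamily_sub σ hl (by linarith : 0 < l + h), ← map_smul]
  rfl

/-- The derivative of the operator family maps the exponential Jost solution to a multiple of
`w^{-r} e^{-il·}`. -/
theorem opDeriv_expFamily (d : JostData u s s₁) (hl : 0 < l) {m : ℝ → ℂ}
    (h : IsJostExp u (s - s₁) σ l m) :
    d.opDeriv l (d.expFamily σ l) =
      fCoeff u l m • weightedRhs d.pos.le l (BoundedContinuousFunction.const ℝ 1) := by
  have hm : m =ᵐ[volume] unweight (s - s₁) l (d.expFamily σ l) := by
    rw [d.expFamily_of_pos σ hl]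
    exact d.ae_eq_sol hl (planeWaveBCF l) h
  ext x
  rw [BoundedContinuousFunction.smul_apply, weightedRhs_apply, opDeriv, weightedConvCLM_apply,
    weightedConv, BoundedContinuousFunction.const_apply, mul_one, smul_eq_mul]
  have e : ∫ y, derivKernel l (x - y) * weightedPotential u (s - s₁) y * d.expFamily σ l y =
      fCoeff u l m * (starRingEnd ℂ) (planeWave l x) := by
    rw [fCoeff, mul_right_comm, ← integral_const_mul]
    refine integral_congr_ae ?_
    filter_upwards [hm] with y hy
    have h2 := congrArg (starRingEnd ℂ) (planeWave_sub l x y)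
    simp only [map_mul, Complex.conj_conj] at h2
    rw [hy, mul_assoc, ← conj_planeWave_mul_unweight, derivKernel, ← conj_planeWave, h2]
    have h3 := conj_planeWave_mul l y
    linear_combination (-(1 / (2 * Real.pi * l : ℂ)) * (starRingEnd ℂ) (planeWave l x) *
      (u y * unweight (s - s₁) l (d.expFamily σ l) y)) * h3
  rw [e]
  ring

/-- The vector `w^{-r} e^{-il·}` produced by `opDeriv` is the right hand side of the conjugated
`m_1` equation, so the resolvent returns the representative of `m_1`. -/
theorem expFamily_deriv_eq (d : JostData u s s₁) (hl : 0 < l) {m : ℝ → ℂ}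
    (h : IsJostExp u (s - s₁) σ l m) :
    Ring.inverse (1 - d.opFamily σ l) (d.opDeriv l (d.expFamily σ l)) =
      fCoeff u l m • d.sol σ hl (BoundedContinuousFunction.const ℝ 1) := by
  rw [d.opDeriv_expFamily hl h, map_smul, d.opFamily_of_pos σ hl, sol]

/-- Differentiability of `ē m_e(l ± 0i)` in the weighted space, and the formula
`e ∂_l (ē m_e(l ± 0i)) = f(l) m_1(l ± 0i)`. -/
theorem exists_hasWeightedDerivAt (d : JostData u s s₁) (σ : Side) (hl : 0 < l)
    {m₁ : ℝ → ℂ} {me : ℝ → ℝ → ℂ} (h1 : IsJostOne u (s - s₁) σ l m₁)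
    (he : ∀ μ : ℝ, 0 < μ → IsJostExp u (s - s₁) σ μ (me μ)) :
    ∃ D : ℝ → ℂ,
      HasWeightedDerivAt (s - s₁) (fun μ x => (starRingEnd ℂ) (planeWave μ x) * me μ x) D l ∧
      ∀ᵐ x, planeWave l x * D x = fCoeff u l (me l) * m₁ x := by
  set r := s - s₁ with hr
  set ν' := Ring.inverse (1 - d.opFamily σ l) (d.opDeriv l (d.expFamily σ l)) with hν'
  have hF : ∀ μ : ℝ, 0 < μ → ∀ᵐ x, (starRingEnd ℂ) (planeWave μ x) * me μ x =
      ((weight x ^ r : ℝ) : ℂ) * d.expFamily σ μ x := fun μ hμ => by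
    filter_upwards [d.ae_eq_sol hμ (planeWaveBCF μ) (he μ hμ)] with x hx
    rw [hx, conj_mul_unweight, d.expFamily_of_pos σ hμ]
  refine ⟨fun x => ((weight x ^ r : ℝ) : ℂ) * ν' x, ⟨?_, ?_⟩, ?_⟩
  · have e : (fun x : ℝ => (weight x ^ (-r)) • (((weight x ^ r : ℝ) : ℂ) * ν' x)) = ν' := by
      funext x
      rw [Complex.real_smul]
      linear_combination ν' x * ofReal_weight_rpow_mul_neg r x
    unfold MemWeightedLp
    rw [e]
    exact memLp_top_of_bound ν'.continuous.aestronglyMeasurable ‖ν'‖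
      (Eventually.of_forall ν'.norm_coe_le_norm)
  · have t := (tendsto_iff_norm_sub_tendsto_zero.1 (d.tendsto_expFamily_slope σ hl))
    have t' := ENNReal.tendsto_ofReal t
    rw [ENNReal.ofReal_zero] at t'
    refine tendsto_of_tendsto_of_tendsto_of_le_of_le' tendsto_const_nhds t'
      (Eventually.of_forall fun h => zero_le) ?_
    have ev : ∀ᶠ h : ℝ in 𝓝[≠] 0, -l < h := nhdsWithin_le_nhds (lt_mem_nhds (by linarith))
    filter_upwards [ev] with h hh
    rw [eLpNorm_exponent_top]
    refine eLpNormEssSup_le_of_ae_bound ?_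
    filter_upwards [hF l hl, hF (l + h) (by linarith)] with x hx hx'
    simp only [hx, hx']
    refine le_trans (le_of_eq (congrArg norm ?_)) (BoundedContinuousFunction.norm_coe_le_norm
      ((h : ℂ)⁻¹ • (d.expFamily σ (l + h) - d.expFamily σ l) - ν') x)
    simp only [BoundedContinuousFunction.sub_apply, BoundedContinuousFunction.smul_apply,
      Complex.real_smul, smul_eq_mul, Complex.ofReal_inv]
    linear_combination ((h : ℂ)⁻¹ * (d.expFamily σ (l + h) x - d.expFamily σ l x) - ν' x) *
      ofReal_weight_rpow_mul_neg r x
  · have h2 := d.ae_eq_sol hl (BoundedContinuousFunction.const ℝ 1) h1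
    filter_upwards [h2] with x hx
    rw [hx, hν', d.expFamily_deriv_eq hl (he l hl), BoundedContinuousFunction.smul_apply, unweight,
      smul_eq_mul]
    ring

end JostData

end BOScattering

open BOScattering

theorem lemma4p2 (u : ℝ → ℝ) (s s₁ : ℝ) (hs₁ : 1 / 2 < s₁) (hs : s₁ < s)
    (hu : MemWeightedLp 2 s u) :
    -- the Jost solutions exist and are unique in the weighted space
    (∀ (σ : Side) (l : ℝ), 0 < l →
      ((∃ m, IsJostOne u (s - s₁) σ l m) ∧
        ∀ m m', IsJostOne u (s - s₁) σ l m → IsJostOne u (s - s₁) σ l m' → m =ᵐ[volume] m') ∧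
      ((∃ m, IsJostExp u (s - s₁) σ l m) ∧
        ∀ m m', IsJostExp u (s - s₁) σ l m → IsJostExp u (s - s₁) σ l m' → m =ᵐ[volume] m')) ∧
    -- the relations between them
    ∀ m1 me : Side → ℝ → ℝ → ℂ,
      (∀ (σ : Side) (l : ℝ), 0 < l → IsJostOne u (s - s₁) σ l (m1 σ l)) →
      (∀ (σ : Side) (l : ℝ), 0 < l → IsJostExp u (s - s₁) σ l (me σ l)) →
      ∀ l : ℝ, 0 < l →
        -- the integrals that define the coefficients converge absolutely
        (∀ σ : Side, Integrable (fun x : ℝ => (u x : ℂ) * m1 σ l x) ∧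
          Integrable (fun x : ℝ => (u x : ℂ) * me σ l x)) ∧
        -- the two expressions for `Γ` agree
        1 - Complex.I * pairing u l (me Side.lower l) ≠ 0 ∧
        Gam u l (me Side.upper l) = 1 / (1 - Complex.I * pairing u l (me Side.lower l)) ∧
        -- `m_e(l + 0i) = Γ(l) m_e(l - 0i)`
        (∀ᵐ x : ℝ, me Side.upper l x = Gam u l (me Side.upper l) * me Side.lower l x) ∧
        -- `m_1(l + 0i) - m_1(l - 0i) = β(l) m_e(l - 0i)`
        (∀ᵐ x : ℝ, m1 Side.upper l x - m1 Side.lower l x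
          = bet u l (m1 Side.upper l) * me Side.lower l x) ∧
        -- `e ∂_l (ē m_e(l - 0i)) = f(l) m_1(l - 0i)`
        ∃ D : ℝ → ℂ,
          HasWeightedDerivAt (s - s₁)
            (fun μ x => (starRingEnd ℂ) (planeWave μ x) * me Side.lower μ x) D l ∧
          ∀ᵐ x : ℝ, planeWave l x * D x = fCoeff u l (me Side.lower l) * m1 Side.lower l x := by
  have d : JostData u s s₁ := ⟨hs₁, hs, hu⟩
  refine ⟨fun σ l hl => ⟨⟨⟨_, d.solves_sol σ hl (BoundedContinuousFunction.const ℝ 1)⟩,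
    fun m m' h h' => d.ae_eq_of_solves hl h h'⟩, ⟨⟨_, d.solves_sol σ hl (planeWaveBCF l)⟩,
    fun m m' h h' => d.ae_eq_of_solves hl h h'⟩⟩, fun m1 me h1 he l hl => ?_⟩
  have hΓ := d.mul_Gam_eq_one hl (he Side.upper l hl) (he Side.lower l hl)
  have hne := left_ne_zero_of_mul_eq_one hΓ
  exact ⟨fun σ => ⟨d.integrable_one hl (h1 σ l hl), d.integrable_exp hl (he σ l hl)⟩, hne,
    (eq_div_iff hne).2 (by rw [mul_comm, hΓ]), d.exp_upper_eq hl (he _ l hl) (he _ l hl),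
    d.one_upper_sub_lower hl (h1 _ l hl) (h1 _ l hl) (he _ l hl),
    d.exists_hasWeightedDerivAt Side.lower hl (h1 _ l hl) fun μ hμ => he _ μ hμ⟩
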